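/- Let $(M,g)$ be a spacetime: a smooth $4$-manifold with a smooth metric of signature $(-,+,+,+)$. The following notions are local: each refers to a suitable coordinate system $(x^0,x^1,x^2,x^3)$ around every point. Below, $\hat v, v$ denote $2$-dimensional Lorentzian metrics in $(x^0,x^1)$ and $\hat h, h$ denote $2$-dimensional Riemannian metrics in $(x^2,x^3)$, all smooth, and $\lambda$ is a smooth function. * $g$ is a conformally $2+2$ product if $g=e^{2\lambda}(\hat v+\hat h)$ with $\lambda=\lambda(x^0,\dots,x^3)$. * $g$ is $2+2$ warped in the wide sense if, around every point, either $g=e^{2\lambda}\hat v+h$ with $\lambda=\lambda(x^2,x^3)$ (t-warped), or $g=v+e^{2\lambda}\hat h$ with $\lambda=\lambda(x^0,x^1)$ (s-warped). It is $2+2$ warped if in addition these $\lambda$ have $d\lambda\neq0$ everywhere (non-constant warping factor). Let $W$ be the Weyl tensor and put $G=\frac12\,g\wedge g$, where $(A\wedge B)_{\alpha\beta\mu\nu}=A_{\alpha\mu}B_{\beta\nu}+A_{\beta\nu}B_{\alpha\mu}-A_{\alpha\nu}B_{\beta\mu}-A_{\beta\mu}B_{\alpha\nu}$. Double $2$-forms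 are composed by $(P\circ Q)_{\alpha\beta\rho\sigma}=\frac12P_{\alpha\beta}{}^{\mu\nu}Q_{\mu\nu\rho\sigma}$, with trace $\mathrm{Tr}\,P=\frac12P^{\alpha\beta}{}_{\alpha\beta}$, and $*P=\eta\circ P$, where $\eta$ is the metric volume element of either local orientation. Set $$\rho=-\left(\tfrac1{12}\mathrm{Tr}\,W^3\right)^{1/3}\ \text{(real cube root)},\qquad S=\frac{1}{3\rho}(W-\rho\,G),\qquad \Phi=\mathrm{tr}\,[S(\nabla\cdot S)].$$ Here $(\nabla\cdot S)_{\beta,\mu\nu}=\nabla^\alpha S_{\alpha\beta\mu\nu}$, and for a vector-valued $2$-form $Y$ we write $S(Y)_{\lambda,\alpha\beta}=\frac12S_{\alpha\beta}{}^{\mu\nu}Y_{\lambda,\mu\nu}$ and $(\mathrm{tr}\,Y)_\alpha=g^{\lambda\mu}Y_{\lambda,\mu\alpha}$. Finally $P(\Phi;\Phi)_{\alpha\beta}=P_{\alpha\mu\beta\nu}\Phi^\mu\Phi^\nu$. **Proposition.** Let $g$ be a conformally $2+2$ product which is not conformally flat, in the sense that $W\neq0$ at every point. Then: 1. $g$ is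 $2+2$ warped if and only if $\Phi\neq0$ and $*S(\Phi;\Phi)=0$ everywhere; equivalently, if and only if $\Phi\neq0$ and $*W(\Phi;\Phi)=0$ everywhere. 2. $g$ is $2+2$ warped in the wide sense (points with $d\lambda=0$ allowed) if and only if $*S(\Phi;\Phi)=0$ everywhere; equivalently, if and only if $*W(\Phi;\Phi)=0$ everywhere. -/

import Mathlib

open Set Topology
open scoped Manifold ContDiff

noncomputable section

namespace Warped22

/-- The model space `ℝ⁴` of coordinates. -/
abbrev R4 : Type := EuclideanSpace ℝ (Fin 4)

/-- A smooth Lorentzian metric, signature `(-,+,+,+)`, on a smooth 4-manifold. -/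
structure LorentzMetric (M : Type*) [TopologicalSpace M] [ChartedSpace R4 M]
    [IsManifold (𝓡 4) ∞ M] where
  /-- The bilinear form on each tangent space. -/
  val : ∀ p : M, TangentSpace (𝓡 4) p →L[ℝ] TangentSpace (𝓡 4) p →L[ℝ] ℝ
  symm : ∀ (p : M) (u w : TangentSpace (𝓡 4) p), val p u w = val p w u
  /-- There is an orthonormal frame at each point, its first vector being time-like. -/
  signature : ∀ p : M, ∃ b : Fin 4 → TangentSpace (𝓡 4) p, ∀ i j : Fin 4,
    val p (b i) (b j) = if i = j then (if i = 0 then -1 else 1) else 0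
  smooth : ContMDiff (𝓡 4) ((𝓡 4).prod 𝓘(ℝ, R4 →L[ℝ] R4 →L[ℝ] ℝ)) ∞
    (fun p : M => Bundle.TotalSpace.mk' (R4 →L[ℝ] R4 →L[ℝ] ℝ)
      (E := fun p : M => TangentSpace (𝓡 4) p →L[ℝ] TangentSpace (𝓡 4) p →L[ℝ] ℝ) p (val p))

/-! ### Tensor calculus in a coordinate system

All tensors are given by their covariant components, as functions of the coordinates.
`g` is the matrix of components of the metric. -/

/-- Components of a 1-form. -/
abbrev Tensor1 : Type := Fin 4 → ℝ
/-- Components of a 3-tensor, such as a vector valued 2-form. -/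
abbrev Tensor3 : Type := Fin 4 → Fin 4 → Fin 4 → ℝ
/-- Components of a 4-tensor, such as a double 2-form. -/
abbrev Tensor4 : Type := Fin 4 → Fin 4 → Fin 4 → Fin 4 → ℝ

/-- The partial derivative `∂f/∂xⁱ`. -/
def pd (i : Fin 4) (f : R4 → ℝ) (x : R4) : ℝ :=
  fderiv ℝ f x (EuclideanSpace.single i (1 : ℝ))

section Coordinates

variable (g : R4 → Matrix (Fin 4) (Fin 4) ℝ)

/-- `Γᵏᵢⱼ`. -/
def christoffel (x : R4) (k i j : Fin 4) : ℝ :=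
  (1 / 2) * ∑ l, (g x)⁻¹ k l *
    (pd i (fun y => g y l j) x + pd j (fun y => g y l i) x - pd l (fun y => g y i j) x)

/-- `Rᵃ_{bcd} = ∂_c Γᵃ_{bd} - ∂_d Γᵃ_{bc} + Γᵃ_{ce} Γᵉ_{bd} - Γᵃ_{de} Γᵉ_{bc}`. -/
def riemannUp (x : R4) (a b c d : Fin 4) : ℝ :=
  pd c (fun y => christoffel g y a b d) x - pd d (fun y => christoffel g y a b c) x
    + ∑ e, (christoffel g x a c e * christoffel g x e b d
        - christoffel g x a d e * christoffel g x e b c)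

/-- `R_{abcd}`. -/
def riemann (x : R4) : Tensor4 := fun a b c d => ∑ e, g x a e * riemannUp g x e b c d

/-- `R_{bd} = Rᵃ_{bad}`. -/
def ricci (x : R4) : Matrix (Fin 4) (Fin 4) ℝ := fun b d => ∑ a, riemannUp g x a b a d

/-- The scalar curvature. -/
def scalarCurv (x : R4) : ℝ := ∑ b, ∑ d, (g x)⁻¹ b d * ricci g x b d

end Coordinates

/-- Exterior product of two 2-tensors as double 1-forms:
`(A ∧ B)_{abcd} = A_{ac}B_{bd} + A_{bd}B_{ac} - A_{ad}B_{bc} - A_{bc}B_{ad}`. -/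
def extProd (A B : Matrix (Fin 4) (Fin 4) ℝ) : Tensor4 := fun a b c d =>
  A a c * B b d + A b d * B a c - A a d * B b c - A b c * B a d

/-- Composition of double 2-forms as endomorphisms of the space of 2-forms:
`(P ∘ Q)_{abcd} = ½ P_{ab}^{mn} Q_{mncd}`; `γ` is the metric at the point. -/
def comp (γ : Matrix (Fin 4) (Fin 4) ℝ) (P Q : Tensor4) : Tensor4 := fun a b c d =>
  (1 / 2) * ∑ k, ∑ l, ∑ m, ∑ n, P a b k l * γ⁻¹ k m * γ⁻¹ l n * Q m n c d

/-- Trace of a double 2-form as an endomorphism of the space of 2-forms, `½ P^{ab}_{ab}`. -/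
def trace4 (γ : Matrix (Fin 4) (Fin 4) ℝ) (P : Tensor4) : ℝ :=
  (1 / 2) * ∑ a, ∑ b, ∑ m, ∑ n, γ⁻¹ a m * γ⁻¹ b n * P m n a b

/-- Action of a double 2-form on a vector valued 2-form:
`P(Y)_{l,ab} = ½ P_{ab}^{mn} Y_{l,mn}`. -/
def act3 (γ : Matrix (Fin 4) (Fin 4) ℝ) (P : Tensor4) (Y : Tensor3) : Tensor3 := fun l a b =>
  (1 / 2) * ∑ k, ∑ t, ∑ m, ∑ n, P a b k t * γ⁻¹ k m * γ⁻¹ t n * Y l m n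

/-- Trace of a vector valued 2-form: `(tr Y)_a = g^{lm} Y_{l,ma}`. -/
def trace3 (γ : Matrix (Fin 4) (Fin 4) ℝ) (Y : Tensor3) : Tensor1 := fun a =>
  ∑ l, ∑ m, γ⁻¹ l m * Y l m a

/-- The vector `α^m = g^{mk} α_k`. -/
def raise (γ : Matrix (Fin 4) (Fin 4) ℝ) (α : Tensor1) : Fin 4 → ℝ := fun m =>
  ∑ k, γ⁻¹ m k * α k

/-- `P(x;y)_{ab} = P_{ambn} x^m y^n`. -/
def act22 (P : Tensor4) (x y : Fin 4 → ℝ) : Matrix (Fin 4) (Fin 4) ℝ := fun a b =>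
  ∑ m, ∑ n, P a m b n * x m * y n

/-- The metric volume element `η_{abcd} = √|det g| ε_{abcd}` (for the orientation given by
the coordinates), with `ε` the Levi-Civita symbol. -/
def volElt (γ : Matrix (Fin 4) (Fin 4) ℝ) : Tensor4 := fun a b c d =>
  Real.sqrt |γ.det| * Matrix.det (fun i j : Fin 4 => if ![a, b, c, d] i = j then (1 : ℝ) else 0)

/-- The Hodge dual of a double 2-form, `*P = η ∘ P`. -/
def hodge (γ : Matrix (Fin 4) (Fin 4) ℝ) (P : Tensor4) : Tensor4 := comp γ (volElt γ) P

/-- The real cube root. -/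
def cbrt (t : ℝ) : ℝ := SignType.sign t * |t| ^ (1 / 3 : ℝ)

section Concomitants

variable (g : R4 → Matrix (Fin 4) (Fin 4) ℝ)

/-- `G = ½ g ∧ g`. -/
def bigG (x : R4) : Tensor4 := (1 / 2 : ℝ) • extProd (g x) (g x)

/-- The Weyl tensor `W = Riem - ½ g ∧ Ric + (r/6) G`. -/
def weyl (x : R4) : Tensor4 :=
  riemann g x - (1 / 2 : ℝ) • extProd (g x) (ricci g x) + (scalarCurv g x / 6) • bigG g x

/-- `ρ = -(Tr W³ / 12)^{1/3}`. -/
def rho (x : R4) : ℝ :=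
  -cbrt (trace4 (g x) (comp (g x) (weyl g x) (comp (g x) (weyl g x) (weyl g x))) / 12)

/-- `S = (W - ρ G) / (3 ρ)`. -/
def bigS (x : R4) : Tensor4 := (1 / (3 * rho g x)) • (weyl g x - rho g x • bigG g x)

/-- The divergence `(∇·P)_{b,cd} = ∇^a P_{abcd}` with respect to the Levi-Civita connection. -/
def diverg (P : R4 → Tensor4) (x : R4) : Tensor3 := fun b c d =>
  ∑ e, ∑ a, (g x)⁻¹ e a *
    (pd e (fun y => P y a b c d) x
      - ∑ f, (christoffel g x f e a * P x f b c d + christoffel g x f e b * P x a f c d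
        + christoffel g x f e c * P x a b f d + christoffel g x f e d * P x a b c f))

/-- `Φ = tr [S(∇·S)]`. -/
def phi (x : R4) : Tensor1 := trace3 (g x) (act3 (g x) (bigS g x) (diverg g (bigS g) x))

/-- `*S(Φ;Φ)`. -/
def starSPhi (x : R4) : Matrix (Fin 4) (Fin 4) ℝ :=
  act22 (hodge (g x) (bigS g x)) (raise (g x) (phi g x)) (raise (g x) (phi g x))

/-- `*W(Φ;Φ)`. -/
def starWPhi (x : R4) : Matrix (Fin 4) (Fin 4) ℝ :=
  act22 (hodge (g x) (weyl g x)) (raise (g x) (phi g x)) (raise (g x) (phi g x))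

end Concomitants

/-! ### Block forms of a metric in a coordinate system -/

/-- The first two coordinates. -/
def firstPair (x : R4) : Fin 2 → ℝ := fun i => x (Fin.castAdd 2 i)

/-- The last two coordinates. -/
def lastPair (x : R4) : Fin 2 → ℝ := fun i => x (Fin.natAdd 2 i)

/-- The block diagonal matrix with blocks `A` (indices 0, 1) and `D` (indices 2, 3). -/
def blockDiag (A D : Matrix (Fin 2) (Fin 2) ℝ) : Matrix (Fin 4) (Fin 4) ℝ :=
  (Matrix.fromBlocks A 0 0 D).reindex finSumFinEquiv finSumFinEquiv

/-- A smooth 2-dimensional Lorentzian metric on `s ⊆ ℝ²`. -/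
structure IsLorentz2 (v : (Fin 2 → ℝ) → Matrix (Fin 2) (Fin 2) ℝ) (s : Set (Fin 2 → ℝ)) :
    Prop where
  smooth : ∀ i j, ContDiffOn ℝ ∞ (fun u => v u i j) s
  symm : ∀ u ∈ s, (v u).IsSymm
  det_neg : ∀ u ∈ s, (v u).det < 0

/-- A smooth 2-dimensional Riemannian metric on `s ⊆ ℝ²`. -/
structure IsRiemann2 (h : (Fin 2 → ℝ) → Matrix (Fin 2) (Fin 2) ℝ) (s : Set (Fin 2 → ℝ)) :
    Prop where
  smooth : ∀ i j, ContDiffOn ℝ ∞ (fun u => h u i j) s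
  posDef : ∀ u ∈ s, (h u).PosDef

/-- `g = e^{2λ} (v + h)` on `O`, where `v` is a Lorentzian metric in the first two coordinates,
`h` a Riemannian metric in the last two, and `λ` a function of the four coordinates. -/
def IsConfProductOn (g : R4 → Matrix (Fin 4) (Fin 4) ℝ) (O : Set R4) : Prop :=
  ∃ (v h : (Fin 2 → ℝ) → Matrix (Fin 2) (Fin 2) ℝ) (lam : R4 → ℝ),
    IsLorentz2 v (firstPair '' O) ∧ IsRiemann2 h (lastPair '' O) ∧ ContDiffOn ℝ ∞ lam O ∧
    ∀ x ∈ O, g x = blockDiag (Real.exp (2 * lam x) • v (firstPair x))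
      (Real.exp (2 * lam x) • h (lastPair x))

/-- `g = e^{2λ} v + h` on `O`, where `v` is a Lorentzian metric in the first two coordinates,
and `h` (a Riemannian metric) and `λ` live in the last two.
The proposition `C` is a further condition on the differential of `λ` at each point. -/
def IsTWarpedOn (C : ((Fin 2 → ℝ) →L[ℝ] ℝ) → Prop) (g : R4 → Matrix (Fin 4) (Fin 4) ℝ)
    (O : Set R4) : Prop :=
  ∃ (v h : (Fin 2 → ℝ) → Matrix (Fin 2) (Fin 2) ℝ) (lam : (Fin 2 → ℝ) → ℝ),
    IsLorentz2 v (firstPair '' O) ∧ IsRiemann2 h (lastPair '' O) ∧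
    ContDiffOn ℝ ∞ lam (lastPair '' O) ∧ (∀ u ∈ lastPair '' O, C (fderiv ℝ lam u)) ∧
    ∀ x ∈ O, g x = blockDiag (Real.exp (2 * lam (lastPair x)) • v (firstPair x)) (h (lastPair x))

/-- `g = v + e^{2λ} h` on `O`, where `h` is a Riemannian metric in the last two coordinates,
and `v` (a Lorentzian metric) and `λ` live in the first two.
The proposition `C` is a further condition on the differential of `λ` at each point. -/
def IsSWarpedOn (C : ((Fin 2 → ℝ) →L[ℝ] ℝ) → Prop) (g : R4 → Matrix (Fin 4) (Fin 4) ℝ)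
    (O : Set R4) : Prop :=
  ∃ (v h : (Fin 2 → ℝ) → Matrix (Fin 2) (Fin 2) ℝ) (lam : (Fin 2 → ℝ) → ℝ),
    IsLorentz2 v (firstPair '' O) ∧ IsRiemann2 h (lastPair '' O) ∧
    ContDiffOn ℝ ∞ lam (firstPair '' O) ∧ (∀ u ∈ firstPair '' O, C (fderiv ℝ lam u)) ∧
    ∀ x ∈ O, g x = blockDiag (v (firstPair x)) (Real.exp (2 * lam (firstPair x)) • h (lastPair x))

/-! ### Notions on a spacetime -/

section Spacetime

variable {M : Type*} [TopologicalSpace M] [ChartedSpace R4 M] [IsManifold (𝓡 4) ∞ M]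

/-- The matrix of components `g(∂ᵢ, ∂ⱼ)` in the chart `φ`, as a function of the coordinates. -/
def metricIn (g : LorentzMetric M) (φ : OpenPartialHomeomorph M R4) (x : R4) :
    Matrix (Fin 4) (Fin 4) ℝ := fun i j =>
  g.val (φ.symm x) (mfderiv (𝓡 4) (𝓡 4) φ.symm x (EuclideanSpace.single i (1 : ℝ)))
    (mfderiv (𝓡 4) (𝓡 4) φ.symm x (EuclideanSpace.single j (1 : ℝ)))

/-- A property of components of tensors at a point holds at every point of `M`, in every chart.
It is only used for the vanishing and non-vanishing of a tensor, possibly up to sign, which do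
not depend on the chart. -/
def Everywhere (g : LorentzMetric M)
    (P : (R4 → Matrix (Fin 4) (Fin 4) ℝ) → R4 → Prop) : Prop :=
  ∀ φ ∈ IsManifold.maximalAtlas (𝓡 4) ∞ M, ∀ x ∈ φ.target, P (metricIn g φ) x

/-- Around every point there is a chart in which the metric has the form `P`. -/
def Locally (g : LorentzMetric M)
    (P : (R4 → Matrix (Fin 4) (Fin 4) ℝ) → Set R4 → Prop) : Prop :=
  ∀ p : M, ∃ φ ∈ IsManifold.maximalAtlas (𝓡 4) ∞ M, p ∈ φ.source ∧ P (metricIn g φ) φ.target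

/-- A conformally 2+2 product spacetime. -/
def IsConfProduct (g : LorentzMetric M) : Prop := Locally g IsConfProductOn

/-- A 2+2 (t- or s-)warped spacetime in the wide sense: no condition on the warping factor. -/
def IsWarpedWide (g : LorentzMetric M) : Prop :=
  Locally g fun γ O => IsTWarpedOn (fun _ => True) γ O ∨ IsSWarpedOn (fun _ => True) γ O

/-- A 2+2 (t- or s-)warped spacetime: the warping factor is non-constant, `dλ ≠ 0`. -/
def IsWarped (g : LorentzMetric M) : Prop :=
  Locally g fun γ O => IsTWarpedOn (fun l => l ≠ 0) γ O ∨ IsSWarpedOn (fun l => l ≠ 0) γ O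

/-- Non conformally flat: the Weyl tensor does not vanish. -/
def NonConfFlat (g : LorentzMetric M) : Prop := Everywhere g fun γ x => weyl γ x ≠ 0

end Spacetime

end Warped22

end

noncomputable section

namespace Warped22

/-! ### Partial derivatives -/

/-! Write the metric as γ = e^{2λ}(v̂ + ĥ) = v + h, and let Π = ½ v∧v + ½ h∧h (`pureForm`). Acting
on 2-forms, Π is the projector of rank two onto the span of the area forms of the two factors. All
three concomitants can be computed in terms of Π and dλ.

Curvature: v̂ is parallel for the product metric, so the Ricci identity kills the mixed curvature
(`riemann_mixed`), and the Bianchi identity leaves only multiples of v∧v and h∧h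
(`curvature_eq_of_mixed`). A conformal change adds a term γ∧T (`exists_riemann_eq`), which the Weyl
tensor does not see. Hence W = r(G - 3Π) for a function r (`weyl_eq_of_riemann`). Its eigenvalues
are r, four times, and -2r, twice, so Tr W³ = -12r³ and ρ = r. Where W ≠ 0 this gives S = -Π.

The 1-form: the covariant derivatives of v and h come from the conformal factor alone. Taking the
divergence of -Π and contracting again with S gives Φ = -2dλ (`phi_eq`). So Φ ≠ 0 says that dλ ≠ 0.

The equation: *Π exchanges the two area forms. Therefore *Π(Φ;Φ) is, up to a nonzero factor, the
symmetrised product of two covectors, one built from each factor component of dλ. It vanishes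
exactly when one of the two components does (`act22_hodge_raise_eq_zero_iff`). The G-part of W
contributes η(Φ;Φ) = 0, so *S and *W give the same condition.

From points to neighbourhoods: the equation says at each point that dλ lies in one factor, and the
factor might change from point to point. On a convex box it cannot (`box_alternative`). Then λ
depends on one pair of coordinates only, and e^{2λ} can be absorbed into the 2-metric of that pair,
which is the warped form. Conversely, a warped metric is a conformal product whose λ depends on one
pair.

The conditions are required in every chart while the product form holds only in adapted ones, so the
computation is done for the pullback of a conformal product by a transition map, with the rows of
its Jacobian as a coframe (`IsPulledBack`). -/

theorem pd_congr {f k : R4 → ℝ} {U : Set R4} (hU : IsOpen U) (h : ∀ y ∈ U, f y = k y) (i : Fin 4)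
    {x : R4} (hx : x ∈ U) : pd i f x = pd i k x := by
  have : f =ᶠ[𝓝 x] k := Filter.eventually_of_mem (hU.mem_nhds hx) h
  simp only [pd, this.fderiv_eq]

theorem pd_const (i : Fin 4) (c : ℝ) (x : R4) : pd i (fun _ => c) x = 0 := by
  simp [pd]

theorem pd_add {f k : R4 → ℝ} {x : R4} (hf : DifferentiableAt ℝ f x) (hk : DifferentiableAt ℝ k x)
    (i : Fin 4) : pd i (fun y => f y + k y) x = pd i f x + pd i k x := by
  simp only [pd, fderiv_fun_add hf hk]; rfl

theorem pd_sub {f k : R4 → ℝ} {x : R4} (hf : DifferentiableAt ℝ f x) (hk : DifferentiableAt ℝ k x)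
    (i : Fin 4) : pd i (fun y => f y - k y) x = pd i f x - pd i k x := by
  simp only [pd, fderiv_fun_sub hf hk]; rfl

theorem pd_mul {f k : R4 → ℝ} {x : R4} (hf : DifferentiableAt ℝ f x) (hk : DifferentiableAt ℝ k x)
    (i : Fin 4) : pd i (fun y => f y * k y) x = pd i f x * k x + f x * pd i k x := by
  simp only [pd, fderiv_fun_mul hf hk]
  simp; ring

theorem pd_const_mul {f : R4 → ℝ} {x : R4} (c : ℝ) (hf : DifferentiableAt ℝ f x)
    (i : Fin 4) : pd i (fun y => c * f y) x = c * pd i f x := by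
  rw [pd_mul (differentiableAt_const c) hf, pd_const]; ring

theorem pd_sum {ι : Type*} (s : Finset ι) {f : ι → R4 → ℝ} {x : R4}
    (hf : ∀ j ∈ s, DifferentiableAt ℝ (f j) x)
    (i : Fin 4) : pd i (fun y => ∑ j ∈ s, f j y) x = ∑ j ∈ s, pd i (f j) x := by
  simp only [pd, fderiv_fun_sum hf]
  simp

theorem pd_exp_two_mul {f : R4 → ℝ} {x : R4} (hf : DifferentiableAt ℝ f x) (i : Fin 4) :
    pd i (fun y => Real.exp (2 * f y)) x = Real.exp (2 * f x) * (2 * pd i f x) := by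
  have h2 : DifferentiableAt ℝ (fun y => 2 * f y) x := hf.const_mul 2
  rw [← pd_const_mul 2 hf]
  simp only [pd, fderiv_exp h2]
  simp

theorem contDiffOn_pd {f : R4 → ℝ} {U : Set R4} (hU : IsOpen U) (hf : ContDiffOn ℝ ∞ f U)
    (i : Fin 4) : ContDiffOn ℝ ∞ (fun y => pd i f y) U := by
  have := hf.fderiv_of_isOpen (m := ∞) hU (by simp)
  exact this.clm_apply contDiffOn_const

theorem differentiableAt_of_contDiffOn {E : Type*} [NormedAddCommGroup E] [NormedSpace ℝ E]
    {f : E → ℝ} {U : Set E} (hU : IsOpen U) (hf : ContDiffOn ℝ ∞ f U)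
    {x : E} (hx : x ∈ U) : DifferentiableAt ℝ f x :=
  (hf.contDiffAt (hU.mem_nhds hx)).differentiableAt (by simp)

theorem pd_comm {f : R4 → ℝ} {U : Set R4} (hU : IsOpen U) (hf : ContDiffOn ℝ ∞ f U)
    (i j : Fin 4) {x : R4} (hx : x ∈ U) :
    pd i (fun y => pd j f y) x = pd j (fun y => pd i f y) x := by
  have hc := hf.contDiffAt (hU.mem_nhds hx)
  have hsymm : IsSymmSndFDerivAt ℝ f x := hc.isSymmSndFDerivAt
    (by simp only [minSmoothness_of_isRCLikeNormedField]; exact WithTop.coe_le_coe.2 (le_top : (2 : ℕ∞) ≤ ⊤))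
  have hd : DifferentiableAt ℝ (fderiv ℝ f) x :=
    ((hf.fderiv_of_isOpen (m := ∞) hU (by simp)).contDiffAt (hU.mem_nhds hx)).differentiableAt
      (by simp)
  have key : ∀ a b : Fin 4, pd a (fun y => pd b f y) x =
      fderiv ℝ (fderiv ℝ f) x (EuclideanSpace.single a 1) (EuclideanSpace.single b 1) := by
    intro a b
    simp only [pd]
    rw [fderiv_clm_apply hd (differentiableAt_const _)]
    simp
  rw [key, key, hsymm.eq]

theorem fderiv_apply_eq_sum_pd (f : R4 → ℝ) (x w : R4) :
    fderiv ℝ f x w = ∑ i, w i * pd i f x := by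
  have : w = ∑ i, w i • EuclideanSpace.single i (1 : ℝ) := by
    ext k; simp [Pi.single_apply]
  conv_lhs => rw [this]
  simp [pd]

theorem contDiffOn_det {ι : Type*} [Fintype ι] [DecidableEq ι] {A : R4 → Matrix ι ι ℝ} {U : Set R4}
    (hA : ∀ i j, ContDiffOn ℝ ∞ (fun y => A y i j) U) :
    ContDiffOn ℝ ∞ (fun y => (A y).det) U := by
  simp only [Matrix.det_apply]
  refine ContDiffOn.sum fun σ _ => ?_
  exact ContDiffOn.const_smul _ (contDiffOn_prod fun i _ => hA _ _)

theorem contDiffOn_matrix_inv {ι : Type*} [Fintype ι] [DecidableEq ι] {A : R4 → Matrix ι ι ℝ}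
    {U : Set R4} (hA : ∀ i j, ContDiffOn ℝ ∞ (fun y => A y i j) U)
    (hdet : ∀ y ∈ U, (A y).det ≠ 0) (i j : ι) : ContDiffOn ℝ ∞ (fun y => (A y)⁻¹ i j) U := by
  have h1 : ∀ y, (A y)⁻¹ i j = (A y).det⁻¹ * (A y).adjugate i j := by
    intro y; simp [Matrix.inv_def]
  simp only [h1]
  refine ((contDiffOn_det hA).inv hdet).mul ?_
  -- An entry of the adjugate is the determinant of the matrix with one row replaced by a constant
  -- row.
  simp only [Matrix.adjugate_apply]
  refine contDiffOn_det fun k l => ?_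
  by_cases hk : k = j
  · subst hk; simpa using contDiffOn_const
  · simpa [Matrix.updateRow_ne hk] using hA k l

/-! ### Smooth metrics on an open set of coordinates -/

/-- The components of a nondegenerate smooth metric on the open set `U`. -/
structure IsMetricOn (g : R4 → Matrix (Fin 4) (Fin 4) ℝ) (U : Set R4) : Prop where
  isOpen : IsOpen U
  smooth : ∀ i j, ContDiffOn ℝ ∞ (fun y => g y i j) U
  symm : ∀ y ∈ U, ∀ i j, g y i j = g y j i
  det_ne : ∀ y ∈ U, (g y).det ≠ 0

/-- The 2-tensor `T` is parallel for the Levi-Civita connection of `g`. -/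
def IsParallelOn (g T : R4 → Matrix (Fin 4) (Fin 4) ℝ) (U : Set R4) : Prop :=
  ∀ y ∈ U, ∀ i j k, pd i (fun z => T z j k) y =
    ∑ f, (christoffel g y f i j * T y f k + christoffel g y f i k * T y j f)

/-- Covariant derivative `∇ᵢ T_{jk}`. -/
def cov2 (g T : R4 → Matrix (Fin 4) (Fin 4) ℝ) (y : R4) (i j k : Fin 4) : ℝ :=
  pd i (fun z => T z j k) y -
    ∑ f, (christoffel g y f i j * T y f k + christoffel g y f i k * T y j f)

theorem mul_inv_contract {g : Matrix (Fin 4) (Fin 4) ℝ} (h : g.det ≠ 0) (w : Fin 4 → ℝ)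
    (a : Fin 4) : ∑ k, g a k * ∑ l, g⁻¹ k l * w l = w a := by
  have : g.mulVec (g⁻¹.mulVec w) = w := by
    rw [Matrix.mulVec_mulVec, Matrix.mul_nonsing_inv _ (isUnit_iff_ne_zero.2 h), Matrix.one_mulVec]
  exact congrFun this a

theorem inv_mul_contract {g : Matrix (Fin 4) (Fin 4) ℝ} (h : g.det ≠ 0) (w : Fin 4 → ℝ)
    (a : Fin 4) : ∑ k, g⁻¹ a k * ∑ l, g k l * w l = w a := by
  have : g⁻¹.mulVec (g.mulVec w) = w := by
    rw [Matrix.mulVec_mulVec, Matrix.nonsing_inv_mul _ (isUnit_iff_ne_zero.2 h), Matrix.one_mulVec]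
  exact congrFun this a

/-- The algebra behind the Ricci identity: `D` stands for ∂Γ and `G` for Γ, and the hypothesis
equates the mixed second derivatives of a parallel `T` after each ∂T has been replaced by ΓT. Terms
with one Γ on each index of `T` cancel between the two sides (`e3`); the others assemble into
curvature. -/
theorem curvature_commutator (D : Fin 4 → Fin 4 → Fin 4 → Fin 4 → ℝ) (G : Fin 4 → Fin 4 → Fin 4 → ℝ)
    (T : Matrix (Fin 4) (Fin 4) ℝ) (a b c d : Fin 4)
    (h : ∑ f, (D c d f a * T f b + G f d a * ∑ e, (G e c f * T e b + G e c b * T f e)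
        + D c d f b * T a f + G f d b * ∑ e, (G e c a * T e f + G e c f * T a e)) =
      ∑ f, (D d c f a * T f b + G f c a * ∑ e, (G e d f * T e b + G e d b * T f e)
        + D d c f b * T a f + G f c b * ∑ e, (G e d a * T e f + G e d f * T a e))) :
    ∑ f, ((D c d f a - D d c f a + ∑ e, (G f c e * G e d a - G f d e * G e c a)) * T f b
      + (D c d f b - D d c f b + ∑ e, (G f c e * G e d b - G f d e * G e c b)) * T a f) = 0 := by
  simp only [Finset.mul_sum, Finset.sum_mul, mul_add, add_mul, sub_mul, Finset.sum_add_distrib,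
    Finset.sum_sub_distrib] at h ⊢
  have e1 : ∀ c d a b, ∑ f, ∑ e, G f d a * (G e c f * T e b) = ∑ f, ∑ e, G f c e * G e d a * T f b := by
    intro c d a b
    rw [Finset.sum_comm]
    exact Finset.sum_congr rfl fun _ _ => Finset.sum_congr rfl fun _ _ => by ring
  have e2 : ∀ c d a b, ∑ f, ∑ e, G f d b * (G e c f * T a e) = ∑ f, ∑ e, G f c e * G e d b * T a f := by
    intro c d a b
    rw [Finset.sum_comm]
    exact Finset.sum_congr rfl fun _ _ => Finset.sum_congr rfl fun _ _ => by ring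
  have e3 : ∀ c d a b, ∑ f, ∑ e, G f d a * (G e c b * T f e) = ∑ f, ∑ e, G f c b * (G e d a * T e f) := by
    intro c d a b
    rw [Finset.sum_comm]
    exact Finset.sum_congr rfl fun _ _ => Finset.sum_congr rfl fun _ _ => by ring
  rw [e1, e1, e2, e2, e3 c d a b, e3 d c a b] at h
  linear_combination h

/-! ### Levi-Civita connection and the symmetries of its curvature -/

namespace IsMetricOn

variable {g : R4 → Matrix (Fin 4) (Fin 4) ℝ} {U : Set R4}

theorem pd_symm (hg : IsMetricOn g U) (i j k : Fin 4) {y : R4} (hy : y ∈ U) :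
    pd i (fun z => g z j k) y = pd i (fun z => g z k j) y :=
  pd_congr hg.isOpen (fun z hz => hg.symm z hz j k) i hy

theorem differentiableAt (hg : IsMetricOn g U) (i j : Fin 4) {y : R4} (hy : y ∈ U) :
    DifferentiableAt ℝ (fun z => g z i j) y :=
  differentiableAt_of_contDiffOn hg.isOpen (hg.smooth i j) hy

theorem christoffel_symm (hg : IsMetricOn g U) {y : R4} (hy : y ∈ U) (k i j : Fin 4) :
    christoffel g y k i j = christoffel g y k j i := by
  unfold christoffel
  congr 1
  refine Finset.sum_congr rfl fun l _ => ?_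
  rw [hg.pd_symm l i j hy]; ring

theorem contDiffOn_inv (hg : IsMetricOn g U) (i j : Fin 4) : ContDiffOn ℝ ∞ (fun y => (g y)⁻¹ i j) U :=
  contDiffOn_matrix_inv hg.smooth hg.det_ne i j

theorem contDiffOn_christoffel (hg : IsMetricOn g U) (k i j : Fin 4) :
    ContDiffOn ℝ ∞ (fun y => christoffel g y k i j) U := by
  unfold christoffel
  refine contDiffOn_const.mul (ContDiffOn.sum fun l _ => (hg.contDiffOn_inv k l).mul ?_)
  exact ((contDiffOn_pd hg.isOpen (hg.smooth _ _) _).add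
    (contDiffOn_pd hg.isOpen (hg.smooth _ _) _)).sub (contDiffOn_pd hg.isOpen (hg.smooth _ _) _)

theorem differentiableAt_christoffel (hg : IsMetricOn g U) (k i j : Fin 4) {y : R4} (hy : y ∈ U) :
    DifferentiableAt ℝ (fun y => christoffel g y k i j) y :=
  differentiableAt_of_contDiffOn hg.isOpen (hg.contDiffOn_christoffel k i j) hy

theorem sum_mul_christoffel (hg : IsMetricOn g U) {y : R4} (hy : y ∈ U) (m i j : Fin 4) :
    ∑ k, g y m k * christoffel g y k i j =
      (1 / 2) * (pd i (fun y => g y m j) y + pd j (fun y => g y m i) y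
        - pd m (fun y => g y i j) y) := by
  rw [← mul_inv_contract (hg.det_ne y hy) (fun l => (1 / 2) * (pd i (fun y => g y l j) y +
    pd j (fun y => g y l i) y - pd l (fun y => g y i j) y)) m]
  refine Finset.sum_congr rfl fun k _ => ?_
  unfold christoffel
  rw [Finset.mul_sum]
  congr 1
  exact Finset.sum_congr rfl fun l _ => by ring

/-- Metric compatibility: in the sum of the two lowered Christoffel symbols all derivatives cancel
in pairs except ∂ᵢ g_{jk}. -/
theorem isParallelOn_self (hg : IsMetricOn g U) : IsParallelOn g g U := by
  intro y hy i j k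
  have h1 := hg.sum_mul_christoffel hy k i j
  have h2 := hg.sum_mul_christoffel hy j i k
  rw [Finset.sum_add_distrib]
  have h3 : ∑ f, christoffel g y f i j * g y f k = ∑ f, g y k f * christoffel g y f i j :=
    Finset.sum_congr rfl fun f _ => by rw [hg.symm y hy f k]; ring
  have h4 : ∑ f, christoffel g y f i k * g y j f = ∑ f, g y j f * christoffel g y f i k :=
    Finset.sum_congr rfl fun f _ => by ring
  rw [h3, h4, h1, h2, hg.pd_symm i k j hy, hg.pd_symm j i k hy, hg.pd_symm k i j hy]
  ring

/-- Second partial derivatives of `T` commute, so curvature annihilates a parallel tensor. With `T`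
the metric this is the antisymmetry of R in its first pair; with `T` one factor of a product it
kills the mixed curvature. -/
theorem ricci_identity (hg : IsMetricOn g U) {T : R4 → Matrix (Fin 4) (Fin 4) ℝ}
    (hT : ∀ i j, ContDiffOn ℝ ∞ (fun y => T y i j) U)
    (hpar : IsParallelOn g T U) {x : R4} (hx : x ∈ U) (a b c d : Fin 4) :
    ∑ f, (riemannUp g x f a c d * T x f b + riemannUp g x f b c d * T x a f) = 0 := by
  have dT : ∀ i j, DifferentiableAt ℝ (fun y => T y i j) x := fun i j =>
    differentiableAt_of_contDiffOn hg.isOpen (hT i j) hx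
  have dG : ∀ k i j, DifferentiableAt ℝ (fun y => christoffel g y k i j) x := fun k i j =>
    hg.differentiableAt_christoffel k i j hx
  have key : ∀ c d, pd c (fun y => pd d (fun z => T z a b) y) x =
      ∑ f, (pd c (fun y => christoffel g y f d a) x * T x f b
        + christoffel g x f d a * pd c (fun y => T y f b) x
        + pd c (fun y => christoffel g y f d b) x * T x a f
        + christoffel g x f d b * pd c (fun y => T y a f) x) := by
    intro c d
    rw [pd_congr hg.isOpen (fun y hy => hpar y hy d a b) c hx, pd_sum]
    · refine Finset.sum_congr rfl fun f _ => ?_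
      rw [pd_add ((dG _ _ _).fun_mul (dT _ _)) ((dG _ _ _).fun_mul (dT _ _)),
        pd_mul (dG _ _ _) (dT _ _), pd_mul (dG _ _ _) (dT _ _)]
      ring
    · intro f _
      exact ((dG _ _ _).fun_mul (dT _ _)).fun_add ((dG _ _ _).fun_mul (dT _ _))
  have hcomm := pd_comm hg.isOpen (hT a b) c d hx
  rw [key, key] at hcomm
  simp only [hpar x hx] at hcomm
  have hR : ∀ f a, riemannUp g x f a c d = pd c (fun y => christoffel g y f d a) x
      - pd d (fun y => christoffel g y f c a) x
      + ∑ e, (christoffel g x f c e * christoffel g x e d a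
        - christoffel g x f d e * christoffel g x e c a) := by
    intro f a
    unfold riemannUp
    rw [pd_congr hg.isOpen (fun y hy => hg.christoffel_symm hy f a d) c hx,
      pd_congr hg.isOpen (fun y hy => hg.christoffel_symm hy f a c) d hx]
    congr 1
    refine Finset.sum_congr rfl fun e _ => ?_
    rw [hg.christoffel_symm hx e a d, hg.christoffel_symm hx e a c]
  simp only [hR]
  exact curvature_commutator (fun c d f a => pd c (fun y => christoffel g y f d a) x)
    (fun f c a => christoffel g x f c a) (T x) a b c d hcomm

theorem bianchi (hg : IsMetricOn g U) {x : R4} (hx : x ∈ U) (a b c d : Fin 4) :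
    riemannUp g x a b c d + riemannUp g x a c d b + riemannUp g x a d b c = 0 := by
  have hs : ∀ e i j k, pd e (fun y => christoffel g y k i j) x =
      pd e (fun y => christoffel g y k j i) x := fun e i j k =>
    pd_congr hg.isOpen (fun y hy => hg.christoffel_symm hy k i j) e hx
  have hx' : ∀ e i j, christoffel g x e i j = christoffel g x e j i := fun e i j =>
    hg.christoffel_symm hx e i j
  have hq : ∑ e, (christoffel g x a c e * christoffel g x e b d
        - christoffel g x a d e * christoffel g x e b c)
      + ∑ e, (christoffel g x a d e * christoffel g x e c b
        - christoffel g x a b e * christoffel g x e c d)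
      + ∑ e, (christoffel g x a b e * christoffel g x e d c
        - christoffel g x a c e * christoffel g x e d b) = 0 := by
    rw [← Finset.sum_add_distrib, ← Finset.sum_add_distrib]
    refine Finset.sum_eq_zero fun e _ => ?_
    rw [hx' e d b, hx' e b c, hx' e c d]; ring
  unfold riemannUp
  linear_combination hs c b d a + hs d c b a + hs b d c a + hq

theorem riemannUp_antisymm (g : R4 → Matrix (Fin 4) (Fin 4) ℝ) (x : R4) (a b c d : Fin 4) :
    riemannUp g x a b d c = -riemannUp g x a b c d := by
  have hq : ∑ e, (christoffel g x a d e * christoffel g x e b c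
        - christoffel g x a c e * christoffel g x e b d)
      + ∑ e, (christoffel g x a c e * christoffel g x e b d
        - christoffel g x a d e * christoffel g x e b c) = 0 := by
    rw [← Finset.sum_add_distrib]
    exact Finset.sum_eq_zero fun e _ => by ring
  unfold riemannUp
  linear_combination hq

theorem riemann_antisymm_right {x : R4} (a b c d : Fin 4) :
    riemann g x a b d c = -riemann g x a b c d := by
  simp only [riemann, riemannUp_antisymm g x _ b c d, mul_neg, Finset.sum_neg_distrib]

theorem riemann_antisymm_left (hg : IsMetricOn g U) {x : R4} (hx : x ∈ U) (a b c d : Fin 4) :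
    riemann g x b a c d = -riemann g x a b c d := by
  have h := hg.ricci_identity hg.smooth hg.isParallelOn_self hx a b c d
  rw [Finset.sum_add_distrib] at h
  have h1 : riemann g x b a c d = ∑ f, riemannUp g x f a c d * g x f b :=
    Finset.sum_congr rfl fun f _ => by rw [hg.symm x hx b f]; ring
  have h2 : riemann g x a b c d = ∑ f, riemannUp g x f b c d * g x a f :=
    Finset.sum_congr rfl fun f _ => by ring
  rw [h1, h2]; linarith

theorem riemann_bianchi (hg : IsMetricOn g U) {x : R4} (hx : x ∈ U) (a b c d : Fin 4) :
    riemann g x a b c d + riemann g x a c d b + riemann g x a d b c = 0 := by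
  simp only [riemann]
  rw [← Finset.sum_add_distrib, ← Finset.sum_add_distrib]
  refine Finset.sum_eq_zero fun e _ => ?_
  rw [← mul_add, ← mul_add, hg.bianchi hx, mul_zero]

end IsMetricOn

/-! ### Algebra of double 2-forms at a point -/

theorem extProd_comm (A B : Matrix (Fin 4) (Fin 4) ℝ) : extProd A B = extProd B A := by
  funext a b c d; simp only [extProd]; ring

theorem extProd_add_left (A B C : Matrix (Fin 4) (Fin 4) ℝ) :
    extProd (A + B) C = extProd A C + extProd B C := by
  funext a b c d; simp only [extProd, Matrix.add_apply, Pi.add_apply]; ring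

theorem extProd_add_right (A B C : Matrix (Fin 4) (Fin 4) ℝ) :
    extProd A (B + C) = extProd A B + extProd A C := by
  rw [extProd_comm, extProd_add_left, extProd_comm B, extProd_comm C]

theorem extProd_smul_left (r : ℝ) (A B : Matrix (Fin 4) (Fin 4) ℝ) :
    extProd (r • A) B = r • extProd A B := by
  funext a b c d; simp only [extProd, Matrix.smul_apply, Pi.smul_apply, smul_eq_mul]; ring

theorem extProd_smul_right (r : ℝ) (A B : Matrix (Fin 4) (Fin 4) ℝ) :
    extProd A (r • B) = r • extProd A B := by
  rw [extProd_comm, extProd_smul_left, extProd_comm]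

theorem extProd_zero_left (A : Matrix (Fin 4) (Fin 4) ℝ) : extProd 0 A = 0 := by
  funext a b c d; simp [extProd]

theorem comp_add_left (γ : Matrix (Fin 4) (Fin 4) ℝ) (P Q R : Tensor4) :
    comp γ (P + Q) R = comp γ P R + comp γ Q R := by
  funext a b c d
  simp only [comp, Pi.add_apply, add_mul, Finset.sum_add_distrib, mul_add]

theorem comp_add_right (γ : Matrix (Fin 4) (Fin 4) ℝ) (P Q R : Tensor4) :
    comp γ P (Q + R) = comp γ P Q + comp γ P R := by
  funext a b c d
  simp only [comp, Pi.add_apply, mul_add, Finset.sum_add_distrib]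

theorem comp_smul_left (γ : Matrix (Fin 4) (Fin 4) ℝ) (r : ℝ) (P Q : Tensor4) :
    comp γ (r • P) Q = r • comp γ P Q := by
  funext a b c d
  simp only [comp, Pi.smul_apply, smul_eq_mul, Finset.mul_sum]
  iterate 4 refine Finset.sum_congr rfl fun _ _ => ?_
  ring

theorem comp_smul_right (γ : Matrix (Fin 4) (Fin 4) ℝ) (r : ℝ) (P Q : Tensor4) :
    comp γ P (r • Q) = r • comp γ P Q := by
  funext a b c d
  simp only [comp, Pi.smul_apply, smul_eq_mul, Finset.mul_sum]
  iterate 4 refine Finset.sum_congr rfl fun _ _ => ?_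
  ring

theorem trace4_add (γ : Matrix (Fin 4) (Fin 4) ℝ) (P Q : Tensor4) :
    trace4 γ (P + Q) = trace4 γ P + trace4 γ Q := by
  simp only [trace4, Pi.add_apply, mul_add, Finset.sum_add_distrib]

theorem trace4_smul (γ : Matrix (Fin 4) (Fin 4) ℝ) (r : ℝ) (P : Tensor4) :
    trace4 γ (r • P) = r * trace4 γ P := by
  simp only [trace4, Pi.smul_apply, smul_eq_mul, Finset.mul_sum]
  iterate 4 refine Finset.sum_congr rfl fun _ _ => ?_
  ring

theorem sum_contract (I : Matrix (Fin 4) (Fin 4) ℝ) (p q r s : Fin 4 → ℝ) :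
    ∑ k, ∑ l, ∑ m, ∑ n, p k * q l * I k m * I l n * (r m * s n) =
      (∑ k, ∑ m, p k * I k m * r m) * ∑ l, ∑ n, q l * I l n * s n := by
  simp only [Finset.sum_mul_sum]
  iterate 4 refine Finset.sum_congr rfl fun _ _ => ?_
  ring

theorem mul_mul_apply_eq_sum (A I C : Matrix (Fin 4) (Fin 4) ℝ) (a c : Fin 4) :
    ∑ k, ∑ m, A a k * I k m * C m c = (A * I * C) a c := by
  simp only [Matrix.mul_apply, Finset.sum_mul]
  exact Finset.sum_comm

/-- Of the sixteen products, each contracts either index by index (`e`) or crosswise (`e'`), and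
each contraction factors into two matrix products. Every identity between v∧v, h∧h and G below is a
case of this law. -/
theorem comp_extProd (γ A B C D : Matrix (Fin 4) (Fin 4) ℝ) :
    comp γ (extProd A B) (extProd C D) =
      extProd (A * γ⁻¹ * C) (B * γ⁻¹ * D) + extProd (A * γ⁻¹ * D) (B * γ⁻¹ * C) := by
  funext a b c d
  have e : ∀ (A B C D : Matrix (Fin 4) (Fin 4) ℝ) (a b c d : Fin 4),
      ∑ k, ∑ l, ∑ m, ∑ n, A a k * B b l * γ⁻¹ k m * γ⁻¹ l n * (C m c * D n d) =
        (A * γ⁻¹ * C) a c * (B * γ⁻¹ * D) b d := by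
    intro A B C D a b c d
    rw [← mul_mul_apply_eq_sum, ← mul_mul_apply_eq_sum]
    exact sum_contract γ⁻¹ (A a) (B b) (fun m => C m c) (fun n => D n d)
  have e' : ∀ (A B C D : Matrix (Fin 4) (Fin 4) ℝ) (a b c d : Fin 4),
      ∑ k, ∑ l, ∑ m, ∑ n, A a l * B b k * γ⁻¹ k m * γ⁻¹ l n * (C m c * D n d) =
        (B * γ⁻¹ * C) b c * (A * γ⁻¹ * D) a d := by
    intro A B C D a b c d
    rw [← e]
    iterate 4 refine Finset.sum_congr rfl fun _ _ => ?_
    ring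
  simp only [Pi.add_apply, extProd]
  have split : ∀ k l m n, (A a k * B b l + A b l * B a k - A a l * B b k - A b k * B a l)
        * γ⁻¹ k m * γ⁻¹ l n * (C m c * D n d + C n d * D m c - C m d * D n c - C n c * D m d) =
      (A a k * B b l * γ⁻¹ k m * γ⁻¹ l n * (C m c * D n d)
        + A a k * B b l * γ⁻¹ k m * γ⁻¹ l n * (D m c * C n d)
        - A a k * B b l * γ⁻¹ k m * γ⁻¹ l n * (C m d * D n c)
        - A a k * B b l * γ⁻¹ k m * γ⁻¹ l n * (D m d * C n c))
      + (B a k * A b l * γ⁻¹ k m * γ⁻¹ l n * (C m c * D n d)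
        + B a k * A b l * γ⁻¹ k m * γ⁻¹ l n * (D m c * C n d)
        - B a k * A b l * γ⁻¹ k m * γ⁻¹ l n * (C m d * D n c)
        - B a k * A b l * γ⁻¹ k m * γ⁻¹ l n * (D m d * C n c))
      - (A a l * B b k * γ⁻¹ k m * γ⁻¹ l n * (C m c * D n d)
        + A a l * B b k * γ⁻¹ k m * γ⁻¹ l n * (D m c * C n d)
        - A a l * B b k * γ⁻¹ k m * γ⁻¹ l n * (C m d * D n c)
        - A a l * B b k * γ⁻¹ k m * γ⁻¹ l n * (D m d * C n c))
      - (B a l * A b k * γ⁻¹ k m * γ⁻¹ l n * (C m c * D n d)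
        + B a l * A b k * γ⁻¹ k m * γ⁻¹ l n * (D m c * C n d)
        - B a l * A b k * γ⁻¹ k m * γ⁻¹ l n * (C m d * D n c)
        - B a l * A b k * γ⁻¹ k m * γ⁻¹ l n * (D m d * C n c)) := by
    intros; ring
  simp only [comp, extProd, split, Finset.sum_add_distrib, Finset.sum_sub_distrib, e, e']
  ring

/-- The contraction `γ^{ac} P_{abcd}`. -/
def ricciContr (γ : Matrix (Fin 4) (Fin 4) ℝ) (P : Tensor4) : Matrix (Fin 4) (Fin 4) ℝ :=
  fun b d => ∑ a, ∑ c, γ⁻¹ a c * P a b c d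

theorem ricciContr_add (γ : Matrix (Fin 4) (Fin 4) ℝ) (P Q : Tensor4) :
    ricciContr γ (P + Q) = ricciContr γ P + ricciContr γ Q := by
  funext b d
  simp only [ricciContr, Pi.add_apply, mul_add, Finset.sum_add_distrib, Matrix.add_apply]

theorem ricciContr_smul (γ : Matrix (Fin 4) (Fin 4) ℝ) (r : ℝ) (P : Tensor4) :
    ricciContr γ (r • P) = r • ricciContr γ P := by
  funext b d
  simp only [ricciContr, Pi.smul_apply, smul_eq_mul, Matrix.smul_apply, Finset.mul_sum]
  iterate 2 refine Finset.sum_congr rfl fun _ _ => ?_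
  ring

/-- Full contraction of a 2-tensor with the inverse metric. -/
def mtrace (γ A : Matrix (Fin 4) (Fin 4) ℝ) : ℝ := ∑ a, ∑ c, γ⁻¹ a c * A a c

theorem mtrace_add (γ A B : Matrix (Fin 4) (Fin 4) ℝ) :
    mtrace γ (A + B) = mtrace γ A + mtrace γ B := by
  simp only [mtrace, Matrix.add_apply, mul_add, Finset.sum_add_distrib]

theorem mtrace_smul (γ : Matrix (Fin 4) (Fin 4) ℝ) (r : ℝ) (A : Matrix (Fin 4) (Fin 4) ℝ) :
    mtrace γ (r • A) = r * mtrace γ A := by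
  simp only [mtrace, Matrix.smul_apply, smul_eq_mul, Finset.mul_sum]
  iterate 2 refine Finset.sum_congr rfl fun _ _ => ?_
  ring

theorem ricciContr_extProd {γ : Matrix (Fin 4) (Fin 4) ℝ} (hγ : γ⁻¹.IsSymm)
    (A B : Matrix (Fin 4) (Fin 4) ℝ) :
    ricciContr γ (extProd A B) = mtrace γ A • B + mtrace γ B • A
      - B * γ⁻¹ * A - A * γ⁻¹ * B := by
  funext b d
  have e : ∀ A B : Matrix (Fin 4) (Fin 4) ℝ,
      ∑ a, ∑ c, A b c * γ⁻¹ a c * B a d = (A * γ⁻¹ * B) b d := by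
    intro A B
    rw [← mul_mul_apply_eq_sum, Finset.sum_comm]
    simp only [hγ.apply]
  simp only [Matrix.sub_apply, Matrix.add_apply, Matrix.smul_apply, smul_eq_mul, ← e, mtrace,
    Finset.sum_mul, ricciContr, extProd, ← Finset.sum_add_distrib, ← Finset.sum_sub_distrib]
  iterate 2 refine Finset.sum_congr rfl fun _ _ => ?_
  ring

theorem trace4_eq {γ : Matrix (Fin 4) (Fin 4) ℝ} (hγ : γ⁻¹.IsSymm) (P : Tensor4) :
    trace4 γ P = (1 / 2) * mtrace γ (ricciContr γ P) := by
  simp only [trace4, mtrace, ricciContr, Finset.mul_sum]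
  rw [Finset.sum_comm]
  conv_rhs => rw [Finset.sum_comm]
  refine Finset.sum_congr rfl fun b _ => ?_
  conv_rhs => 
    rw [Finset.sum_congr rfl fun n _ => Finset.sum_comm]
    rw [Finset.sum_comm]
  refine Finset.sum_congr rfl fun a _ => ?_
  rw [Finset.sum_comm]
  refine Finset.sum_congr rfl fun n _ => ?_
  refine Finset.sum_congr rfl fun m _ => ?_
  rw [hγ.apply m a, hγ.apply n b]; ring

/-- `γ = v + h` is an orthogonal splitting of the metric `γ` into two metrics of rank two. -/
structure IsSplit (γ v h : Matrix (Fin 4) (Fin 4) ℝ) : Prop where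
  eq_add : γ = v + h
  det_ne : γ.det ≠ 0
  symm_left : v.IsSymm
  symm_right : h.IsSymm
  left_left : v * γ⁻¹ * v = v
  left_right : v * γ⁻¹ * h = 0
  right_left : h * γ⁻¹ * v = 0
  right_right : h * γ⁻¹ * h = h
  mtrace_left : mtrace γ v = 2
  mtrace_right : mtrace γ h = 2

/-! ### Projectors and traces on 2-forms for an orthogonal splitting -/

namespace IsSplit

variable {γ v h : Matrix (Fin 4) (Fin 4) ℝ}

theorem swap (H : IsSplit γ v h) : IsSplit γ h v :=
  ⟨by rw [H.eq_add, add_comm], H.det_ne, H.symm_right, H.symm_left, H.right_right, H.right_left,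
    H.left_right, H.left_left, H.mtrace_right, H.mtrace_left⟩

theorem symm (H : IsSplit γ v h) : γ.IsSymm := by
  rw [H.eq_add]; exact H.symm_left.add H.symm_right

theorem symm_inv (H : IsSplit γ v h) : γ⁻¹.IsSymm := by
  rw [Matrix.IsSymm, Matrix.transpose_nonsing_inv, H.symm.eq]

theorem self_mul_inv (H : IsSplit γ v h) : γ * γ⁻¹ = 1 :=
  Matrix.mul_nonsing_inv _ (isUnit_iff_ne_zero.2 H.det_ne)

theorem inv_mul_self (H : IsSplit γ v h) : γ⁻¹ * γ = 1 :=
  Matrix.nonsing_inv_mul _ (isUnit_iff_ne_zero.2 H.det_ne)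

/-- The double 2-form `½ v ∧ v + ½ h ∧ h`. -/
def pureForm (v h : Matrix (Fin 4) (Fin 4) ℝ) : Tensor4 :=
  (1 / 2 : ℝ) • extProd v v + (1 / 2 : ℝ) • extProd h h

/-- The identity of the space of 2-forms. -/
def idForm (γ : Matrix (Fin 4) (Fin 4) ℝ) : Tensor4 := (1 / 2 : ℝ) • extProd γ γ

theorem mtrace_self (H : IsSplit γ v h) : mtrace γ γ = 4 := by
  conv_lhs => arg 2; rw [H.eq_add]
  rw [mtrace_add, H.mtrace_left, H.mtrace_right]; norm_num

/-- Each of ½ v∧v and ½ h∧h is idempotent and their compositions vanish, because v γ⁻¹ h = 0.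
Together with trace 2 this makes the pure part a projector of rank two. -/
theorem comp_pure_pure (H : IsSplit γ v h) :
    comp γ (pureForm v h) (pureForm v h) = pureForm v h := by
  simp only [pureForm, comp_add_left, comp_add_right, comp_smul_left, comp_smul_right,
    comp_extProd, H.left_left, H.left_right, H.right_left, H.right_right, extProd_zero_left]
  module

theorem comp_id_left (H : IsSplit γ v h) (A B : Matrix (Fin 4) (Fin 4) ℝ) :
    comp γ (idForm γ) (extProd A B) = extProd A B := by
  simp only [idForm, comp_smul_left, comp_extProd, H.self_mul_inv, one_mul, extProd_comm B A]
  module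

theorem comp_id_right (H : IsSplit γ v h) (A B : Matrix (Fin 4) (Fin 4) ℝ) :
    comp γ (extProd A B) (idForm γ) = extProd A B := by
  simp only [idForm, comp_smul_right, comp_extProd, mul_assoc, H.inv_mul_self, mul_one]
  module

theorem comp_id_id (H : IsSplit γ v h) : comp γ (idForm γ) (idForm γ) = idForm γ := by
  conv_lhs => arg 3; rw [idForm]
  rw [comp_smul_right, H.comp_id_left]; rfl

theorem comp_id_pure (H : IsSplit γ v h) : comp γ (idForm γ) (pureForm v h) = pureForm v h := by
  simp only [pureForm, comp_add_right, comp_smul_right, H.comp_id_left]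

theorem comp_pure_id (H : IsSplit γ v h) : comp γ (pureForm v h) (idForm γ) = pureForm v h := by
  simp only [pureForm, comp_add_left, comp_smul_left, H.comp_id_right]

theorem ricciContr_extProd_left (H : IsSplit γ v h) : ricciContr γ (extProd v v) = (2 : ℝ) • v := by
  rw [ricciContr_extProd H.symm_inv, H.mtrace_left, H.left_left]; module

theorem ricciContr_extProd_right (H : IsSplit γ v h) :
    ricciContr γ (extProd h h) = (2 : ℝ) • h :=
  H.swap.ricciContr_extProd_left

theorem ricciContr_extProd_self (H : IsSplit γ v h) (T : Matrix (Fin 4) (Fin 4) ℝ) :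
    ricciContr γ (extProd γ T) = (2 : ℝ) • T + mtrace γ T • γ := by
  rw [ricciContr_extProd H.symm_inv, H.mtrace_self, mul_assoc, H.inv_mul_self, H.self_mul_inv,
    mul_one, one_mul]; module

theorem trace4_pure (H : IsSplit γ v h) : trace4 γ (pureForm v h) = 2 := by
  rw [trace4_eq H.symm_inv, pureForm, ricciContr_add, ricciContr_smul, ricciContr_smul,
    H.ricciContr_extProd_left, H.ricciContr_extProd_right]
  simp only [mtrace_add, mtrace_smul, H.mtrace_left, H.mtrace_right]; norm_num

theorem trace4_id (H : IsSplit γ v h) : trace4 γ (idForm γ) = 6 := by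
  rw [trace4_eq H.symm_inv, idForm, ricciContr_smul, H.ricciContr_extProd_self]
  simp only [mtrace_add, mtrace_smul, H.mtrace_self]; norm_num

/-- With Π² = Π one has (1 - 3Π)² = 1 + 3Π and (1 - 3Π)³ = 1 - 9Π, of trace 6 - 18 = -12. This is
the source of the 12 in the definition of ρ. -/
theorem trace4_cube (H : IsSplit γ v h) (r : ℝ) {W : Tensor4}
    (hW : W = r • (idForm γ + (-3 : ℝ) • pureForm v h)) :
    trace4 γ (comp γ W (comp γ W W)) = -12 * r ^ 3 := by
  have h2 : comp γ W W = r ^ 2 • (idForm γ + (3 : ℝ) • pureForm v h) := by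
    simp only [hW, comp_add_left, comp_add_right, comp_smul_left, comp_smul_right, H.comp_id_id,
      H.comp_id_pure, H.comp_pure_id, H.comp_pure_pure]
    module
  have h3 : comp γ W (comp γ W W) = r ^ 3 • (idForm γ + (-9 : ℝ) • pureForm v h) := by
    rw [h2]
    simp only [hW, comp_add_left, comp_add_right, comp_smul_left, comp_smul_right, H.comp_id_id,
      H.comp_id_pure, H.comp_pure_id, H.comp_pure_pure]
    module
  rw [h3]
  simp only [trace4_smul, trace4_add, H.trace4_pure, H.trace4_id]
  ring

end IsSplit

theorem cbrt_neg_pow (r : ℝ) : cbrt (-r ^ 3) = -r := by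
  unfold cbrt
  have habs : |-r ^ 3| ^ (1 / 3 : ℝ) = |r| := by
    rw [abs_neg, abs_pow, ← Real.rpow_natCast, ← Real.rpow_mul (abs_nonneg r)]
    norm_num
  rw [habs]
  rcases lt_trichotomy r 0 with h | h | h
  · have : 0 < -r ^ 3 := by
      have := pow_pos (neg_pos.2 h) 3
      nlinarith
    rw [sign_pos this, abs_of_neg h]; simp
  · subst h; simp
  · have : -r ^ 3 < 0 := by
      have := pow_pos h 3
      linarith
    rw [sign_neg this, abs_of_pos h]; simp

/-! ### The Weyl tensor of a curvature tensor with pure blocks -/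

theorem ricci_eq_ricciContr {g : R4 → Matrix (Fin 4) (Fin 4) ℝ} {x : R4} (hs : (g x)⁻¹.IsSymm)
    (hd : (g x).det ≠ 0) : ricci g x = ricciContr (g x) (riemann g x) := by
  funext b d
  simp only [ricci, ricciContr, riemann]
  rw [Finset.sum_comm]
  refine Finset.sum_congr rfl fun c _ => ?_
  rw [← inv_mul_contract hd (fun e => riemannUp g x e b c d) c]
  exact Finset.sum_congr rfl fun a _ => by rw [hs.apply a c]

/-- The trace corrections in W remove g∧T entirely, so `T` may be anything: it will hold the effect
of the conformal factor. What is left is ((k+l)/3)(v∧v + h∧h - v∧h), which is rewritten through G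
and Π. -/
theorem weyl_eq_of_riemann {g : R4 → Matrix (Fin 4) (Fin 4) ℝ} {x : R4}
    {v h T : Matrix (Fin 4) (Fin 4) ℝ} {k l : ℝ} (H : IsSplit (g x) v h)
    (hR : riemann g x = k • extProd v v + l • extProd h h + extProd (g x) T) :
    weyl g x = (-(k + l) / 3) • (IsSplit.idForm (g x) + (-3 : ℝ) • IsSplit.pureForm v h) := by
  have hric : ricci g x = (2 * k) • v + (2 * l) • h + (2 : ℝ) • T + mtrace (g x) T • g x := by
    rw [ricci_eq_ricciContr H.symm_inv H.det_ne, hR]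
    simp only [ricciContr_add, ricciContr_smul, H.ricciContr_extProd_left,
      H.ricciContr_extProd_right, H.ricciContr_extProd_self]
    module
  have hsc : scalarCurv g x = 4 * k + 4 * l + 6 * mtrace (g x) T := by
    change mtrace (g x) (ricci g x) = _
    rw [hric]
    simp only [mtrace_add, mtrace_smul, H.mtrace_left, H.mtrace_right, H.mtrace_self]
    ring
  have h1 : extProd (g x) v = extProd v v + extProd v h := by
    rw [extProd_comm, ← extProd_add_right, ← H.eq_add]
  have h2 : extProd (g x) h = extProd h h + extProd v h := by
    rw [extProd_comm v h, extProd_comm, add_comm (extProd h h), ← extProd_add_right, ← H.eq_add]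
  have h3 : extProd (g x) (g x) = extProd v v + extProd h h + (2 : ℝ) • extProd v h := by
    conv_lhs => arg 2; rw [H.eq_add]
    rw [extProd_add_right, h1, h2]; module
  rw [weyl, hric, hsc, hR, bigG]
  simp only [IsSplit.idForm, IsSplit.pureForm, extProd_add_right, extProd_smul_right, h1, h2, h3]
  module

theorem rho_eq {g : R4 → Matrix (Fin 4) (Fin 4) ℝ} {x : R4} {v h : Matrix (Fin 4) (Fin 4) ℝ}
    {r : ℝ} (H : IsSplit (g x) v h)
    (hW : weyl g x = r • (IsSplit.idForm (g x) + (-3 : ℝ) • IsSplit.pureForm v h)) :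
    rho g x = r := by
  have : -12 * r ^ 3 / 12 = -r ^ 3 := by ring
  rw [rho, H.trace4_cube r hW, this, cbrt_neg_pow, neg_neg]

/-- W - rG = -3rΠ, and division by 3r is where the Weyl tensor has to be nonzero. -/
theorem bigS_eq {g : R4 → Matrix (Fin 4) (Fin 4) ℝ} {x : R4} {v h : Matrix (Fin 4) (Fin 4) ℝ}
    {r : ℝ} (H : IsSplit (g x) v h)
    (hW : weyl g x = r • (IsSplit.idForm (g x) + (-3 : ℝ) • IsSplit.pureForm v h)) (hr : r ≠ 0) :
    bigS g x = -IsSplit.pureForm v h := by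
  have hG : bigG g x = IsSplit.idForm (g x) := rfl
  rw [bigS, rho_eq H hW, hG, hW]
  have : r • (IsSplit.idForm (g x) + (-3 : ℝ) • IsSplit.pureForm v h)
      - r • IsSplit.idForm (g x) = (3 * r) • (-IsSplit.pureForm v h) := by module
  rw [this, smul_smul, one_div, inv_mul_cancel₀ (by simpa using hr), one_smul]

/-! ### Adapted frames -/

/-- The 2-form `θᴬ ∧ θᴮ`, where `θᴬ` is the `A`-th row of `J`. -/
def wedgeRow (J : Matrix (Fin 4) (Fin 4) ℝ) (A B a b : Fin 4) : ℝ := J A a * J B b - J B a * J A b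

theorem blockDiag_apply (A D : Matrix (Fin 2) (Fin 2) ℝ) :
    blockDiag A D = !![A 0 0, A 0 1, 0, 0; A 1 0, A 1 1, 0, 0; 0, 0, D 0 0, D 0 1; 0, 0, D 1 0, D 1 1] := by
  ext i j
  fin_cases i <;> fin_cases j <;> rfl

theorem blockDiag_mul (A D A' D' : Matrix (Fin 2) (Fin 2) ℝ) :
    blockDiag A D * blockDiag A' D' = blockDiag (A * A') (D * D') := by
  simp [blockDiag, Matrix.reindex_apply, Matrix.submatrix_mul_equiv, Matrix.fromBlocks_multiply]

theorem blockDiag_one : blockDiag 1 1 = 1 := by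
  simp [blockDiag, Matrix.fromBlocks_one]

theorem blockDiag_add (A D A' D' : Matrix (Fin 2) (Fin 2) ℝ) :
    blockDiag A D + blockDiag A' D' = blockDiag (A + A') (D + D') := by
  ext i j
  fin_cases i <;> fin_cases j <;> simp [blockDiag_apply]

theorem blockDiag_smul (r : ℝ) (A D : Matrix (Fin 2) (Fin 2) ℝ) :
    r • blockDiag A D = blockDiag (r • A) (r • D) := by
  have : Matrix.fromBlocks (r • A) 0 0 (r • D) = r • Matrix.fromBlocks A 0 0 D := by
    rw [Matrix.fromBlocks_smul]; simp
  simp [blockDiag, this, Matrix.reindex_apply]; rfl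

theorem blockDiag_zero : blockDiag 0 0 = 0 := by
  simp [blockDiag, Matrix.fromBlocks_zero]

theorem blockDiag_inv {A D : Matrix (Fin 2) (Fin 2) ℝ} (hA : A.det ≠ 0) (hD : D.det ≠ 0) :
    (blockDiag A D)⁻¹ = blockDiag A⁻¹ D⁻¹ := by
  refine Matrix.inv_eq_right_inv ?_
  rw [blockDiag_mul, Matrix.mul_nonsing_inv _ (isUnit_iff_ne_zero.2 hA),
    Matrix.mul_nonsing_inv _ (isUnit_iff_ne_zero.2 hD), blockDiag_one]

theorem blockDiag_det (A D : Matrix (Fin 2) (Fin 2) ℝ) :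
    (blockDiag A D).det = A.det * D.det := by
  simp [blockDiag]

theorem blockDiag_transpose (A D : Matrix (Fin 2) (Fin 2) ℝ) :
    (blockDiag A D).transpose = blockDiag A.transpose D.transpose := by
  simp [blockDiag, Matrix.fromBlocks_transpose, Matrix.reindex_apply]

theorem blockDiag_trace (A D : Matrix (Fin 2) (Fin 2) ℝ) :
    (blockDiag A D).trace = A.trace + D.trace := by
  simp [blockDiag_apply, Matrix.trace, Fin.sum_univ_four, Fin.sum_univ_two]
  ring

/-- The pullback `Jᵀ X J`. -/
def pullMat (J X : Matrix (Fin 4) (Fin 4) ℝ) : Matrix (Fin 4) (Fin 4) ℝ := J.transpose * X * J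

theorem pullMat_inv (J X : Matrix (Fin 4) (Fin 4) ℝ) :
    (pullMat J X)⁻¹ = J⁻¹ * X⁻¹ * J⁻¹.transpose := by
  simp only [pullMat, Matrix.mul_inv_rev, Matrix.transpose_nonsing_inv, mul_assoc]

theorem mtrace_eq_trace {γ : Matrix (Fin 4) (Fin 4) ℝ} (hs : γ⁻¹.IsSymm)
    (A : Matrix (Fin 4) (Fin 4) ℝ) : mtrace γ A = (γ⁻¹ * A).trace := by
  simp only [mtrace, Matrix.trace, Matrix.diag_apply, Matrix.mul_apply]
  rw [Finset.sum_comm]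
  iterate 2 refine Finset.sum_congr rfl fun _ _ => ?_
  rw [hs.apply]

/-! ### Splittings and curvature in the coframe of rows of `J` -/

section frame
variable {J : Matrix (Fin 4) (Fin 4) ℝ} {V H : Matrix (Fin 2) (Fin 2) ℝ}

theorem pull_mul_inv_mul (hJ : J.det ≠ 0) (hV : V.det ≠ 0) (hH : H.det ≠ 0)
    (X Y : Matrix (Fin 4) (Fin 4) ℝ) :
    pullMat J X * (pullMat J (blockDiag V H))⁻¹ * pullMat J Y =
      pullMat J (X * blockDiag V⁻¹ H⁻¹ * Y) := by
  have h1 : J * J⁻¹ = 1 := Matrix.mul_nonsing_inv _ (isUnit_iff_ne_zero.2 hJ)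
  have h2 : J⁻¹.transpose * J.transpose = 1 := by rw [← Matrix.transpose_mul, h1]; simp
  rw [pullMat_inv, blockDiag_inv hV hH]
  calc _ = J.transpose * X * (J * J⁻¹) * blockDiag V⁻¹ H⁻¹ * (J⁻¹.transpose * J.transpose) * Y * J := by
        simp only [pullMat, mul_assoc]
    _ = _ := by rw [h1, h2]; simp only [pullMat, mul_assoc, mul_one]

theorem isSplit_pullMat (hJ : J.det ≠ 0) (hV : V.det ≠ 0) (hH : H.det ≠ 0) (hVs : V.IsSymm)
    (hHs : H.IsSymm) : IsSplit (pullMat J (blockDiag V H)) (pullMat J (blockDiag V 0))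
      (pullMat J (blockDiag 0 H)) := by
  have hV' : V * V⁻¹ = 1 := Matrix.mul_nonsing_inv _ (isUnit_iff_ne_zero.2 hV)
  have hH' : H * H⁻¹ = 1 := Matrix.mul_nonsing_inv _ (isUnit_iff_ne_zero.2 hH)
  have hV'' : V⁻¹ * V = 1 := Matrix.nonsing_inv_mul _ (isUnit_iff_ne_zero.2 hV)
  have hH'' : H⁻¹ * H = 1 := Matrix.nonsing_inv_mul _ (isUnit_iff_ne_zero.2 hH)
  have h1 : J⁻¹ * J = 1 := Matrix.nonsing_inv_mul _ (isUnit_iff_ne_zero.2 hJ)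
  have h1' : J * J⁻¹ = 1 := Matrix.mul_nonsing_inv _ (isUnit_iff_ne_zero.2 hJ)
  have h2 : J⁻¹.transpose * J.transpose = 1 := by rw [← Matrix.transpose_mul, h1']; simp
  have hsymm : ∀ X : Matrix (Fin 4) (Fin 4) ℝ, X.IsSymm → (pullMat J X).IsSymm := by
    intro X hX
    simp [Matrix.IsSymm, pullMat, Matrix.transpose_mul, hX.eq, mul_assoc]
  have hb : ∀ A D : Matrix (Fin 2) (Fin 2) ℝ, A.IsSymm → D.IsSymm → (blockDiag A D).IsSymm := by
    intro A D hA hD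
    rw [Matrix.IsSymm, blockDiag_transpose, hA.eq, hD.eq]
  have h0 : (0 : Matrix (Fin 2) (Fin 2) ℝ).IsSymm := Matrix.isSymm_zero
  have hinv : (pullMat J (blockDiag V H))⁻¹.IsSymm := by
    rw [Matrix.IsSymm, Matrix.transpose_nonsing_inv, (hsymm _ (hb _ _ hVs hHs)).eq]
  have htr : ∀ A D : Matrix (Fin 2) (Fin 2) ℝ,
      mtrace (pullMat J (blockDiag V H)) (pullMat J (blockDiag A D)) =
        (V⁻¹ * A).trace + (H⁻¹ * D).trace := by
    intro A D
    rw [mtrace_eq_trace hinv, pullMat_inv, blockDiag_inv hV hH, ← blockDiag_trace, ← blockDiag_mul]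
    calc _ = (J⁻¹ * (blockDiag V⁻¹ H⁻¹ * (J⁻¹.transpose * J.transpose) * blockDiag A D * J)).trace := by
          simp only [pullMat, mul_assoc]
      _ = _ := by rw [h2, Matrix.trace_mul_comm, mul_assoc, h1']; simp
  refine ⟨?_, ?_, hsymm _ (hb _ _ hVs h0), hsymm _ (hb _ _ h0 hHs), ?_, ?_, ?_, ?_, ?_, ?_⟩
  · have : blockDiag V H = blockDiag V 0 + blockDiag 0 H := by rw [blockDiag_add]; simp
    rw [this]; simp only [pullMat, mul_add, add_mul]
  · simp only [pullMat, Matrix.det_mul, Matrix.det_transpose, blockDiag_det]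
    exact mul_ne_zero (mul_ne_zero hJ (mul_ne_zero hV hH)) hJ
  · rw [pull_mul_inv_mul hJ hV hH]; simp [blockDiag_mul, hV']
  · rw [pull_mul_inv_mul hJ hV hH]; simp [blockDiag_mul, blockDiag_zero, pullMat]
  · rw [pull_mul_inv_mul hJ hV hH]; simp [blockDiag_mul, blockDiag_zero, pullMat]
  · rw [pull_mul_inv_mul hJ hV hH]; simp [blockDiag_mul, hH']
  · rw [htr, hV'']; simp
  · rw [htr, hH'']; simp

/-- The 2-forms of a two-dimensional factor form a line, so v∧v is a multiple of the square of its
area form; the multiple is a determinant. -/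
theorem extProd_pull_left (hVs : V.IsSymm) (a b c d : Fin 4) :
    extProd (pullMat J (blockDiag V 0)) (pullMat J (blockDiag V 0)) a b c d =
      2 * V.det * (wedgeRow J 0 1 a b * wedgeRow J 0 1 c d) := by
  have h := hVs.apply 0 1
  simp [extProd, pullMat, Matrix.mul_apply, Fin.sum_univ_four, blockDiag_apply, wedgeRow,
    Matrix.det_fin_two, h]
  ring

theorem extProd_pull_right (hHs : H.IsSymm) (a b c d : Fin 4) :
    extProd (pullMat J (blockDiag 0 H)) (pullMat J (blockDiag 0 H)) a b c d =
      2 * H.det * (wedgeRow J 2 3 a b * wedgeRow J 2 3 c d) := by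
  have h := hHs.apply 0 1
  simp [extProd, pullMat, Matrix.mul_apply, Fin.sum_univ_four, blockDiag_apply, wedgeRow,
    Matrix.det_fin_two, h]
  ring

/-- Components of a 2-form in the frame dual to the rows of `J`. -/
theorem twoForm_eq {X : Matrix (Fin 4) (Fin 4) ℝ} (hJ : J.det ≠ 0) (hX : ∀ a b, X b a = -X a b)
    (hmix : ∀ A B : Fin 4, A < 2 → 2 ≤ B → ∑ a, ∑ b, J⁻¹ a A * J⁻¹ b B * X a b = 0) (a b : Fin 4) :
    X a b = (∑ a, ∑ b, J⁻¹ a 0 * J⁻¹ b 1 * X a b) * wedgeRow J 0 1 a b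
      + (∑ a, ∑ b, J⁻¹ a 2 * J⁻¹ b 3 * X a b) * wedgeRow J 2 3 a b := by
  set Y : Matrix (Fin 4) (Fin 4) ℝ := J⁻¹.transpose * X * J⁻¹ with hY
  have hYe : ∀ A B, Y A B = ∑ a, ∑ b, J⁻¹ a A * J⁻¹ b B * X a b := by
    intro A B
    rw [hY, ← mul_mul_apply_eq_sum]
    iterate 2 refine Finset.sum_congr rfl fun _ _ => ?_
    simp only [Matrix.transpose_apply]; ring
  have hYa : ∀ A B, Y B A = -Y A B := by
    intro A B
    rw [hYe, hYe, Finset.sum_comm, ← Finset.sum_neg_distrib]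
    refine Finset.sum_congr rfl fun a _ => ?_
    rw [← Finset.sum_neg_distrib]
    refine Finset.sum_congr rfl fun b _ => ?_
    rw [hX a b]; ring
  have hYd : ∀ A, Y A A = 0 := fun A => by have := hYa A A; linarith
  have h1 : J⁻¹ * J = 1 := Matrix.nonsing_inv_mul _ (isUnit_iff_ne_zero.2 hJ)
  have hXY : X = J.transpose * Y * J := by
    have : J.transpose * J⁻¹.transpose = 1 := by rw [← Matrix.transpose_mul, h1]; simp
    calc X = (J.transpose * J⁻¹.transpose) * X * (J⁻¹ * J) := by rw [this, h1]; simp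
      _ = _ := by simp only [hY, mul_assoc]
  have m02 := (hYe 0 2).trans (hmix 0 2 (by decide) (by decide))
  have m03 := (hYe 0 3).trans (hmix 0 3 (by decide) (by decide))
  have m12 := (hYe 1 2).trans (hmix 1 2 (by decide) (by decide))
  have m13 := (hYe 1 3).trans (hmix 1 3 (by decide) (by decide))
  rw [← hYe, ← hYe]
  conv_lhs => rw [hXY]
  simp only [Matrix.mul_apply, Fin.sum_univ_four, Matrix.transpose_apply, wedgeRow, hYd,
    hYa 0 1, hYa 0 2, hYa 0 3, hYa 1 2, hYa 1 3, hYa 2 3, m02, m03, m12, m13]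
  ring

/-- The classical octahedron argument: a combination of the four cyclic identities, with the
antisymmetries matching their terms. -/
theorem pair_symm_of_bianchi {R : Tensor4} (hr : ∀ a b c d, R a b d c = -R a b c d)
    (hl : ∀ a b c d, R b a c d = -R a b c d)
    (hb : ∀ a b c d, R a b c d + R a c d b + R a d b c = 0) (a b c d : Fin 4) :
    R a b c d = R c d a b := by
  linarith [hb a b c d, hb b c d a, hb c d a b, hb d a b c, hl a b c d, hl a c d b, hl a d b c,
    hl b c d a, hl b d a c, hl b a c d, hl c d a b, hl c a b d, hl c b d a, hl d a b c, hl d b c a,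
    hl d c a b, hr a b c d, hr a c d b, hr a d b c, hr b c d a, hr b d a c, hr b a c d, hr c d a b,
    hr c a b d, hr c b d a, hr d a b c, hr d b c a, hr d c a b]

theorem sum_mul_sum_pair_comm (p q r s : Fin 4 → ℝ) (R : Tensor4) :
    ∑ c, ∑ d, r c * s d * ∑ a, ∑ b, p a * q b * R a b c d =
      ∑ a, ∑ b, p a * q b * ∑ c, ∑ d, r c * s d * R a b c d := by
  simp only [Finset.mul_sum]
  rw [Finset.sum_congr rfl fun c _ => Finset.sum_comm, Finset.sum_comm]
  refine Finset.sum_congr rfl fun a _ => ?_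
  rw [Finset.sum_congr rfl fun c _ => Finset.sum_comm, Finset.sum_comm]
  refine Finset.sum_congr rfl fun b _ => ?_
  iterate 2 refine Finset.sum_congr rfl fun _ _ => ?_
  ring

/-- Let θᴬ be the rows of `J`. Without mixed components in the first pair there are none in the
second either, by pair symmetry, so R is a combination of products of θ⁰∧θ¹ and θ²∧θ³. The cross
components vanish by the Bianchi identity, leaving one scalar for each factor. -/
theorem curvature_eq_of_mixed (hJ : J.det ≠ 0) (hV : V.det ≠ 0) (hH : H.det ≠ 0) (hVs : V.IsSymm)
    (hHs : H.IsSymm) {R : Tensor4} (hr : ∀ a b c d, R a b d c = -R a b c d)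
    (hl : ∀ a b c d, R b a c d = -R a b c d)
    (hb : ∀ a b c d, R a b c d + R a c d b + R a d b c = 0)
    (hmix : ∀ A B : Fin 4, A < 2 → 2 ≤ B → ∀ c d, ∑ a, ∑ b, J⁻¹ a A * J⁻¹ b B * R a b c d = 0) :
    ∃ k l : ℝ, R = k • extProd (pullMat J (blockDiag V 0)) (pullMat J (blockDiag V 0))
      + l • extProd (pullMat J (blockDiag 0 H)) (pullMat J (blockDiag 0 H)) := by
  have hp := pair_symm_of_bianchi hr hl hb
  have key : ∀ A B c d, ∑ a, ∑ b, J⁻¹ a A * J⁻¹ b B * R a b c d =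
      (∑ c, ∑ d, J⁻¹ c 0 * J⁻¹ d 1 * ∑ a, ∑ b, J⁻¹ a A * J⁻¹ b B * R a b c d) * wedgeRow J 0 1 c d
      + (∑ c, ∑ d, J⁻¹ c 2 * J⁻¹ d 3 * ∑ a, ∑ b, J⁻¹ a A * J⁻¹ b B * R a b c d)
        * wedgeRow J 2 3 c d := by
    intro A B c d
    refine twoForm_eq (X := fun c d => ∑ a, ∑ b, J⁻¹ a A * J⁻¹ b B * R a b c d) hJ ?_ ?_ c d
    · intro c d
      simp only [hr _ _ c d, mul_neg, Finset.sum_neg_distrib]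
    · intro C D hC hD
      rw [sum_mul_sum_pair_comm]
      refine Finset.sum_eq_zero fun a _ => Finset.sum_eq_zero fun b _ => ?_
      rw [Finset.sum_congr rfl fun c _ => Finset.sum_congr rfl fun d _ => by rw [hp a b c d],
        hmix C D hC hD a b, mul_zero]
  -- The component R₀₁₂₃ is minus the sum of R₀₂₃₁ and R₀₃₁₂, both of which are mixed in the first
  -- pair.
  have h0123 : ∑ c, ∑ d, J⁻¹ c 2 * J⁻¹ d 3 * ∑ a, ∑ b, J⁻¹ a 0 * J⁻¹ b 1 * R a b c d = 0 := by
    rw [sum_mul_sum_pair_comm]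
    have h2 : ∑ a, ∑ b, J⁻¹ a 0 * J⁻¹ b 1 * ∑ c, ∑ d, J⁻¹ c 2 * J⁻¹ d 3 * R a c d b = 0 := by
      simp only [Finset.mul_sum]
      calc _ = ∑ b, ∑ d, J⁻¹ b 1 * J⁻¹ d 3 * ∑ a, ∑ c, J⁻¹ a 0 * J⁻¹ c 2 * R a c d b := by
            simp only [Finset.mul_sum]
            rw [Finset.sum_comm]
            refine Finset.sum_congr rfl fun b _ => ?_
            rw [Finset.sum_congr rfl fun a _ => Finset.sum_comm, Finset.sum_comm]
            iterate 3 refine Finset.sum_congr rfl fun _ _ => ?_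
            ring
        _ = 0 := by
            simp only [hmix 0 2 (by decide) (by decide), mul_zero, Finset.sum_const_zero]
    have h3 : ∑ a, ∑ b, J⁻¹ a 0 * J⁻¹ b 1 * ∑ c, ∑ d, J⁻¹ c 2 * J⁻¹ d 3 * R a d b c = 0 := by
      simp only [Finset.mul_sum]
      calc _ = ∑ b, ∑ c, J⁻¹ b 1 * J⁻¹ c 2 * ∑ a, ∑ d, J⁻¹ a 0 * J⁻¹ d 3 * R a d b c := by
            simp only [Finset.mul_sum]
            rw [Finset.sum_comm]
            refine Finset.sum_congr rfl fun b _ => ?_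
            rw [Finset.sum_comm]
            iterate 3 refine Finset.sum_congr rfl fun _ _ => ?_
            ring
        _ = 0 := by
            simp only [hmix 0 3 (by decide) (by decide), mul_zero, Finset.sum_const_zero]
    have : ∀ a b c d, R a b c d = -(R a c d b) - R a d b c := fun a b c d => by linarith [hb a b c d]
    calc _ = -(∑ a, ∑ b, J⁻¹ a 0 * J⁻¹ b 1 * ∑ c, ∑ d, J⁻¹ c 2 * J⁻¹ d 3 * R a c d b)
          - ∑ a, ∑ b, J⁻¹ a 0 * J⁻¹ b 1 * ∑ c, ∑ d, J⁻¹ c 2 * J⁻¹ d 3 * R a d b c := by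
          simp only [← Finset.sum_neg_distrib, ← Finset.sum_sub_distrib, Finset.mul_sum]
          iterate 4 refine Finset.sum_congr rfl fun _ _ => ?_
          rw [this]; ring
      _ = 0 := by rw [h2, h3]; ring
  set r0 := ∑ c, ∑ d, J⁻¹ c 0 * J⁻¹ d 1 * ∑ a, ∑ b, J⁻¹ a 0 * J⁻¹ b 1 * R a b c d with hr0
  set r1 := ∑ c, ∑ d, J⁻¹ c 2 * J⁻¹ d 3 * ∑ a, ∑ b, J⁻¹ a 2 * J⁻¹ b 3 * R a b c d with hr1
  have h2301 : ∑ c, ∑ d, J⁻¹ c 0 * J⁻¹ d 1 * ∑ a, ∑ b, J⁻¹ a 2 * J⁻¹ b 3 * R a b c d = 0 := by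
    rw [← h0123, sum_mul_sum_pair_comm]
    iterate 2 refine Finset.sum_congr rfl fun _ _ => ?_
    congr 1
    iterate 2 refine Finset.sum_congr rfl fun _ _ => ?_
    rw [hp]
  -- The factors 2 det V and 2 det H come from v∧v = 2 det V (θ⁰∧θ¹)⊗(θ⁰∧θ¹) and its analogue for h.
  refine ⟨r0 / (2 * V.det), r1 / (2 * H.det), ?_⟩
  funext a b c d
  have e := twoForm_eq (X := fun a b => R a b c d) hJ (fun a b => hl a b c d)
    (fun A B hA hB => hmix A B hA hB c d) a b
  rw [key 0 1, key 2 3, ← hr0, ← hr1, h0123, h2301] at e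
  simp only [Pi.add_apply, Pi.smul_apply, smul_eq_mul, extProd_pull_left hVs,
    extProd_pull_right hHs]
  rw [e]
  field_simp
  ring

end frame

/-! ### The Hodge dual of the pure part -/

/-- Up to √|det γ|, the left side is θ⁰∧θ¹∧θ²∧θ³ evaluated on coordinate vectors, and the right side
is its Laplace expansion in 2×2 minors. Besides adapting η to a frame, the case `J = 1` yields its
antisymmetries. -/
theorem volElt_mul_det (γ J : Matrix (Fin 4) (Fin 4) ℝ) (a b c d : Fin 4) :
    volElt γ a b c d * J.det = Real.sqrt |γ.det| *
      (wedgeRow J 0 1 a b * wedgeRow J 2 3 c d - wedgeRow J 0 2 a b * wedgeRow J 1 3 c d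
        + wedgeRow J 0 3 a b * wedgeRow J 1 2 c d + wedgeRow J 1 2 a b * wedgeRow J 0 3 c d
        - wedgeRow J 1 3 a b * wedgeRow J 0 2 c d + wedgeRow J 2 3 a b * wedgeRow J 0 1 c d) := by
  have h1 : Matrix.det (fun i j : Fin 4 => if ![a, b, c, d] i = j then (1 : ℝ) else 0) * J.det =
      Matrix.det (Matrix.of fun i j : Fin 4 => J j (![a, b, c, d] i)) := by
    change Matrix.det (Matrix.of fun i j : Fin 4 => if ![a, b, c, d] i = j then (1 : ℝ) else 0)
      * J.det = _
    rw [← Matrix.det_transpose J, ← Matrix.det_mul]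
    congr 1
    ext i j
    simp [Matrix.mul_apply]
  rw [volElt, mul_assoc, h1]
  congr 1
  simp only [Matrix.det_succ_row_zero, Fin.sum_univ_four, Fin.sum_univ_three,
    Matrix.submatrix_apply, wedgeRow]
  simp [Fin.succAbove, Fin.sum_univ_succ]
  ring

theorem volElt_antisymm_mid (γ : Matrix (Fin 4) (Fin 4) ℝ) (a b c d : Fin 4) :
    volElt γ a d c b = -volElt γ a b c d := by
  have h1 := volElt_mul_det γ 1 a b c d
  have h2 := volElt_mul_det γ 1 a d c b
  rw [Matrix.det_one, mul_one] at h1 h2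
  rw [h1, h2]
  simp only [wedgeRow]
  ring

theorem volElt_antisymm_right (γ : Matrix (Fin 4) (Fin 4) ℝ) (a b c d : Fin 4) :
    volElt γ a b d c = -volElt γ a b c d := by
  have h1 := volElt_mul_det γ 1 a b c d
  have h2 := volElt_mul_det γ 1 a b d c
  rw [Matrix.det_one, mul_one] at h1 h2
  rw [h1, h2]
  simp only [wedgeRow]
  ring

/-- η is antisymmetric in the two slots that receive the same vector. -/
theorem act22_volElt (γ : Matrix (Fin 4) (Fin 4) ℝ) (x : Fin 4 → ℝ) :
    act22 (volElt γ) x x = 0 := by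
  funext a b
  have h : act22 (volElt γ) x x a b = -act22 (volElt γ) x x a b := by
    conv_lhs => rw [act22, Finset.sum_comm]
    rw [act22, ← Finset.sum_neg_distrib]
    refine Finset.sum_congr rfl fun m _ => ?_
    rw [← Finset.sum_neg_distrib]
    refine Finset.sum_congr rfl fun n _ => ?_
    rw [volElt_antisymm_mid]; ring
  have : act22 (volElt γ) x x a b = 0 := by linarith
  simpa using this

theorem act22_add (P Q : Tensor4) (x y : Fin 4 → ℝ) :
    act22 (P + Q) x y = act22 P x y + act22 Q x y := by
  funext a b
  simp only [act22, Pi.add_apply, add_mul, Finset.sum_add_distrib, Matrix.add_apply]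

theorem act22_smul (r : ℝ) (P : Tensor4) (x y : Fin 4 → ℝ) :
    act22 (r • P) x y = r • act22 P x y := by
  funext a b
  simp only [act22, Pi.smul_apply, smul_eq_mul, Matrix.smul_apply, Finset.mul_sum]
  iterate 2 refine Finset.sum_congr rfl fun _ _ => ?_
  ring

theorem comp_idForm_right {γ : Matrix (Fin 4) (Fin 4) ℝ} (hd : γ.det ≠ 0) {P : Tensor4}
    (hP : ∀ a b c d, P a b d c = -P a b c d) : comp γ P (IsSplit.idForm γ) = P := by
  have h1 : γ⁻¹ * γ = 1 := Matrix.nonsing_inv_mul _ (isUnit_iff_ne_zero.2 hd)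
  have h1' : ∀ k c, ∑ m, γ⁻¹ k m * γ m c = if k = c then 1 else 0 := by
    intro k c
    rw [← Matrix.mul_apply, h1, Matrix.one_apply]
  have e : ∀ a b c d, ∑ k, ∑ l, ∑ m, ∑ n, P a b k l * γ⁻¹ k m * γ⁻¹ l n * (γ m c * γ n d) =
      P a b c d := by
    intro a b c d
    calc _ = ∑ k, ∑ l, P a b k l * ((∑ m, γ⁻¹ k m * γ m c) * ∑ n, γ⁻¹ l n * γ n d) := by
          refine Finset.sum_congr rfl fun k _ => Finset.sum_congr rfl fun l _ => ?_
          rw [Finset.sum_mul_sum]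
          simp only [Finset.mul_sum]
          iterate 2 refine Finset.sum_congr rfl fun _ _ => ?_
          ring
      _ = _ := by simp [h1']
  funext a b c d
  have : comp γ P (IsSplit.idForm γ) a b c d = (1 / 2) * (P a b c d - P a b d c) := by
    rw [← e a b c d, ← e a b d c]
    simp only [comp, IsSplit.idForm, extProd, Pi.smul_apply, smul_eq_mul, Finset.mul_sum,
      ← Finset.sum_sub_distrib]
    iterate 4 refine Finset.sum_congr rfl fun _ _ => ?_
    ring
  rw [this, hP]; ring

/-- Why *S and *W impose the same equation: they differ by a factor and by a multiple of *G = η, and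
η(x;x) = 0. -/
theorem act22_hodge {γ : Matrix (Fin 4) (Fin 4) ℝ} (hd : γ.det ≠ 0) (r s : ℝ) (P : Tensor4)
    (x : Fin 4 → ℝ) : act22 (hodge γ (r • IsSplit.idForm γ + s • P)) x x =
      s • act22 (hodge γ P) x x := by
  rw [hodge, comp_add_right, comp_smul_right, comp_smul_right,
    comp_idForm_right hd (volElt_antisymm_right γ), act22_add, act22_smul, act22_smul,
    act22_volElt]
  simp [hodge]

/-! ### Vanishing of the dual of the pure part on a vector -/

section frame
variable {J : Matrix (Fin 4) (Fin 4) ℝ} {V H : Matrix (Fin 2) (Fin 2) ℝ}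

theorem inv_pullMat_rows (hJ : J.det ≠ 0) (hV : V.det ≠ 0) (hH : H.det ≠ 0) :
    J * (pullMat J (blockDiag V H))⁻¹ * J.transpose = blockDiag V⁻¹ H⁻¹ := by
  have h1' : J * J⁻¹ = 1 := Matrix.mul_nonsing_inv _ (isUnit_iff_ne_zero.2 hJ)
  have h2 : J⁻¹.transpose * J.transpose = 1 := by rw [← Matrix.transpose_mul, h1']; simp
  rw [pullMat_inv, blockDiag_inv hV hH]
  calc _ = (J * J⁻¹) * blockDiag V⁻¹ H⁻¹ * (J⁻¹.transpose * J.transpose) := by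
        simp only [mul_assoc]
    _ = _ := by rw [h1', h2]; simp

theorem sum_wedgeRow_contract (I : Matrix (Fin 4) (Fin 4) ℝ) (i j A B : Fin 4) :
    ∑ k, ∑ l, ∑ m, ∑ n, wedgeRow J i j k l * I k m * I l n * wedgeRow J A B m n =
      2 * ((J * I * J.transpose) i A * (J * I * J.transpose) j B
        - (J * I * J.transpose) i B * (J * I * J.transpose) j A) := by
  have e : ∀ i j A B : Fin 4, ∑ k, ∑ l, ∑ m, ∑ n, J i k * J j l * I k m * I l n *
      (J A m * J B n) = (J * I * J.transpose) i A * (J * I * J.transpose) j B := by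
    intro i j A B
    rw [sum_contract, ← mul_mul_apply_eq_sum, ← mul_mul_apply_eq_sum]
    rfl
  calc _ = ∑ k, ∑ l, ∑ m, ∑ n, (J i k * J j l * I k m * I l n * (J A m * J B n)
        - J i k * J j l * I k m * I l n * (J B m * J A n)
        - J j k * J i l * I k m * I l n * (J A m * J B n)
        + J j k * J i l * I k m * I l n * (J B m * J A n)) := by
        iterate 4 refine Finset.sum_congr rfl fun _ _ => ?_
        simp only [wedgeRow]; ring
    _ = _ := by
        simp only [Finset.sum_add_distrib, Finset.sum_sub_distrib, e]; ring

/-- `X` is the inverse metric in the coframe. Expanding η in wedges of rows turns the contraction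
with θᴬ∧θᴮ into 2×2 minors of `X`; since `X` is block diagonal, only one of the six survives when A,
B belong to the same factor. -/
theorem comp_volElt_wedge (hJ : J.det ≠ 0) (hV : V.det ≠ 0) (hH : H.det ≠ 0)
    (A B a b c d : Fin 4) {X : Matrix (Fin 4) (Fin 4) ℝ} (hX : X = blockDiag V⁻¹ H⁻¹) :
    comp (pullMat J (blockDiag V H)) (volElt (pullMat J (blockDiag V H)))
        (fun a b c d => wedgeRow J A B a b * wedgeRow J A B c d) a b c d =
      (Real.sqrt |(pullMat J (blockDiag V H)).det| / J.det) *
      (wedgeRow J 0 1 a b * (X 2 A * X 3 B - X 2 B * X 3 A)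
        - wedgeRow J 0 2 a b * (X 1 A * X 3 B - X 1 B * X 3 A)
        + wedgeRow J 0 3 a b * (X 1 A * X 2 B - X 1 B * X 2 A)
        + wedgeRow J 1 2 a b * (X 0 A * X 3 B - X 0 B * X 3 A)
        - wedgeRow J 1 3 a b * (X 0 A * X 2 B - X 0 B * X 2 A)
        + wedgeRow J 2 3 a b * (X 0 A * X 1 B - X 0 B * X 1 A)) * wedgeRow J A B c d := by
  have hX' := (inv_pullMat_rows hJ hV hH).trans hX.symm
  set γ := pullMat J (blockDiag V H)
  have hη : ∀ k l, volElt γ a b k l = (Real.sqrt |γ.det| / J.det) *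
      (wedgeRow J 0 1 a b * wedgeRow J 2 3 k l - wedgeRow J 0 2 a b * wedgeRow J 1 3 k l
        + wedgeRow J 0 3 a b * wedgeRow J 1 2 k l + wedgeRow J 1 2 a b * wedgeRow J 0 3 k l
        - wedgeRow J 1 3 a b * wedgeRow J 0 2 k l + wedgeRow J 2 3 a b * wedgeRow J 0 1 k l) := by
    intro k l
    have := volElt_mul_det γ J a b k l
    field_simp
    linarith
  have e := fun i j => sum_wedgeRow_contract (J := J) γ⁻¹ i j A B
  rw [hX'] at e
  have s : ∀ i j, (X i A * X j B - X i B * X j A) = 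
    (1 / 2) * ∑ k, ∑ l, ∑ m, ∑ n, wedgeRow J i j k l * γ⁻¹ k m * γ⁻¹ l n * wedgeRow J A B m n := by
    intro i j; rw [e]; ring
  simp only [s, comp, hη]
  simp only [Finset.mul_sum, Finset.sum_mul, ← Finset.sum_add_distrib, ← Finset.sum_sub_distrib]
  iterate 4 refine Finset.sum_congr rfl fun _ _ => ?_
  ring

theorem pureForm_pull (hVs : V.IsSymm) (hHs : H.IsSymm) :
    IsSplit.pureForm (pullMat J (blockDiag V 0)) (pullMat J (blockDiag 0 H)) =
      V.det • (fun a b c d => wedgeRow J 0 1 a b * wedgeRow J 0 1 c d)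
      + H.det • (fun a b c d => wedgeRow J 2 3 a b * wedgeRow J 2 3 c d : Tensor4) := by
  funext a b c d
  simp only [IsSplit.pureForm, Pi.add_apply, Pi.smul_apply, smul_eq_mul, extProd_pull_left hVs,
    extProd_pull_right hHs]
  ring

/-- Duality exchanges the area forms of the two factors. The determinants of V and H in Π cancel
against those of V⁻¹ and H⁻¹ in the contraction. -/
theorem hodge_pureForm (hJ : J.det ≠ 0) (hV : V.det ≠ 0) (hH : H.det ≠ 0) (hVs : V.IsSymm)
    (hHs : H.IsSymm) (a b c d : Fin 4) :
    hodge (pullMat J (blockDiag V H)) (IsSplit.pureForm (pullMat J (blockDiag V 0))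
      (pullMat J (blockDiag 0 H))) a b c d =
      (Real.sqrt |(pullMat J (blockDiag V H)).det| / J.det) *
        (wedgeRow J 2 3 a b * wedgeRow J 0 1 c d + wedgeRow J 0 1 a b * wedgeRow J 2 3 c d) := by
  have dV : V.det * (V⁻¹ 0 0 * V⁻¹ 1 1 - V⁻¹ 0 1 * V⁻¹ 1 0) = 1 := by
    rw [← Matrix.det_fin_two, ← Matrix.det_mul,
      Matrix.mul_nonsing_inv _ (isUnit_iff_ne_zero.2 hV), Matrix.det_one]
  have dH : H.det * (H⁻¹ 0 0 * H⁻¹ 1 1 - H⁻¹ 0 1 * H⁻¹ 1 0) = 1 := by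
    rw [← Matrix.det_fin_two, ← Matrix.det_mul,
      Matrix.mul_nonsing_inv _ (isUnit_iff_ne_zero.2 hH), Matrix.det_one]
  rw [pureForm_pull hVs hHs, hodge, comp_add_right, comp_smul_right, comp_smul_right]
  simp only [Pi.add_apply, Pi.smul_apply, smul_eq_mul]
  rw [comp_volElt_wedge hJ hV hH 0 1 a b c d (blockDiag_apply V⁻¹ H⁻¹).symm,
    comp_volElt_wedge hJ hV hH 2 3 a b c d (blockDiag_apply V⁻¹ H⁻¹).symm]
  simp
  linear_combination (√|(pullMat J (blockDiag V H)).det| / J.det) *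
    (wedgeRow J 2 3 a b * wedgeRow J 0 1 c d * dV + wedgeRow J 0 1 a b * wedgeRow J 2 3 c d * dH)

theorem sum_wedgeRow_mul (A B : Fin 4) (x : Fin 4 → ℝ) (a : Fin 4) :
    ∑ m, wedgeRow J A B a m * x m = J A a * (J.mulVec x B) - J B a * (J.mulVec x A) := by
  simp only [wedgeRow, Matrix.mulVec, dotProduct, Finset.mul_sum, ← Finset.sum_sub_distrib]
  exact Finset.sum_congr rfl fun _ _ => by ring

theorem rows_eq_zero_of_wedge (hJ : J.det ≠ 0) {A B : Fin 4} (hAB : A ≠ B) {p q : ℝ}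
    (h : ∀ a, J A a * q - J B a * p = 0) : p = 0 ∧ q = 0 := by
  have h1 : J * J⁻¹ = 1 := Matrix.mul_nonsing_inv _ (isUnit_iff_ne_zero.2 hJ)
  have h2 : ∀ i j, ∑ a, J i a * J⁻¹ a j = if i = j then 1 else 0 := by
    intro i j; rw [← Matrix.mul_apply, h1, Matrix.one_apply]
  have key : ∀ j, (if A = j then 1 else 0) * q - (if B = j then 1 else 0) * p = 0 := by
    intro j
    rw [← h2, ← h2, Finset.sum_mul, Finset.sum_mul, ← Finset.sum_sub_distrib]
    exact Finset.sum_eq_zero fun a _ => by linear_combination J⁻¹ a j * h a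
  have hA := key A
  have hB := key B
  simp [hAB, hAB.symm] at hA hB
  exact ⟨hB, hA⟩

/-- Contracting with x gives s(α⊗β + β⊗α), where α and β are the contractions of θ⁰∧θ¹ and θ²∧θ³
with x. A symmetrised product of covectors vanishes only if one of them does, and α = 0 means θ⁰(x)
= θ¹(x) = 0 because the rows of `J` are independent. -/
theorem act22_hodge_pureForm_eq_zero_iff (hJ : J.det ≠ 0) (hV : V.det ≠ 0) (hH : H.det ≠ 0)
    (hVs : V.IsSymm) (hHs : H.IsSymm) (x : Fin 4 → ℝ) :
    act22 (hodge (pullMat J (blockDiag V H)) (IsSplit.pureForm (pullMat J (blockDiag V 0))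
      (pullMat J (blockDiag 0 H)))) x x = 0 ↔
      (J.mulVec x 0 = 0 ∧ J.mulVec x 1 = 0) ∨ (J.mulVec x 2 = 0 ∧ J.mulVec x 3 = 0) := by
  set s := Real.sqrt |(pullMat J (blockDiag V H)).det| / J.det with hs
  have hs0 : s ≠ 0 := by
    refine div_ne_zero (Real.sqrt_ne_zero'.2 (abs_pos.2 ?_)) hJ
    exact (isSplit_pullMat hJ hV hH hVs hHs).det_ne
  set α : Fin 4 → ℝ := fun a => J 0 a * (J.mulVec x 1) - J 1 a * (J.mulVec x 0) with hα
  set β : Fin 4 → ℝ := fun a => J 2 a * (J.mulVec x 3) - J 3 a * (J.mulVec x 2) with hβ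
  have hα' : ∀ a, α a = ∑ m, wedgeRow J 0 1 a m * x m := fun a => (sum_wedgeRow_mul 0 1 x a).symm
  have hβ' : ∀ a, β a = ∑ m, wedgeRow J 2 3 a m * x m := fun a => (sum_wedgeRow_mul 2 3 x a).symm
  have key : ∀ a b, act22 (hodge (pullMat J (blockDiag V H)) (IsSplit.pureForm
      (pullMat J (blockDiag V 0)) (pullMat J (blockDiag 0 H)))) x x a b =
      s * (β a * α b + α a * β b) := by
    intro a b
    simp only [act22, hodge_pureForm hJ hV hH hVs hHs, ← hs]
    rw [hα', hα', hβ', hβ', Finset.sum_mul_sum, Finset.sum_mul_sum, ← Finset.sum_add_distrib,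
      Finset.mul_sum]
    refine Finset.sum_congr rfl fun _ _ => ?_
    rw [← Finset.sum_add_distrib, Finset.mul_sum]
    refine Finset.sum_congr rfl fun _ _ => ?_
    ring
  constructor
  · intro h
    have hz : ∀ a b, β a * α b + α a * β b = 0 := by
      intro a b
      have := key a b
      rw [h] at this
      exact (mul_eq_zero.1 this.symm).resolve_left hs0
    by_cases hα0 : ∀ a, α a = 0
    · left
      exact rows_eq_zero_of_wedge hJ (by decide) hα0
    · right
      push Not at hα0
      obtain ⟨a, ha⟩ := hα0
      -- At an index with αₐ ≠ 0 the diagonal entry 2αₐβₐ forces βₐ = 0; the entries (a, b) then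
      -- reduce to αₐβ_b and force β = 0.
      have hβa : β a = 0 := by
        have := hz a a
        have h2 : α a * β a = 0 := by linarith
        exact (mul_eq_zero.1 h2).resolve_left ha
      refine rows_eq_zero_of_wedge (A := 2) (B := 3) hJ (by decide) fun b => ?_
      have := hz a b
      rw [hβa, zero_mul, zero_add] at this
      exact (mul_eq_zero.1 this).resolve_left ha
  · intro h
    funext a b
    rw [key]
    rcases h with ⟨h0, h1⟩ | ⟨h0, h1⟩
    · simp [hα, h0, h1]
    · simp [hβ, h0, h1]

theorem mulVec_raise_pullMat (hJ : J.det ≠ 0) (hV : V.det ≠ 0) (hH : H.det ≠ 0) (l : Fin 4 → ℝ) :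
    J.mulVec (raise (pullMat J (blockDiag V H)) (J.transpose.mulVec l)) =
      (blockDiag V⁻¹ H⁻¹).mulVec l := by
  have : ∀ γ : Matrix (Fin 4) (Fin 4) ℝ, ∀ α, raise γ α = γ⁻¹.mulVec α := fun _ _ => rfl
  rw [this, Matrix.mulVec_mulVec, Matrix.mulVec_mulVec, inv_pullMat_rows hJ hV hH]

theorem inv_mulVec_eq_zero_iff {V : Matrix (Fin 2) (Fin 2) ℝ} (hV : V.det ≠ 0) (p q : ℝ) :
    (V⁻¹ 0 0 * p + V⁻¹ 0 1 * q = 0 ∧ V⁻¹ 1 0 * p + V⁻¹ 1 1 * q = 0) ↔ p = 0 ∧ q = 0 := by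
  constructor
  · rintro ⟨h1, h2⟩
    have h : V⁻¹.mulVec ![p, q] = 0 := by
      ext i; fin_cases i <;> simp [Matrix.mulVec, dotProduct, h1, h2]
    have h3 : V.mulVec (V⁻¹.mulVec ![p, q]) = 0 := by rw [h, Matrix.mulVec_zero]
    rw [Matrix.mulVec_mulVec, Matrix.mul_nonsing_inv _ (isUnit_iff_ne_zero.2 hV),
      Matrix.one_mulVec] at h3
    exact ⟨congrFun h3 0, congrFun h3 1⟩
  · rintro ⟨rfl, rfl⟩; simp

/-- Raising the index acts inside each factor by the invertible matrices V⁻¹ and H⁻¹, so the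
condition on the vector is the same condition on the frame components `l` of the covector. -/
theorem act22_hodge_raise_eq_zero_iff (hJ : J.det ≠ 0) (hV : V.det ≠ 0) (hH : H.det ≠ 0)
    (hVs : V.IsSymm) (hHs : H.IsSymm) (l : Fin 4 → ℝ) :
    act22 (hodge (pullMat J (blockDiag V H)) (IsSplit.pureForm (pullMat J (blockDiag V 0))
      (pullMat J (blockDiag 0 H))))
      (raise (pullMat J (blockDiag V H)) (J.transpose.mulVec l))
      (raise (pullMat J (blockDiag V H)) (J.transpose.mulVec l)) = 0 ↔
      (l 0 = 0 ∧ l 1 = 0) ∨ (l 2 = 0 ∧ l 3 = 0) := by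
  rw [act22_hodge_pureForm_eq_zero_iff hJ hV hH hVs hHs, mulVec_raise_pullMat hJ hV hH,
    ← inv_mulVec_eq_zero_iff hV (l 0) (l 1), ← inv_mulVec_eq_zero_iff hH (l 2) (l 3)]
  simp [blockDiag_apply, Matrix.mulVec, dotProduct, Fin.sum_univ_four]

end frame

/-! ### Conformal changes of metric -/

/-- `γ = e^{2λ} g` on `U`. -/
structure IsConformalOn (g γ : R4 → Matrix (Fin 4) (Fin 4) ℝ) (lam : R4 → ℝ) (U : Set R4) :
    Prop where
  metric : IsMetricOn g U
  smooth : ContDiffOn ℝ ∞ lam U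
  eq : ∀ y ∈ U, γ y = Real.exp (2 * lam y) • g y

/-- The gradient `g^{kl} ∂_l λ`. -/
def grad (g : R4 → Matrix (Fin 4) (Fin 4) ℝ) (lam : R4 → ℝ) (y : R4) (k : Fin 4) : ℝ :=
  ∑ l, (g y)⁻¹ k l * pd l lam y

/-- Difference of the Christoffel symbols of `e^{2λ} g` and `g`. -/
def confTerm (g : R4 → Matrix (Fin 4) (Fin 4) ℝ) (lam : R4 → ℝ) (y : R4) (k i j : Fin 4) : ℝ :=
  (if k = i then 1 else 0) * pd j lam y + (if k = j then 1 else 0) * pd i lam y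
    - g y i j * grad g lam y k

theorem sum_delta_left (a : Fin 4) (f : Fin 4 → ℝ) :
    ∑ e, (if e = a then 1 else 0) * f e = f a := by simp

theorem sum_delta_right (a : Fin 4) (f : Fin 4 → ℝ) :
    ∑ e, (if a = e then 1 else 0) * f e = f a := by simp

/-! ### Connection, curvature and parallel tensors under a conformal change -/

namespace IsConformalOn

variable {g γ : R4 → Matrix (Fin 4) (Fin 4) ℝ} {lam : R4 → ℝ} {U : Set R4}

theorem inv_eq (h : IsConformalOn g γ lam U) {y : R4} (hy : y ∈ U) :
    (γ y)⁻¹ = (Real.exp (2 * lam y))⁻¹ • (g y)⁻¹ := by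
  refine Matrix.inv_eq_right_inv ?_
  rw [h.eq y hy, Matrix.smul_mul, Matrix.mul_smul, smul_smul, mul_inv_cancel₀ (Real.exp_ne_zero _),
    one_smul, Matrix.mul_nonsing_inv _ (isUnit_iff_ne_zero.2 (h.metric.det_ne y hy))]

theorem apply_eq (h : IsConformalOn g γ lam U) {y : R4} (hy : y ∈ U) (i j : Fin 4) :
    γ y i j = Real.exp (2 * lam y) * g y i j := by
  rw [h.eq y hy]; rfl

theorem differentiableAt_lam (h : IsConformalOn g γ lam U) {y : R4} (hy : y ∈ U) :
    DifferentiableAt ℝ lam y :=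
  differentiableAt_of_contDiffOn h.metric.isOpen h.smooth hy

theorem pd_apply (h : IsConformalOn g γ lam U) {y : R4} (hy : y ∈ U) (i j k : Fin 4) :
    pd i (fun z => γ z j k) y =
      Real.exp (2 * lam y) * (2 * pd i lam y * g y j k + pd i (fun z => g z j k) y) := by
  have hd := h.differentiableAt_lam hy
  rw [pd_congr h.metric.isOpen (fun z hz => h.apply_eq hz j k) i hy,
    pd_mul (hd.const_mul 2).exp (h.metric.differentiableAt j k hy), pd_exp_two_mul hd]
  ring

theorem isMetricOn (h : IsConformalOn g γ lam U) : IsMetricOn γ U where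
  isOpen := h.metric.isOpen
  smooth i j := by
    refine ContDiffOn.congr ?_ (fun y hy => h.apply_eq hy i j)
    exact (contDiffOn_const.mul h.smooth).exp.mul (h.metric.smooth i j)
  symm y hy i j := by rw [h.apply_eq hy, h.apply_eq hy, h.metric.symm y hy]
  det_ne y hy := by
    rw [h.eq y hy, Matrix.det_smul]
    exact mul_ne_zero (pow_ne_zero _ (Real.exp_ne_zero _)) (h.metric.det_ne y hy)

theorem christoffel_eq (h : IsConformalOn g γ lam U) {y : R4} (hy : y ∈ U) (k i j : Fin 4) :
    christoffel γ y k i j = christoffel g y k i j + confTerm g lam y k i j := by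
  have hδ : ∀ j, ∑ l, (g y)⁻¹ k l * g y l j = if k = j then 1 else 0 := by
    intro j
    rw [← Matrix.mul_apply, Matrix.nonsing_inv_mul _ (isUnit_iff_ne_zero.2 (h.metric.det_ne y hy)),
      Matrix.one_apply]
  simp only [christoffel, h.inv_eq hy, h.pd_apply hy, Matrix.smul_apply, smul_eq_mul, confTerm,
    ← hδ, grad]
  simp only [Finset.mul_sum, Finset.sum_mul, ← Finset.sum_add_distrib, ← Finset.sum_sub_distrib]
  refine Finset.sum_congr rfl fun l _ => ?_
  have := Real.exp_ne_zero (2 * lam y)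
  field_simp
  ring

theorem contDiffOn_pd_lam (h : IsConformalOn g γ lam U) (i : Fin 4) :
    ContDiffOn ℝ ∞ (fun y => pd i lam y) U := contDiffOn_pd h.metric.isOpen h.smooth i

theorem contDiffOn_grad (h : IsConformalOn g γ lam U) (k : Fin 4) :
    ContDiffOn ℝ ∞ (fun y => grad g lam y k) U :=
  ContDiffOn.sum fun l _ => (h.metric.contDiffOn_inv k l).mul (h.contDiffOn_pd_lam l)

theorem sum_mul_grad (h : IsConformalOn g γ lam U) {y : R4} (hy : y ∈ U) (m : Fin 4) :
    ∑ a, g y m a * grad g lam y a = pd m lam y :=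
  mul_inv_contract (h.metric.det_ne y hy) _ m

theorem pd_confTerm (h : IsConformalOn g γ lam U) {y : R4} (hy : y ∈ U) (c k i j : Fin 4) :
    pd c (fun z => confTerm g lam z k i j) y =
      (if k = i then 1 else 0) * pd c (fun z => pd j lam z) y
      + (if k = j then 1 else 0) * pd c (fun z => pd i lam z) y
      - (pd c (fun z => g z i j) y * grad g lam y k
        + g y i j * pd c (fun z => grad g lam z k) y) := by
  have d1 : ∀ i, DifferentiableAt ℝ (fun z => pd i lam z) y := fun i =>
    differentiableAt_of_contDiffOn h.metric.isOpen (h.contDiffOn_pd_lam i) hy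
  have d2 := differentiableAt_of_contDiffOn h.metric.isOpen (h.contDiffOn_grad k) hy
  have d3 := h.metric.differentiableAt i j hy
  unfold confTerm
  rw [pd_sub (((d1 j).const_mul _).fun_add ((d1 i).const_mul _)) (d3.fun_mul d2),
    pd_add ((d1 j).const_mul _) ((d1 i).const_mul _), pd_const_mul _ (d1 j), pd_const_mul _ (d1 i),
    pd_mul d3 d2]

/-- The covariant Hessian of `λ` for `g`. -/
def hess (g : R4 → Matrix (Fin 4) (Fin 4) ℝ) (lam : R4 → ℝ) (y : R4) (c b : Fin 4) : ℝ :=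
  pd c (fun z => pd b lam z) y - ∑ f, christoffel g y f c b * pd f lam y

/-- The covariant derivative of the gradient of `λ` for `g`. -/
def covGrad (g : R4 → Matrix (Fin 4) (Fin 4) ℝ) (lam : R4 → ℝ) (y : R4) (c a : Fin 4) : ℝ :=
  pd c (fun z => grad g lam z a) y + ∑ f, christoffel g y a c f * grad g lam y f

/-- Lowering an index commutes with the covariant derivative, because g is parallel. -/
theorem sum_mul_covGrad (h : IsConformalOn g γ lam U) {y : R4} (hy : y ∈ U) (m c : Fin 4) :
    ∑ a, g y m a * covGrad g lam y c a = hess g lam y c m := by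
  have d2 := fun k => differentiableAt_of_contDiffOn h.metric.isOpen (h.contDiffOn_grad k) hy
  have h1 : pd c (fun z => pd m lam z) y =
      ∑ a, (pd c (fun z => g z m a) y * grad g lam y a
        + g y m a * pd c (fun z => grad g lam z a) y) := by
    rw [← pd_congr h.metric.isOpen (fun z hz => h.sum_mul_grad hz m) c hy, pd_sum]
    · exact Finset.sum_congr rfl fun a _ => pd_mul (h.metric.differentiableAt m a hy) (d2 a) c
    · exact fun a _ => (h.metric.differentiableAt m a hy).fun_mul (d2 a)
  have h2 : ∑ a, pd c (fun z => g z m a) y * grad g lam y a =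
      ∑ f, christoffel g y f c m * pd f lam y
        + ∑ a, g y m a * ∑ f, christoffel g y a c f * grad g lam y f := by
    simp only [h.metric.isParallelOn_self y hy, ← h.sum_mul_grad hy, Finset.sum_add_distrib,
      add_mul, Finset.mul_sum, Finset.sum_mul]
    congr 1
    · rw [Finset.sum_comm]
      iterate 2 refine Finset.sum_congr rfl fun _ _ => ?_
      ring
    · rw [Finset.sum_comm]
      iterate 2 refine Finset.sum_congr rfl fun _ _ => ?_
      ring
  rw [hess, h1, Finset.sum_add_distrib, h2]
  simp only [covGrad, mul_add, Finset.sum_add_distrib]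
  ring

theorem hess_symm (h : IsConformalOn g γ lam U) {y : R4} (hy : y ∈ U) (c b : Fin 4) :
    hess g lam y c b = hess g lam y b c := by
  rw [hess, hess, pd_comm h.metric.isOpen h.smooth c b hy]
  simp only [h.metric.christoffel_symm hy _ c b]

/-- The norm squared of `dλ`. -/
def normSq (g : R4 → Matrix (Fin 4) (Fin 4) ℝ) (lam : R4 → ℝ) (y : R4) : ℝ :=
  ∑ e, pd e lam y * grad g lam y e

theorem sum_christoffel_mul (h : IsConformalOn g γ lam U) {y : R4} (hy : y ∈ U) (a b c d : Fin 4) :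
    ∑ e, christoffel γ y a c e * christoffel γ y e b d =
      ∑ e, christoffel g y a c e * christoffel g y e b d
      + (christoffel g y a c b * pd d lam y + christoffel g y a c d * pd b lam y
        - g y b d * ∑ e, christoffel g y a c e * grad g lam y e)
      + ((if a = c then 1 else 0) * ∑ e, pd e lam y * christoffel g y e b d
        + pd c lam y * christoffel g y a b d
        - grad g lam y a * ∑ e, g y c e * christoffel g y e b d)
      + ((if a = c then 1 else 0) * (2 * pd b lam y * pd d lam y - g y b d * normSq g lam y)
        + pd c lam y * ((if a = b then 1 else 0) * pd d lam y
          + (if a = d then 1 else 0) * pd b lam y - g y b d * grad g lam y a)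
        - grad g lam y a * (g y c b * pd d lam y + g y c d * pd b lam y
          - g y b d * pd c lam y)) := by
  have e1 := sum_delta_left b (fun e => christoffel g y a c e)
  have e2 := sum_delta_left d (fun e => christoffel g y a c e)
  have e3 := sum_delta_right a (fun e => christoffel g y e b d)
  have e4 := sum_delta_left b (fun e => pd e lam y)
  have e5 := sum_delta_left d (fun e => pd e lam y)
  have e6 := sum_delta_right a (fun e => if e = b then 1 else 0)
  have e7 := sum_delta_right a (fun e => if e = d then 1 else 0)
  have e8 := sum_delta_right a (fun e => grad g lam y e)
  have e9 := sum_delta_left b (fun e => g y c e)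
  have e10 := sum_delta_left d (fun e => g y c e)
  have e11 := h.sum_mul_grad hy c
  calc _ = ∑ e, christoffel g y a c e * christoffel g y e b d
      + ((∑ e, (if e = b then 1 else 0) * christoffel g y a c e) * pd d lam y
        + (∑ e, (if e = d then 1 else 0) * christoffel g y a c e) * pd b lam y
        - g y b d * ∑ e, christoffel g y a c e * grad g lam y e)
      + ((if a = c then 1 else 0) * ∑ e, pd e lam y * christoffel g y e b d
        + pd c lam y * (∑ e, (if a = e then 1 else 0) * christoffel g y e b d)
        - grad g lam y a * ∑ e, g y c e * christoffel g y e b d)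
      + ((if a = c then 1 else 0) * ((∑ e, (if e = b then 1 else 0) * pd e lam y) * pd d lam y
          + (∑ e, (if e = d then 1 else 0) * pd e lam y) * pd b lam y
          - g y b d * ∑ e, pd e lam y * grad g lam y e)
        + pd c lam y * ((∑ e, (if a = e then 1 else 0) * (if e = b then 1 else 0)) * pd d lam y
          + (∑ e, (if a = e then 1 else 0) * (if e = d then 1 else 0)) * pd b lam y
          - g y b d * ∑ e, (if a = e then 1 else 0) * grad g lam y e)
        - grad g lam y a * ((∑ e, (if e = b then 1 else 0) * g y c e) * pd d lam y
          + (∑ e, (if e = d then 1 else 0) * g y c e) * pd b lam y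
          - g y b d * ∑ e, g y c e * grad g lam y e)) := by
        simp only [h.christoffel_eq hy, confTerm, Finset.mul_sum, Finset.sum_mul,
          ← Finset.sum_add_distrib, ← Finset.sum_sub_distrib]
        exact Finset.sum_congr rfl fun e _ => by ring
    _ = _ := by
        rw [e1, e2, e3, e4, e5, e6, e7, e8, e9, e10, e11, normSq]
        ring

/-- Expand ∂Γ + ΓΓ with Γ replaced by Γ + `confTerm`; metric compatibility rewrites the derivatives
of g, and the partial derivatives of dλ and its gradient complete to covariant ones. -/
theorem riemannUp_eq (h : IsConformalOn g γ lam U) {x : R4} (hx : x ∈ U) (a b c d : Fin 4) :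
    riemannUp γ x a b c d = riemannUp g x a b c d
      + ((if a = d then 1 else 0) * (hess g lam x c b - pd c lam x * pd b lam x
          + normSq g lam x * g x c b)
        - (if a = c then 1 else 0) * (hess g lam x d b - pd d lam x * pd b lam x
          + normSq g lam x * g x d b)
        - covGrad g lam x c a * g x d b + covGrad g lam x d a * g x c b
        + grad g lam x a * (pd c lam x * g x d b - pd d lam x * g x c b)) := by
  have hpd : ∀ c b d, pd c (fun y => christoffel γ y a b d) x =
      pd c (fun y => christoffel g y a b d) x + pd c (fun y => confTerm g lam y a b d) x := by
    intro c b d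
    have d1 : ∀ i, DifferentiableAt ℝ (fun z => pd i lam z) x := fun i =>
      differentiableAt_of_contDiffOn h.metric.isOpen (h.contDiffOn_pd_lam i) hx
    have d2 := differentiableAt_of_contDiffOn h.metric.isOpen (h.contDiffOn_grad a) hx
    have d3 := h.metric.differentiableAt b d hx
    rw [pd_congr h.metric.isOpen (fun y hy => h.christoffel_eq hy a b d) c hx,
      pd_add (h.metric.differentiableAt_christoffel a b d hx)]
    exact (((d1 d).const_mul _).fun_add ((d1 b).const_mul _)).fun_sub (d3.fun_mul d2)
  have hg : ∀ i j, g x i j = g x j i := h.metric.symm x hx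
  have hΓ : ∀ k i j, christoffel g x k i j = christoffel g x k j i := h.metric.christoffel_symm hx
  have hcomm := pd_comm h.metric.isOpen h.smooth c d hx
  have p1 := h.metric.isParallelOn_self x hx c b d
  have p2 := h.metric.isParallelOn_self x hx d b c
  rw [Finset.sum_add_distrib] at p1 p2
  have q1 : ∑ f, christoffel g x f c b * g x f d = ∑ e, g x d e * christoffel g x e b c :=
    Finset.sum_congr rfl fun e _ => by rw [hΓ e c b, hg e d]; ring
  have q2 : ∑ f, christoffel g x f d b * g x f c = ∑ e, g x c e * christoffel g x e b d :=
    Finset.sum_congr rfl fun e _ => by rw [hΓ e d b, hg e c]; ring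
  have q3 : ∑ f, christoffel g x f d c * g x b f = ∑ f, christoffel g x f c d * g x b f :=
    Finset.sum_congr rfl fun e _ => by rw [hΓ e d c]
  rw [q1] at p1
  rw [q2, q3] at p2
  have r1 : ∀ d, ∑ e, pd e lam x * christoffel g x e b d = ∑ f, christoffel g x f d b * pd f lam x :=
    fun d => Finset.sum_congr rfl fun e _ => by rw [hΓ e d b]; ring
  simp only [riemannUp, Finset.sum_sub_distrib]
  rw [h.sum_christoffel_mul hx a b c d, h.sum_christoffel_mul hx a b d c, hpd, hpd,
    h.pd_confTerm hx, h.pd_confTerm hx, r1, r1, p1, p2, hcomm]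
  simp only [hess, covGrad]
  rw [hΓ a c d, hg c b, hg d b, hg c d, hΓ a c b, hΓ a d b]
  ring

theorem exists_riemann_eq (h : IsConformalOn g γ lam U) {x : R4} (hx : x ∈ U) :
    ∃ T : Matrix (Fin 4) (Fin 4) ℝ, riemann γ x =
      Real.exp (2 * lam x) • riemann g x + extProd (γ x) T := by
  -- `T` is minus (∇dλ - dλ⊗dλ + ½|dλ|² g). The ½ appears because in γ∧T the term in g is counted
  -- once for each factor. Later arguments use only the shape γ∧T.
  refine ⟨fun c b => -(hess g lam x c b - pd c lam x * pd b lam x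
    + (1 / 2) * normSq g lam x * g x c b), ?_⟩
  have hg : ∀ i j, g x i j = g x j i := h.metric.symm x hx
  funext m b c d
  simp only [riemann, Pi.add_apply, Pi.smul_apply, smul_eq_mul, extProd, h.apply_eq hx,
    h.riemannUp_eq hx]
  have s1 : ∀ d, ∑ a, (if a = d then 1 else 0) * g x m a = g x m d := fun d =>
    sum_delta_left d (fun a => g x m a)
  have s2 := fun c => h.sum_mul_covGrad hx m c
  have s3 := h.sum_mul_grad hx m
  calc _ = Real.exp (2 * lam x) * (∑ a, g x m a * riemannUp g x a b c d
      + ((∑ a, (if a = d then 1 else 0) * g x m a) * (hess g lam x c b - pd c lam x * pd b lam x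
          + normSq g lam x * g x c b)
        - (∑ a, (if a = c then 1 else 0) * g x m a) * (hess g lam x d b - pd d lam x * pd b lam x
          + normSq g lam x * g x d b)
        - (∑ a, g x m a * covGrad g lam x c a) * g x d b
        + (∑ a, g x m a * covGrad g lam x d a) * g x c b
        + (∑ a, g x m a * grad g lam x a) * (pd c lam x * g x d b - pd d lam x * g x c b))) := by
        simp only [Finset.mul_sum, Finset.sum_mul, ← Finset.sum_add_distrib,
          ← Finset.sum_sub_distrib]
        exact Finset.sum_congr rfl fun e _ => by ring
    _ = _ := by
        rw [s1, s1, s2, s2, s3, hg c b, hg d b, h.hess_symm hx d m, h.hess_symm hx c m,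
          h.hess_symm hx c b, h.hess_symm hx d b]
        ring

/-- As `T` is parallel for g, only the derivative of e^{2λ} and the `confTerm` corrections
contribute, and the terms in ∂ᵢλ cancel. What remains is linear in dλ and in its contraction with
`T`. -/
theorem cov2_eq (h : IsConformalOn g γ lam U) {T : R4 → Matrix (Fin 4) (Fin 4) ℝ}
    (hT : ∀ i j, ContDiffOn ℝ ∞ (fun y => T y i j) U) (hTs : ∀ y ∈ U, (T y).IsSymm)
    (hpar : IsParallelOn g T U) {y : R4} (hy : y ∈ U) (i j k : Fin 4) :
    cov2 γ (fun z => Real.exp (2 * lam z) • T z) y i j k =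
      γ y i j * (∑ f, T y k f * grad g lam y f) + γ y i k * (∑ f, T y j f * grad g lam y f)
      - Real.exp (2 * lam y) * T y i k * pd j lam y
      - Real.exp (2 * lam y) * T y i j * pd k lam y := by
  have hd := h.differentiableAt_lam hy
  have hs : ∀ i j, T y i j = T y j i := fun i j => (hTs y hy).apply j i
  have s1 := sum_delta_left i (fun f => T y f k)
  have s2 := sum_delta_left j (fun f => T y f k)
  have s3 := sum_delta_left i (fun f => T y j f)
  have s4 := sum_delta_left k (fun f => T y j f)
  have hm : pd i (fun z => Real.exp (2 * lam z) * T z j k) y =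
      Real.exp (2 * lam y) * (2 * pd i lam y * T y j k + pd i (fun z => T z j k) y) := by
    rw [pd_mul (hd.const_mul 2).exp (differentiableAt_of_contDiffOn h.metric.isOpen (hT j k) hy),
      pd_exp_two_mul hd]
    ring
  simp only [cov2, Matrix.smul_apply, smul_eq_mul]
  rw [hm, hpar y hy]
  calc _ = Real.exp (2 * lam y) * (2 * pd i lam y * T y j k
      - ((∑ f, (if f = i then 1 else 0) * T y f k) * pd j lam y
        + (∑ f, (if f = j then 1 else 0) * T y f k) * pd i lam y
        - g y i j * ∑ f, T y k f * grad g lam y f)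
      - ((∑ f, (if f = i then 1 else 0) * T y j f) * pd k lam y
        + (∑ f, (if f = k then 1 else 0) * T y j f) * pd i lam y
        - g y i k * ∑ f, T y j f * grad g lam y f)) := by
        have : ∑ f, (christoffel γ y f i j * (Real.exp (2 * lam y) * T y f k)
            + christoffel γ y f i k * (Real.exp (2 * lam y) * T y j f)) =
          Real.exp (2 * lam y) * (∑ f, (christoffel g y f i j * T y f k
              + christoffel g y f i k * T y j f)
            + ((∑ f, (if f = i then 1 else 0) * T y f k) * pd j lam y
              + (∑ f, (if f = j then 1 else 0) * T y f k) * pd i lam y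
              - g y i j * ∑ f, T y k f * grad g lam y f)
            + ((∑ f, (if f = i then 1 else 0) * T y j f) * pd k lam y
              + (∑ f, (if f = k then 1 else 0) * T y j f) * pd i lam y
              - g y i k * ∑ f, T y j f * grad g lam y f)) := by
          simp only [h.christoffel_eq hy, confTerm, Finset.mul_sum, Finset.sum_mul,
            ← Finset.sum_add_distrib, ← Finset.sum_sub_distrib]
          refine Finset.sum_congr rfl fun f _ => ?_
          rw [hs k f]; ring
        rw [this]; ring
    _ = _ := by
        rw [s1, s2, s3, s4, h.apply_eq hy, h.apply_eq hy, hs j i]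
        ring

end IsConformalOn

/-! ### Divergence of the pure part and the 1-form `Φ` -/

theorem IsSplit.smul {γ v h : Matrix (Fin 4) (Fin 4) ℝ} (H : IsSplit γ v h) {c : ℝ} (hc : c ≠ 0) :
    IsSplit (c • γ) (c • v) (c • h) := by
  have hinv : (c • γ)⁻¹ = c⁻¹ • γ⁻¹ := by
    refine Matrix.inv_eq_right_inv ?_
    rw [Matrix.smul_mul, Matrix.mul_smul, smul_smul, mul_inv_cancel₀ hc, one_smul, H.self_mul_inv]
  have hm : ∀ X Y : Matrix (Fin 4) (Fin 4) ℝ,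
      (c • X) * (c • γ)⁻¹ * (c • Y) = c • (X * γ⁻¹ * Y) := by
    intro X Y
    rw [hinv]
    simp only [Matrix.smul_mul, Matrix.mul_smul, smul_smul]
    congr 1
    field_simp
  have ht : ∀ X : Matrix (Fin 4) (Fin 4) ℝ, mtrace (c • γ) (c • X) = mtrace γ X := by
    intro X
    simp only [mtrace, hinv, Matrix.smul_apply, smul_eq_mul]
    iterate 2 refine Finset.sum_congr rfl fun _ _ => ?_
    field_simp
  refine ⟨by rw [H.eq_add, smul_add], ?_, H.symm_left.smul c, H.symm_right.smul c, ?_, ?_, ?_, ?_,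
    ?_, ?_⟩
  · rw [Matrix.det_smul]; exact mul_ne_zero (pow_ne_zero _ hc) H.det_ne
  · rw [hm, H.left_left]
  · rw [hm, H.left_right, smul_zero]
  · rw [hm, H.right_left, smul_zero]
  · rw [hm, H.right_right]
  · rw [ht, H.mtrace_left]
  · rw [ht, H.mtrace_right]

/-- The inner product of two covectors. -/
def pair (γ : Matrix (Fin 4) (Fin 4) ℝ) (p q : Fin 4 → ℝ) : ℝ := ∑ e, ∑ a, p e * γ⁻¹ e a * q a

theorem pair_rows (γ A B : Matrix (Fin 4) (Fin 4) ℝ) (hB : B.IsSymm) (b c : Fin 4) :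
    pair γ (A b) (B c) = (A * γ⁻¹ * B) b c := by
  rw [← mul_mul_apply_eq_sum]
  simp only [pair, hB.apply]

theorem pair_row_eq (γ A : Matrix (Fin 4) (Fin 4) ℝ) (a : Fin 4) (q : Fin 4 → ℝ) :
    pair γ (A a) q = (A * γ⁻¹).mulVec q a := by
  simp only [pair, Matrix.mulVec, dotProduct, Matrix.mul_apply, Finset.sum_mul]
  exact Finset.sum_comm

theorem pair_self_row {γ v h : Matrix (Fin 4) (Fin 4) ℝ} (H : IsSplit γ v h) (p : Fin 4 → ℝ)
    (b : Fin 4) : pair γ (γ b) p = p b := by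
  have := mul_inv_contract H.det_ne p b
  rw [← this]
  simp only [pair, Finset.mul_sum]
  iterate 2 refine Finset.sum_congr rfl fun _ _ => ?_
  ring

/-- `∇^a (v ∧ v)_{abcd}` when `∇ᵢ v_{jk} = γ_{ij} ν_k + γ_{ik} ν_j - v_{ik} λ_j - v_{ij} λ_k`. -/
theorem div_extProd_self {γ v h : Matrix (Fin 4) (Fin 4) ℝ} (H : IsSplit γ v h)
    {N : Fin 4 → Fin 4 → Fin 4 → ℝ} {l ν : Fin 4 → ℝ}
    (hN : ∀ i j k, N i j k = γ i j * ν k + γ i k * ν j - v i k * l j - v i j * l k)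
    (hν : ∀ a, ν a = pair γ (v a) l) (b c d : Fin 4) :
    ∑ e, ∑ a, γ⁻¹ e a * (2 * (N e a c * v b d + v a c * N e b d - N e a d * v b c
        - v a d * N e b c)) =
      2 * ((3 * ν c - l c) * v b d - (3 * ν d - l d) * v b c) := by
  have hs : ∀ i j, v i j = v j i := fun i j => H.symm_left.apply j i
  have hsγ : ∀ i j, γ i j = γ j i := fun i j => H.symm.apply j i
  have p1 : ∀ c, pair γ (γ c) ν = ν c := pair_self_row H ν
  have p2 : ∀ b c, pair γ (γ b) (v c) = v b c := by
    intro b c; rw [pair_self_row H, hs]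
  have p3 : ∀ b c, pair γ (v b) (v c) = v b c := by
    intro b c; rw [pair_rows γ v v H.symm_left, H.left_left]
  -- Contractions reduce to the traces 4 and 2 and to v γ⁻¹ v = v. The coefficient of ν_c is 4 + 1 -
  -- 1 from the first term and -1 from the last, hence 3; that of l_c is -2 + 1.
  calc _ = 2 * ((mtrace γ γ * ν c + pair γ (γ c) ν - pair γ (v c) l - mtrace γ v * l c) * v b d
      + (pair γ (γ b) (v c) * ν d + pair γ (γ d) (v c) * ν b - pair γ (v d) (v c) * l b
        - pair γ (v b) (v c) * l d)
      - (mtrace γ γ * ν d + pair γ (γ d) ν - pair γ (v d) l - mtrace γ v * l d) * v b c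
      - (pair γ (γ b) (v d) * ν c + pair γ (γ c) (v d) * ν b - pair γ (v c) (v d) * l b
        - pair γ (v b) (v d) * l c)) := by
        simp only [hN, pair, mtrace, Finset.mul_sum, Finset.sum_mul, ← Finset.sum_add_distrib,
          ← Finset.sum_sub_distrib]
        refine Finset.sum_congr rfl fun e _ => Finset.sum_congr rfl fun a _ => ?_
        rw [hs a c, hs a d, hs e c, hs e d, hs e b, hsγ e c, hsγ e d, hsγ e b]
        ring
    _ = _ := by
        rw [p1, p1, ← hν, ← hν, p2, p2, p2, p2, p3, p3, p3, p3, H.mtrace_left, H.mtrace_self,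
          hs d c]
        ring

/-- Π acts on each factor separately since v γ⁻¹ h = 0, so only the v-part of `p` and the h-part of
`q` survive. In the trace each factor of dimension two gives 2(ν - 2ν) = -2ν, respectively with μ.
-/
theorem trace3_act3_pureForm {γ v h : Matrix (Fin 4) (Fin 4) ℝ} (H : IsSplit γ v h)
    {p q ν μ : Fin 4 → ℝ} (hp : ∀ a, pair γ (v a) p = 2 * ν a) (hq : ∀ a, pair γ (h a) q = 2 * μ a)
    (hν : ∀ a, pair γ (v a) ν = ν a) (hμ : ∀ a, pair γ (h a) μ = μ a) (a : Fin 4) :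
    trace3 γ (act3 γ (-IsSplit.pureForm v h) (fun b c d =>
      -((p c * v b d - p d * v b c) + (q c * h b d - q d * h b c)))) a = -2 * (ν a + μ a) := by
  have hs : ∀ i j, v i j = v j i := fun i j => H.symm_left.apply j i
  have hs' : ∀ i j, h i j = h j i := fun i j => H.symm_right.apply j i
  have act : ∀ l a b, act3 γ (-IsSplit.pureForm v h) (fun b c d =>
      -((p c * v b d - p d * v b c) + (q c * h b d - q d * h b c))) l a b =
      2 * (ν a * v b l - ν b * v a l) + 2 * (μ a * h b l - μ b * h a l) := by
    intro l a b
    have vv : ∀ b c, pair γ (v b) (v c) = v b c := fun b c => by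
      rw [pair_rows γ v v H.symm_left, H.left_left]
    have hh : ∀ b c, pair γ (h b) (h c) = h b c := fun b c => by
      rw [pair_rows γ h h H.symm_right, H.right_right]
    have vh : ∀ b c, pair γ (v b) (h c) = 0 := fun b c => by
      rw [pair_rows γ v h H.symm_right, H.left_right]; rfl
    have hv : ∀ b c, pair γ (h b) (v c) = 0 := fun b c => by
      rw [pair_rows γ h v H.symm_left, H.right_left]; rfl
    have key : ∀ x y r s : Fin 4 → ℝ, ∑ k, ∑ t, ∑ m, ∑ n, (x k * y t - x t * y k) * γ⁻¹ k m * γ⁻¹ t n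
        * (r m * s n - r n * s m) = 2 * (pair γ x r * pair γ y s - pair γ x s * pair γ y r) := by
      intro x y r s
      have e1 := fun x y r s : Fin 4 → ℝ => sum_contract γ⁻¹ x y r s
      calc _ = ∑ k, ∑ t, ∑ m, ∑ n, (x k * y t * γ⁻¹ k m * γ⁻¹ t n * (r m * s n)
            - x k * y t * γ⁻¹ k m * γ⁻¹ t n * (s m * r n)
            - y k * x t * γ⁻¹ k m * γ⁻¹ t n * (r m * s n)
            + y k * x t * γ⁻¹ k m * γ⁻¹ t n * (s m * r n)) := by
            iterate 4 refine Finset.sum_congr rfl fun _ _ => ?_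
            ring
        _ = _ := by
            simp only [Finset.sum_add_distrib, Finset.sum_sub_distrib, e1]
            simp only [pair]; ring
    have k1 := key (v a) (v b) p (v l)
    have k2 := key (v a) (v b) q (h l)
    have k3 := key (h a) (h b) p (v l)
    have k4 := key (h a) (h b) q (h l)
    rw [hp, hp, vv, vv] at k1
    rw [vh, vh] at k2
    rw [hv, hv] at k3
    rw [hq, hq, hh, hh] at k4
    calc _ = (1 / 2) * (∑ k, ∑ t, ∑ m, ∑ n, (v a k * v b t - v a t * v b k) * γ⁻¹ k m * γ⁻¹ t n
          * (p m * v l n - p n * v l m)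
        + ∑ k, ∑ t, ∑ m, ∑ n, (v a k * v b t - v a t * v b k) * γ⁻¹ k m * γ⁻¹ t n
          * (q m * h l n - q n * h l m)
        + ∑ k, ∑ t, ∑ m, ∑ n, (h a k * h b t - h a t * h b k) * γ⁻¹ k m * γ⁻¹ t n
          * (p m * v l n - p n * v l m)
        + ∑ k, ∑ t, ∑ m, ∑ n, (h a k * h b t - h a t * h b k) * γ⁻¹ k m * γ⁻¹ t n
          * (q m * h l n - q n * h l m)) := by
          simp only [act3, ← Finset.sum_add_distrib]
          congr 1
          iterate 4 refine Finset.sum_congr rfl fun _ _ => ?_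
          simp only [IsSplit.pureForm, extProd, Pi.neg_apply, Pi.add_apply, Pi.smul_apply,
            smul_eq_mul]
          ring
      _ = _ := by rw [k1, k2, k3, k4]; ring
  have tr1 : ∀ (w : Matrix (Fin 4) (Fin 4) ℝ) (ν : Fin 4 → ℝ), (∀ i j, w i j = w j i) →
      (∀ a, pair γ (w a) ν = ν a) → mtrace γ w = 2 →
      ∑ l, ∑ m, γ⁻¹ l m * (2 * (ν m * w a l - ν a * w m l)) = -2 * ν a := by
    intro w ν hw hν hm
    calc _ = 2 * (pair γ (w a) ν - mtrace γ w * ν a) := by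
          simp only [pair, mtrace, Finset.mul_sum, Finset.sum_mul, ← Finset.sum_sub_distrib]
          refine Finset.sum_congr rfl fun l _ => Finset.sum_congr rfl fun m _ => ?_
          rw [hw m l]; ring
      _ = _ := by rw [hν, hm]; ring
  simp only [trace3, act, mul_add, Finset.sum_add_distrib]
  rw [tr1 v ν hs hν H.mtrace_left, tr1 h μ hs' hμ H.mtrace_right]

/-- The Leibniz rule for ∇(T∧T), with two of the four terms paired off. -/
theorem cov4_extProd_self {γ T : R4 → Matrix (Fin 4) (Fin 4) ℝ} {U : Set R4} (hU : IsOpen U)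
    (hT : ∀ i j, ContDiffOn ℝ ∞ (fun y => T y i j) U) {x : R4} (hx : x ∈ U) (e a b c d : Fin 4) :
    pd e (fun y => extProd (T y) (T y) a b c d) x
      - ∑ f, (christoffel γ x f e a * extProd (T x) (T x) f b c d
        + christoffel γ x f e b * extProd (T x) (T x) a f c d
        + christoffel γ x f e c * extProd (T x) (T x) a b f d
        + christoffel γ x f e d * extProd (T x) (T x) a b c f) =
      2 * (cov2 γ T x e a c * T x b d + T x a c * cov2 γ T x e b d
        - cov2 γ T x e a d * T x b c - T x a d * cov2 γ T x e b c) := by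
  have dT : ∀ i j, DifferentiableAt ℝ (fun y => T y i j) x := fun i j =>
    differentiableAt_of_contDiffOn hU (hT i j) hx
  have hfun : (fun y => extProd (T y) (T y) a b c d) =
      fun y => 2 * (T y a c * T y b d - T y a d * T y b c) := by
    funext y; simp only [extProd]; ring
  rw [hfun, pd_const_mul 2 (((dT a c).fun_mul (dT b d)).fun_sub ((dT a d).fun_mul (dT b c))),
    pd_sub ((dT a c).fun_mul (dT b d)) ((dT a d).fun_mul (dT b c)), pd_mul (dT a c) (dT b d),
    pd_mul (dT a d) (dT b c)]
  simp only [cov2, extProd, Finset.sum_add_distrib, mul_sub, sub_mul, mul_add, add_mul,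
    Finset.sum_mul, Finset.mul_sum]
  simp only [Fin.sum_univ_four]
  ring

/-- An orthogonal splitting `g = a + b` into parallel tensors. -/
structure IsParallelSplitOn (g a b : R4 → Matrix (Fin 4) (Fin 4) ℝ) (U : Set R4) : Prop where
  smooth_left : ∀ i j, ContDiffOn ℝ ∞ (fun y => a y i j) U
  smooth_right : ∀ i j, ContDiffOn ℝ ∞ (fun y => b y i j) U
  split : ∀ y ∈ U, IsSplit (g y) (a y) (b y)
  parallel_left : IsParallelOn g a U
  parallel_right : IsParallelOn g b U

/-- Let ν and μ be the projections of dλ on the two factors. The divergence of -Π involves 3ν - dλ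
and 3μ - dλ, whose projections on their own factors are 2ν and 2μ; the final trace gives -2(ν + μ) =
-2dλ. The identity S = -Π is assumed on the whole open set because it is differentiated. -/
theorem phi_eq {g γ a b : R4 → Matrix (Fin 4) (Fin 4) ℝ} {lam : R4 → ℝ} {U : Set R4}
    (h : IsConformalOn g γ lam U) (hp : IsParallelSplitOn g a b U)
    (hS : ∀ y ∈ U, bigS γ y = -IsSplit.pureForm (Real.exp (2 * lam y) • a y)
      (Real.exp (2 * lam y) • b y)) {x : R4} (hx : x ∈ U) (i : Fin 4) :
    phi γ x i = -2 * pd i lam x := by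
  have hU := h.metric.isOpen
  set E := Real.exp (2 * lam x) with hE
  have hE0 : E ≠ 0 := Real.exp_ne_zero _
  set v : R4 → Matrix (Fin 4) (Fin 4) ℝ := fun y => Real.exp (2 * lam y) • a y with hv
  set w : R4 → Matrix (Fin 4) (Fin 4) ℝ := fun y => Real.exp (2 * lam y) • b y with hw
  have H : IsSplit (γ x) (v x) (w x) := by
    rw [h.eq x hx]; exact (hp.split x hx).smul hE0
  have hexp : ContDiffOn ℝ ∞ (fun y => Real.exp (2 * lam y)) U :=
    (contDiffOn_const.mul h.smooth).exp
  have sv : ∀ i j, ContDiffOn ℝ ∞ (fun y => v y i j) U := fun i j => hexp.mul (hp.smooth_left i j)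
  have sw : ∀ i j, ContDiffOn ℝ ∞ (fun y => w y i j) U := fun i j => hexp.mul (hp.smooth_right i j)
  set l : Fin 4 → ℝ := fun i => pd i lam x with hl
  set ν : Fin 4 → ℝ := fun k => pair (γ x) (v x k) l with hν
  set μ : Fin 4 → ℝ := fun k => pair (γ x) (w x k) l with hμ
  have hgrad : ∀ (T : Matrix (Fin 4) (Fin 4) ℝ) k, ∑ f, T k f * grad g lam x f =
      pair (γ x) ((E • T) k) l := by
    intro T k
    simp only [grad, pair, h.inv_eq hx, Finset.mul_sum, Matrix.smul_apply, smul_eq_mul, ← hE]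
    iterate 2 refine Finset.sum_congr rfl fun _ _ => ?_
    field_simp
    rfl
  have hNv : ∀ i j k, cov2 γ v x i j k =
      γ x i j * ν k + γ x i k * ν j - v x i k * l j - v x i j * l k := by
    intro i j k
    rw [h.cov2_eq hp.smooth_left (fun y hy => (hp.split y hy).symm_left) hp.parallel_left hx,
      hgrad, hgrad]
    rfl
  have hNw : ∀ i j k, cov2 γ w x i j k =
      γ x i j * μ k + γ x i k * μ j - w x i k * l j - w x i j * l k := by
    intro i j k
    rw [h.cov2_eq hp.smooth_right (fun y hy => (hp.split y hy).symm_right) hp.parallel_right hx,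
      hgrad, hgrad]
    rfl
  have hdiv : diverg γ (bigS γ) x = fun b c d =>
      -(((3 * ν c - l c) * v x b d - (3 * ν d - l d) * v x b c)
        + ((3 * μ c - l c) * w x b d - (3 * μ d - l d) * w x b c)) := by
    funext b c d
    have d1 := div_extProd_self H hNv (fun _ => rfl) b c d
    have d2 := div_extProd_self H.swap hNw (fun _ => rfl) b c d
    simp only [← cov4_extProd_self hU sv hx] at d1
    simp only [← cov4_extProd_self hU sw hx] at d2
    have hpdS : ∀ e a, pd e (fun y => bigS γ y a b c d) x =
        -((1 / 2) * pd e (fun y => extProd (v y) (v y) a b c d) x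
          + (1 / 2) * pd e (fun y => extProd (w y) (w y) a b c d) x) := by
      intro e a
      have hd : ∀ T : R4 → Matrix (Fin 4) (Fin 4) ℝ, (∀ i j, ContDiffOn ℝ ∞ (fun y => T y i j) U) →
          DifferentiableAt ℝ (fun y => extProd (T y) (T y) a b c d) x := by
        intro T hT
        refine differentiableAt_of_contDiffOn hU ?_ hx
        simp only [extProd]
        exact (((hT _ _).mul (hT _ _)).add ((hT _ _).mul (hT _ _))).sub
          ((hT _ _).mul (hT _ _)) |>.sub ((hT _ _).mul (hT _ _))
      have hc : ∀ y ∈ U, bigS γ y a b c d = (-1 / 2) * extProd (v y) (v y) a b c d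
          + (-1 / 2) * extProd (w y) (w y) a b c d := by
        intro y hy
        rw [hS y hy]
        simp only [IsSplit.pureForm, Pi.neg_apply, Pi.add_apply, Pi.smul_apply, smul_eq_mul]
        ring
      rw [pd_congr hU hc e hx, pd_add ((hd v sv).const_mul _) ((hd w sw).const_mul _),
        pd_const_mul _ (hd v sv), pd_const_mul _ (hd w sw)]
      ring
    have hSx : ∀ a b c d, bigS γ x a b c d = -((1 / 2) * extProd (v x) (v x) a b c d
        + (1 / 2) * extProd (w x) (w x) a b c d) := by
      intro a b c d; rw [hS x hx]; rfl
    have : ∀ p q : ℝ, p = 2 * q → (1 / 2) * p = q := by intros; linarith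
    rw [← this _ _ d1, ← this _ _ d2]
    have key : ∀ e a, pd e (fun y => bigS γ y a b c d) x
        - ∑ f, (christoffel γ x f e a * bigS γ x f b c d + christoffel γ x f e b * bigS γ x a f c d
          + christoffel γ x f e c * bigS γ x a b f d + christoffel γ x f e d * bigS γ x a b c f) =
        -((1 / 2) * (pd e (fun y => extProd (v y) (v y) a b c d) x
            - ∑ f, (christoffel γ x f e a * extProd (v x) (v x) f b c d
              + christoffel γ x f e b * extProd (v x) (v x) a f c d
              + christoffel γ x f e c * extProd (v x) (v x) a b f d
              + christoffel γ x f e d * extProd (v x) (v x) a b c f))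
          + (1 / 2) * (pd e (fun y => extProd (w y) (w y) a b c d) x
            - ∑ f, (christoffel γ x f e a * extProd (w x) (w x) f b c d
              + christoffel γ x f e b * extProd (w x) (w x) a f c d
              + christoffel γ x f e c * extProd (w x) (w x) a b f d
              + christoffel γ x f e d * extProd (w x) (w x) a b c f))) := by
      intro e a
      rw [hpdS]
      simp only [hSx, Fin.sum_univ_four]
      ring
    have lin : ∀ A B : Fin 4 → Fin 4 → ℝ,
        ∑ e, ∑ a, (γ x)⁻¹ e a * -((1 / 2) * A e a + (1 / 2) * B e a) =
        -((1 / 2) * ∑ e, ∑ a, (γ x)⁻¹ e a * A e a + (1 / 2) * ∑ e, ∑ a, (γ x)⁻¹ e a * B e a) := by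
      intro A B
      simp only [Finset.mul_sum, ← Finset.sum_add_distrib, ← Finset.sum_neg_distrib]
      refine Finset.sum_congr rfl fun e _ => Finset.sum_congr rfl fun a _ => ?_
      ring
    simp only [diverg, key]
    exact lin _ _
  have hνe : ν = (v x * (γ x)⁻¹).mulVec l := funext fun a => pair_row_eq _ _ _ _
  have hμe : μ = (w x * (γ x)⁻¹).mulVec l := funext fun a => pair_row_eq _ _ _ _
  have hνν : ∀ a, pair (γ x) (v x a) ν = ν a := by
    intro a
    rw [pair_row_eq, hνe, Matrix.mulVec_mulVec, ← mul_assoc, H.left_left]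
  have hμμ : ∀ a, pair (γ x) (w x a) μ = μ a := by
    intro a
    rw [pair_row_eq, hμe, Matrix.mulVec_mulVec, ← mul_assoc, H.right_right]
  have hsum : ∀ a, ν a + μ a = l a := by
    intro a
    rw [hνe, hμe, ← Pi.add_apply, ← Matrix.add_mulVec, ← add_mul, ← H.eq_add, H.self_mul_inv,
      Matrix.one_mulVec]
  have lin : ∀ (A : Matrix (Fin 4) (Fin 4) ℝ) (a : Fin 4) (p : Fin 4 → ℝ),
      pair (γ x) (A a) (fun c => 3 * p c - l c) =
        3 * pair (γ x) (A a) p - pair (γ x) (A a) l := by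
    intro A a p
    simp only [pair, Finset.mul_sum, ← Finset.sum_sub_distrib]
    refine Finset.sum_congr rfl fun e _ => Finset.sum_congr rfl fun a _ => ?_
    ring
  -- The two remaining goals say that 3ν - dλ projects to 3ν - ν = 2ν on the first factor, and
  -- likewise for μ.
  rw [phi, hdiv, hS x hx, trace3_act3_pureForm H (ν := ν) (μ := μ) (p := fun c => 3 * ν c - l c)
    (q := fun c => 3 * μ c - l c) ?_ ?_ hνν hμμ, hsum]
  · intro a
    rw [lin, hνν]; change 3 * ν a - ν a = _; ring
  · intro a
    rw [lin, hμμ]; change 3 * μ a - μ a = _; ring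

/-! ### Pullbacks of product metrics -/

/-- Christoffel symbols of the first kind `½ (∂ᵢ T_{kj} + ∂ⱼ T_{ki} - ∂ₖ T_{ij})`. -/
def firstKind (T : R4 → Matrix (Fin 4) (Fin 4) ℝ) (y : R4) (k i j : Fin 4) : ℝ :=
  (1 / 2) * (pd i (fun z => T z k j) y + pd j (fun z => T z k i) y - pd k (fun z => T z i j) y)

/-- The pullback of the metric `w` on `ℝ²` by the map with components `x`. -/
def pull2 (w : (Fin 2 → ℝ) → Matrix (Fin 2) (Fin 2) ℝ) (x : Fin 2 → R4 → ℝ) (y : R4) :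
    Matrix (Fin 4) (Fin 4) ℝ := fun j k =>
  ∑ A, ∑ B, w (fun C => x C y) A B * (pd j (x A) y * pd k (x B) y)

theorem pd_comp {f : (Fin 2 → ℝ) → ℝ} {x : Fin 2 → R4 → ℝ} {y : R4}
    (hf : DifferentiableAt ℝ f (fun C => x C y)) (hx : ∀ C, DifferentiableAt ℝ (x C) y)
    (i : Fin 4) : pd i (fun z => f (fun C => x C z)) y =
      ∑ C, pd i (x C) y * fderiv ℝ f (fun C => x C y) (Pi.single C 1) := by
  have hx' : DifferentiableAt ℝ (fun z => fun C => x C z) y := differentiableAt_pi.2 hx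
  have h1 : HasFDerivAt (fun z => f (fun C => x C z)) _ y :=
    HasFDerivAt.comp y hf.hasFDerivAt hx'.hasFDerivAt
  rw [pd, h1.fderiv, ContinuousLinearMap.comp_apply]
  have h2 : fderiv ℝ (fun z => fun C => x C z) y (EuclideanSpace.single i 1) =
      ∑ C, pd i (x C) y • (Pi.single C (1 : ℝ) : Fin 2 → ℝ) := by
    ext C
    rw [fderiv_pi hx]
    simp [pd, Pi.single_apply]
  rw [h2, map_sum]
  simp

section pull2
variable {w : (Fin 2 → ℝ) → Matrix (Fin 2) (Fin 2) ℝ} {x : Fin 2 → R4 → ℝ} {U : Set R4}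
  {s : Set (Fin 2 → ℝ)}

theorem contDiffOn_comp_pair {f : (Fin 2 → ℝ) → ℝ} (hf : ContDiffOn ℝ ∞ f s)
    (hx : ∀ C, ContDiffOn ℝ ∞ (x C) U) (hm : ∀ y ∈ U, (fun C => x C y) ∈ s) :
    ContDiffOn ℝ ∞ (fun y => f (fun C => x C y)) U :=
  hf.comp (contDiffOn_pi.2 hx) hm

theorem contDiffOn_pull2 (hU : IsOpen U) (hw : ∀ i j, ContDiffOn ℝ ∞ (fun u => w u i j) s)
    (hx : ∀ C, ContDiffOn ℝ ∞ (x C) U) (hm : ∀ y ∈ U, (fun C => x C y) ∈ s) (j k : Fin 4) :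
    ContDiffOn ℝ ∞ (fun y => pull2 w x y j k) U := by
  unfold pull2
  refine ContDiffOn.sum fun A _ => ContDiffOn.sum fun B _ => ?_
  exact (contDiffOn_comp_pair (hw A B) hx hm).mul
    ((contDiffOn_pd hU (hx A) j).mul (contDiffOn_pd hU (hx B) k))

/-- In the first index `k`, a first-kind symbol of a pullback lies in the span of the differentials
of the map: the terms with second derivatives ∂ᵢ∂ₖ of the map cancel by symmetry. This suffices for
the factors to be parallel, without knowing the symbols. -/
theorem firstKind_pull2 (hU : IsOpen U) (hs : IsOpen s)
    (hw : ∀ i j, ContDiffOn ℝ ∞ (fun u => w u i j) s) (hws : ∀ u ∈ s, (w u).IsSymm)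
    (hx : ∀ C, ContDiffOn ℝ ∞ (x C) U) (hm : ∀ y ∈ U, (fun C => x C y) ∈ s) {y : R4} (hy : y ∈ U) :
    ∃ Y : Fin 2 → Fin 4 → Fin 4 → ℝ, ∀ k i j,
      firstKind (pull2 w x) y k i j = ∑ A, pd k (x A) y * Y A i j := by
  have dx : ∀ C, DifferentiableAt ℝ (x C) y := fun C => differentiableAt_of_contDiffOn hU (hx C) hy
  have dpx : ∀ C i, DifferentiableAt ℝ (fun z => pd i (x C) z) y := fun C i =>
    differentiableAt_of_contDiffOn hU (contDiffOn_pd hU (hx C) i) hy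
  have dw : ∀ A B, DifferentiableAt ℝ (fun u => w u A B) (fun C => x C y) := fun A B =>
    differentiableAt_of_contDiffOn hs (hw A B) (hm y hy)
  have dwx : ∀ A B, DifferentiableAt ℝ (fun z => w (fun C => x C z) A B) y := fun A B =>
    differentiableAt_of_contDiffOn hU (contDiffOn_comp_pair (hw A B) hx hm) hy
  set q : Fin 2 → Fin 2 → Fin 2 → ℝ := fun C A B =>
    fderiv ℝ (fun u => w u A B) (fun C => x C y) (Pi.single C 1) with hq
  set W := w (fun C => x C y) with hW
  have hWs : W 1 0 = W 0 1 := (hws _ (hm y hy)).apply 0 1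
  have hqs : ∀ C, q C 1 0 = q C 0 1 := by
    intro C
    have : (fun u => w u 1 0) =ᶠ[𝓝 (fun C => x C y)] fun u => w u 0 1 :=
      Filter.eventually_of_mem (hs.mem_nhds (hm y hy)) fun u hu => (hws u hu).apply 0 1
    simp only [hq, this.fderiv_eq]
  set t : Fin 2 → Fin 4 → ℝ := fun A i => pd i (x A) y with ht
  set r : Fin 2 → Fin 4 → Fin 4 → ℝ := fun A i j => pd i (fun z => pd j (x A) z) y with hr
  have hrs : ∀ A i j, r A i j = r A j i := fun A i j => pd_comm hU (hx A) i j hy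
  have hpd : ∀ i j k, pd i (fun z => pull2 w x z j k) y = ∑ A, ∑ B,
      ((∑ C, t C i * q C A B) * (t A j * t B k) + W A B * (r A i j * t B k + t A j * r B i k)) := by
    intro i j k
    unfold pull2
    rw [pd_sum]
    · refine Finset.sum_congr rfl fun A _ => ?_
      rw [pd_sum]
      · refine Finset.sum_congr rfl fun B _ => ?_
        rw [pd_mul (dwx A B) ((dpx A j).fun_mul (dpx B k)), pd_mul (dpx A j) (dpx B k),
          pd_comp (dw A B) dx]
      · exact fun B _ => (dwx A B).fun_mul ((dpx A j).fun_mul (dpx B k))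
    · exact fun A _ => DifferentiableAt.fun_sum fun B _ =>
        (dwx A B).fun_mul ((dpx A j).fun_mul (dpx B k))
  -- The two summands are w applied to the Hessian of the map and the first-kind symbols of w
  -- evaluated on the tangent components.
  refine ⟨fun B i j => ∑ A, W A B * r A i j + (1 / 2) * ∑ A, ∑ C,
    (q C A B * t C i * t A j + q C A B * t C j * t A i - q B A C * t A i * t C j), ?_⟩
  intro k i j
  rw [firstKind, hpd, hpd, hpd]
  change _ = ∑ A, t A k * _
  simp only [Fin.sum_univ_two, hWs, hqs, hrs _ j i, hrs _ k i, hrs _ k j]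
  ring

end pull2

/-- The matrix a g⁻¹ projects covectors on the factor of a. If it fixes the first-kind symbols of a
and kills those of b, then a_{kf}Γᶠᵢⱼ is the first-kind symbol of a, and the proof of metric
compatibility applies to a alone. -/
theorem isParallelOn_of_firstKind {g a b : R4 → Matrix (Fin 4) (Fin 4) ℝ} {U : Set R4}
    (hU : IsOpen U) (ha : ∀ i j, ContDiffOn ℝ ∞ (fun y => a y i j) U)
    (hb : ∀ i j, ContDiffOn ℝ ∞ (fun y => b y i j) U) (hg : ∀ y ∈ U, g y = a y + b y)
    (has : ∀ y ∈ U, (a y).IsSymm)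
    (hA : ∀ y ∈ U, ∀ k i j, ∑ f, ∑ l, a y k f * (g y)⁻¹ f l * firstKind a y l i j =
      firstKind a y k i j)
    (hB : ∀ y ∈ U, ∀ k i j, ∑ f, ∑ l, a y k f * (g y)⁻¹ f l * firstKind b y l i j = 0) :
    IsParallelOn g a U := by
  intro y hy i j k
  have hs : ∀ i j, a y i j = a y j i := fun i j => (has y hy).apply j i
  have hpdg : ∀ i j k, pd i (fun z => g z j k) y =
      pd i (fun z => a z j k) y + pd i (fun z => b z j k) y := by
    intro i j k
    rw [pd_congr hU (fun z hz => by rw [hg z hz, Matrix.add_apply]) i hy,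
      pd_add (differentiableAt_of_contDiffOn hU (ha j k) hy)
        (differentiableAt_of_contDiffOn hU (hb j k) hy)]
  have hsp : ∀ i j k, pd i (fun z => a z j k) y = pd i (fun z => a z k j) y := fun i j k =>
    pd_congr hU (fun z hz => (has z hz).apply k j) i hy
  have hΓ : ∀ f i j, christoffel g y f i j =
      ∑ l, (g y)⁻¹ f l * (firstKind a y l i j + firstKind b y l i j) := by
    intro f i j
    rw [christoffel, Finset.mul_sum]
    refine Finset.sum_congr rfl fun l _ => ?_
    rw [hpdg, hpdg, hpdg, firstKind, firstKind]; ring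
  have key : ∀ k i j, ∑ f, a y k f * christoffel g y f i j = firstKind a y k i j := by
    intro k i j
    rw [← add_zero (firstKind a y k i j), ← hB y hy k i j, ← hA y hy k i j,
      ← Finset.sum_add_distrib]
    refine Finset.sum_congr rfl fun f _ => ?_
    rw [hΓ, Finset.mul_sum, ← Finset.sum_add_distrib]
    exact Finset.sum_congr rfl fun l _ => by ring
  have h1 : ∑ f, christoffel g y f i j * a y f k = firstKind a y k i j := by
    rw [← key]; exact Finset.sum_congr rfl fun f _ => by rw [hs f k]; ring
  have h2 : ∑ f, christoffel g y f i k * a y j f = firstKind a y j i k := by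
    rw [← key]; exact Finset.sum_congr rfl fun f _ => by ring
  rw [Finset.sum_add_distrib, h1, h2, firstKind, firstKind, hsp i k j, hsp j k i, hsp k j i]
  ring

/-! ### Conformal products in an arbitrary coordinate system -/

/-- The 2-metrics are smooth only on projections of the chart domain; openness of these sets is what
allows differentiating there. -/
theorem isOpenMap_firstPair : IsOpenMap firstPair := by
  let L : R4 →L[ℝ] (Fin 2 → ℝ) :=
    ContinuousLinearMap.pi fun i => EuclideanSpace.proj (Fin.castAdd 2 i)
  refine L.isOpenMap fun u => ⟨WithLp.toLp 2 ![u 0, u 1, 0, 0], ?_⟩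
  ext i; fin_cases i <;> rfl

theorem isOpenMap_lastPair : IsOpenMap lastPair := by
  let L : R4 →L[ℝ] (Fin 2 → ℝ) :=
    ContinuousLinearMap.pi fun i => EuclideanSpace.proj (Fin.natAdd 2 i)
  refine L.isOpenMap fun u => ⟨WithLp.toLp 2 ![0, 0, u 0, u 1], ?_⟩
  ext i; fin_cases i <;> rfl

/-- The Jacobian matrix of `F`. -/
def jacobian (F : R4 → R4) (y : R4) : Matrix (Fin 4) (Fin 4) ℝ := fun A i =>
  pd i (fun z => F z A) y

/-- On `U`, `γ` is the pullback by `F` of the conformal product `e^{2λ} (v + h)` on `O`. -/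
structure IsPulledBack (γ : R4 → Matrix (Fin 4) (Fin 4) ℝ) (U : Set R4) (F : R4 → R4) (O : Set R4)
    (v h : (Fin 2 → ℝ) → Matrix (Fin 2) (Fin 2) ℝ) (lam : R4 → ℝ) : Prop where
  isOpen_source : IsOpen U
  isOpen_target : IsOpen O
  smooth_map : ∀ A, ContDiffOn ℝ ∞ (fun y => F y A) U
  mapsTo : ∀ y ∈ U, F y ∈ O
  det_ne : ∀ y ∈ U, (jacobian F y).det ≠ 0
  lorentz : IsLorentz2 v (firstPair '' O)
  riemannian : IsRiemann2 h (lastPair '' O)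
  smooth : ContDiffOn ℝ ∞ lam O
  eq : ∀ y ∈ U, γ y = pullMat (jacobian F y) (blockDiag (Real.exp (2 * lam (F y)) • v (firstPair (F y)))
    (Real.exp (2 * lam (F y)) • h (lastPair (F y))))

theorem pullMat_smul (r : ℝ) (J X : Matrix (Fin 4) (Fin 4) ℝ) :
    pullMat J (r • X) = r • pullMat J X := by
  simp [pullMat]

theorem pullMat_mul_inv {J : Matrix (Fin 4) (Fin 4) ℝ} (hJ : J.det ≠ 0)
    (X : Matrix (Fin 4) (Fin 4) ℝ) : pullMat J X * J⁻¹ = J.transpose * X := by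
  rw [pullMat, mul_assoc, Matrix.mul_nonsing_inv _ (isUnit_iff_ne_zero.2 hJ), mul_one]

theorem pullMat_mul_inv_transpose {J D : Matrix (Fin 4) (Fin 4) ℝ} (hJ : J.det ≠ 0)
    (X : Matrix (Fin 4) (Fin 4) ℝ) :
    pullMat J X * (pullMat J D)⁻¹ * J.transpose = J.transpose * (X * D⁻¹) := by
  have h1 : J * J⁻¹ = 1 := Matrix.mul_nonsing_inv _ (isUnit_iff_ne_zero.2 hJ)
  have h2 : J⁻¹.transpose * J.transpose = 1 := by rw [← Matrix.transpose_mul, h1]; simp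
  rw [pullMat_inv]
  calc _ = J.transpose * X * (J * J⁻¹) * D⁻¹ * (J⁻¹.transpose * J.transpose) := by
        simp only [pullMat, mul_assoc]
    _ = _ := by rw [h1, h2]; simp only [mul_assoc, mul_one]

/-! ### The pulled back product: parallel factors and mixed curvature -/

namespace IsPulledBack

variable {γ : R4 → Matrix (Fin 4) (Fin 4) ℝ} {U : Set R4} {F : R4 → R4} {O : Set R4}
  {v h : (Fin 2 → ℝ) → Matrix (Fin 2) (Fin 2) ℝ} {lam : R4 → ℝ}

theorem symm_left (P : IsPulledBack γ U F O v h lam) {y : R4} (hy : y ∈ U) :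
    (v (firstPair (F y))).IsSymm := P.lorentz.symm _ (mem_image_of_mem _ (P.mapsTo y hy))

theorem symm_right (P : IsPulledBack γ U F O v h lam) {y : R4} (hy : y ∈ U) :
    (h (lastPair (F y))).IsSymm := by
  have := (P.riemannian.posDef _ (mem_image_of_mem _ (P.mapsTo y hy))).isHermitian
  exact this

theorem det_left (P : IsPulledBack γ U F O v h lam) {y : R4} (hy : y ∈ U) :
    (v (firstPair (F y))).det ≠ 0 :=
  (P.lorentz.det_neg _ (mem_image_of_mem _ (P.mapsTo y hy))).ne

theorem det_right (P : IsPulledBack γ U F O v h lam) {y : R4} (hy : y ∈ U) :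
    (h (lastPair (F y))).det ≠ 0 :=
  (P.riemannian.posDef _ (mem_image_of_mem _ (P.mapsTo y hy))).det_pos.ne'

/-- The pullback of the Lorentzian factor. -/
def leftPart (F : R4 → R4) (v : (Fin 2 → ℝ) → Matrix (Fin 2) (Fin 2) ℝ) (y : R4) :
    Matrix (Fin 4) (Fin 4) ℝ := pullMat (jacobian F y) (blockDiag (v (firstPair (F y))) 0)

/-- The pullback of the Riemannian factor. -/
def rightPart (F : R4 → R4) (h : (Fin 2 → ℝ) → Matrix (Fin 2) (Fin 2) ℝ) (y : R4) :
    Matrix (Fin 4) (Fin 4) ℝ := pullMat (jacobian F y) (blockDiag 0 (h (lastPair (F y))))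

/-- The pullback of the product metric. -/
def prodMetric (F : R4 → R4) (v h : (Fin 2 → ℝ) → Matrix (Fin 2) (Fin 2) ℝ) (y : R4) :
    Matrix (Fin 4) (Fin 4) ℝ :=
  pullMat (jacobian F y) (blockDiag (v (firstPair (F y))) (h (lastPair (F y))))

theorem leftPart_eq (F : R4 → R4) (v : (Fin 2 → ℝ) → Matrix (Fin 2) (Fin 2) ℝ) :
    leftPart F v = pull2 v (fun A y => F y (Fin.castAdd 2 A)) := by
  funext y j k
  simp only [leftPart, pull2, pullMat, Matrix.mul_apply, Fin.sum_univ_four, Fin.sum_univ_two,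
    blockDiag_apply, Matrix.transpose_apply]
  have hf : firstPair (F y) = fun C => F y (Fin.castAdd 2 C) := rfl
  simp [jacobian, hf]
  ring

theorem rightPart_eq (F : R4 → R4) (h : (Fin 2 → ℝ) → Matrix (Fin 2) (Fin 2) ℝ) :
    rightPart F h = pull2 h (fun A y => F y (Fin.natAdd 2 A)) := by
  funext y j k
  simp only [rightPart, pull2, pullMat, Matrix.mul_apply, Fin.sum_univ_four, Fin.sum_univ_two,
    blockDiag_apply, Matrix.transpose_apply]
  have hf : lastPair (F y) = fun C => F y (Fin.natAdd 2 C) := rfl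
  simp [jacobian, hf]
  ring

theorem split (P : IsPulledBack γ U F O v h lam) {y : R4} (hy : y ∈ U) :
    IsSplit (prodMetric F v h y) (leftPart F v y) (rightPart F h y) :=
  isSplit_pullMat (P.det_ne y hy) (P.det_left hy) (P.det_right hy) (P.symm_left hy)
    (P.symm_right hy)

theorem contDiffOn_leftPart (P : IsPulledBack γ U F O v h lam) (i j : Fin 4) :
    ContDiffOn ℝ ∞ (fun y => leftPart F v y i j) U := by
  rw [leftPart_eq]
  exact contDiffOn_pull2 P.isOpen_source P.lorentz.smooth (fun C => P.smooth_map _)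
    (fun y hy => mem_image_of_mem firstPair (P.mapsTo y hy)) i j

theorem contDiffOn_rightPart (P : IsPulledBack γ U F O v h lam) (i j : Fin 4) :
    ContDiffOn ℝ ∞ (fun y => rightPart F h y i j) U := by
  rw [rightPart_eq]
  exact contDiffOn_pull2 P.isOpen_source P.riemannian.smooth (fun C => P.smooth_map _)
    (fun y hy => mem_image_of_mem lastPair (P.mapsTo y hy)) i j

theorem isMetricOn (P : IsPulledBack γ U F O v h lam) : IsMetricOn (prodMetric F v h) U where
  isOpen := P.isOpen_source
  smooth i j := ((P.contDiffOn_leftPart i j).add (P.contDiffOn_rightPart i j)).congr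
    fun y hy => by rw [(P.split hy).eq_add]; rfl
  symm y hy i j := (P.split hy).symm.apply j i
  det_ne y hy := (P.split hy).det_ne

theorem isConformalOn (P : IsPulledBack γ U F O v h lam) :
    IsConformalOn (prodMetric F v h) γ (fun y => lam (F y)) U where
  metric := P.isMetricOn
  smooth := P.smooth.comp (contDiffOn_euclidean.2 P.smooth_map) P.mapsTo
  eq y hy := by rw [P.eq y hy, ← blockDiag_smul, pullMat_smul]; rfl

/-- The rows of the Jacobian of the first two coordinates are fixed by the first projector. -/
theorem leftPart_contract (P : IsPulledBack γ U F O v h lam) {y : R4} (hy : y ∈ U) (A k : Fin 4) :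
    ∑ f, ∑ l, leftPart F v y k f * (prodMetric F v h y)⁻¹ f l * jacobian F y A l =
      if A < 2 then jacobian F y A k else 0 := by
  have h1 := pullMat_mul_inv_transpose (D := blockDiag (v (firstPair (F y))) (h (lastPair (F y))))
    (P.det_ne y hy) (blockDiag (v (firstPair (F y))) 0)
  rw [blockDiag_inv (P.det_left hy) (P.det_right hy), blockDiag_mul,
    Matrix.mul_nonsing_inv _ (isUnit_iff_ne_zero.2 (P.det_left hy)), zero_mul] at h1
  have h2 := mul_mul_apply_eq_sum (leftPart F v y) (prodMetric F v h y)⁻¹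
    (jacobian F y).transpose k A
  refine h2.trans ?_
  rw [leftPart, prodMetric, h1, Matrix.mul_apply]
  fin_cases A <;> simp [blockDiag_apply, Fin.sum_univ_four]

theorem rightPart_contract (P : IsPulledBack γ U F O v h lam) {y : R4} (hy : y ∈ U) (A k : Fin 4) :
    ∑ f, ∑ l, rightPart F h y k f * (prodMetric F v h y)⁻¹ f l * jacobian F y A l =
      if A < 2 then 0 else jacobian F y A k := by
  have h1 := pullMat_mul_inv_transpose (D := blockDiag (v (firstPair (F y))) (h (lastPair (F y))))
    (P.det_ne y hy) (blockDiag 0 (h (lastPair (F y))))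
  rw [blockDiag_inv (P.det_left hy) (P.det_right hy), blockDiag_mul,
    Matrix.mul_nonsing_inv _ (isUnit_iff_ne_zero.2 (P.det_right hy)), zero_mul] at h1
  have h2 := mul_mul_apply_eq_sum (rightPart F h y) (prodMetric F v h y)⁻¹
    (jacobian F y).transpose k A
  refine h2.trans ?_
  rw [rightPart, prodMetric, h1, Matrix.mul_apply]
  fin_cases A <;> simp [blockDiag_apply, Fin.sum_univ_four]

theorem firstKind_left (P : IsPulledBack γ U F O v h lam) {y : R4} (hy : y ∈ U) :
    ∃ Y : Fin 2 → Fin 4 → Fin 4 → ℝ, ∀ k i j, firstKind (leftPart F v) y k i j =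
      ∑ A, jacobian F y (Fin.castAdd 2 A) k * Y A i j := by
  rw [leftPart_eq]
  exact firstKind_pull2 P.isOpen_source (isOpenMap_firstPair O P.isOpen_target)
    P.lorentz.smooth P.lorentz.symm (fun C => P.smooth_map _)
    (fun y hy => mem_image_of_mem firstPair (P.mapsTo y hy)) hy

theorem firstKind_right (P : IsPulledBack γ U F O v h lam) {y : R4} (hy : y ∈ U) :
    ∃ Y : Fin 2 → Fin 4 → Fin 4 → ℝ, ∀ k i j, firstKind (rightPart F h) y k i j =
      ∑ A, jacobian F y (Fin.natAdd 2 A) k * Y A i j := by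
  rw [rightPart_eq]
  exact firstKind_pull2 P.isOpen_source (isOpenMap_lastPair O P.isOpen_target)
    P.riemannian.smooth (fun u hu => (P.riemannian.posDef u hu).isHermitian)
    (fun C => P.smooth_map _) (fun y hy => mem_image_of_mem lastPair (P.mapsTo y hy)) hy

theorem contract_sum (M I : Matrix (Fin 4) (Fin 4) ℝ) (k i j : Fin 4) (t : Fin 2 → Fin 4 → ℝ)
    (Y : Fin 2 → Fin 4 → Fin 4 → ℝ) :
    ∑ f, ∑ l, M k f * I f l * ∑ A, t A l * Y A i j =
      ∑ A, (∑ f, ∑ l, M k f * I f l * t A l) * Y A i j := by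
  simp only [Fin.sum_univ_two, Finset.sum_mul, ← Finset.sum_add_distrib]
  iterate 2 refine Finset.sum_congr rfl fun _ _ => ?_
  ring

theorem isParallelSplitOn (P : IsPulledBack γ U F O v h lam) :
    IsParallelSplitOn (prodMetric F v h) (leftPart F v) (rightPart F h) U where
  smooth_left := P.contDiffOn_leftPart
  smooth_right := P.contDiffOn_rightPart
  split y hy := P.split hy
  parallel_left := by
    refine isParallelOn_of_firstKind P.isOpen_source P.contDiffOn_leftPart P.contDiffOn_rightPart
      (fun y hy => (P.split hy).eq_add) (fun y hy => (P.split hy).symm_left) ?_ ?_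
    · intro y hy k i j
      obtain ⟨Y, hY⟩ := P.firstKind_left hy
      simp only [hY, contract_sum, P.leftPart_contract hy]
      refine Finset.sum_congr rfl fun A _ => ?_
      rw [if_pos (by fin_cases A <;> decide)]
    · intro y hy k i j
      obtain ⟨Y, hY⟩ := P.firstKind_right hy
      simp only [hY, contract_sum, P.leftPart_contract hy]
      refine Finset.sum_eq_zero fun A _ => ?_
      rw [if_neg (by fin_cases A <;> decide), zero_mul]
  parallel_right := by
    refine isParallelOn_of_firstKind P.isOpen_source P.contDiffOn_rightPart P.contDiffOn_leftPart
      (fun y hy => (P.split hy).swap.eq_add) (fun y hy => (P.split hy).symm_right) ?_ ?_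
    · intro y hy k i j
      obtain ⟨Y, hY⟩ := P.firstKind_right hy
      simp only [hY, contract_sum, P.rightPart_contract hy]
      refine Finset.sum_congr rfl fun A _ => ?_
      rw [if_neg (by fin_cases A <;> decide)]
    · intro y hy k i j
      obtain ⟨Y, hY⟩ := P.firstKind_left hy
      simp only [hY, contract_sum, P.rightPart_contract hy]
      refine Finset.sum_eq_zero fun A _ => ?_
      rw [if_pos (by fin_cases A <;> decide), zero_mul]

/-- The columns K_A of the inverse Jacobian are the adapted coordinate vectors. Contract the Ricci
identity for the parallel tensor v̂ with K_A from the first factor and K_B from the second: v̂K_B =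
0 removes one term, and v̂K_A = gK_A turns the other into the mixed curvature. -/
theorem riemann_mixed (P : IsPulledBack γ U F O v h lam) {x : R4} (hx : x ∈ U) (A B : Fin 4)
    (hA : A < 2) (hB : 2 ≤ B) (c d : Fin 4) :
    ∑ a, ∑ b, (jacobian F x)⁻¹ a A * (jacobian F x)⁻¹ b B *
      riemann (prodMetric F v h) x a b c d = 0 := by
  set K := (jacobian F x)⁻¹ with hK
  have hJ := P.det_ne x hx
  have z1 : ∀ f, ∑ q, leftPart F v x f q * K q B = 0 := by
    intro f
    rw [← Matrix.mul_apply, leftPart, hK, pullMat_mul_inv hJ, Matrix.mul_apply]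
    fin_cases B
    · exact absurd hB (by decide)
    · exact absurd hB (by decide)
    · simp [blockDiag_apply, Fin.sum_univ_four]
    · simp [blockDiag_apply, Fin.sum_univ_four]
  have z2 : ∀ f, ∑ q, rightPart F h x f q * K q A = 0 := by
    intro f
    rw [← Matrix.mul_apply, rightPart, hK, pullMat_mul_inv hJ, Matrix.mul_apply]
    fin_cases A
    · simp [blockDiag_apply, Fin.sum_univ_four]
    · simp [blockDiag_apply, Fin.sum_univ_four]
    · exact absurd hA (by decide)
    · exact absurd hA (by decide)
  have z3 : ∀ f, ∑ q, leftPart F v x f q * K q A = ∑ q, prodMetric F v h x f q * K q A := by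
    intro f
    rw [(P.split hx).eq_add]
    simp only [Matrix.add_apply, add_mul, Finset.sum_add_distrib, z2, add_zero]
  have hs : ∀ i j, leftPart F v x i j = leftPart F v x j i := fun i j =>
    (P.split hx).symm_left.apply j i
  have hsg := P.isMetricOn.symm x hx
  have hid := fun p q => P.isMetricOn.ricci_identity P.contDiffOn_leftPart
    P.isParallelSplitOn.parallel_left hx p q c d
  have hzero : ∑ q, ∑ p, K q A * K p B * ∑ f, (riemannUp (prodMetric F v h) x f p c d *
      leftPart F v x f q + riemannUp (prodMetric F v h) x f q c d * leftPart F v x p f) = 0 := by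
    simp only [hid, mul_zero, Finset.sum_const_zero]
  have hsplit : ∑ q, ∑ p, K q A * K p B * ∑ f, (riemannUp (prodMetric F v h) x f p c d *
      leftPart F v x f q + riemannUp (prodMetric F v h) x f q c d * leftPart F v x p f) =
      ∑ p, ∑ f, K p B * riemannUp (prodMetric F v h) x f p c d * ∑ q, leftPart F v x f q * K q A
      + ∑ q, ∑ f, K q A * riemannUp (prodMetric F v h) x f q c d *
        ∑ p, leftPart F v x f p * K p B := by
    simp only [mul_add, Finset.sum_add_distrib, Finset.mul_sum]
    congr 1
    · rw [Finset.sum_comm]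
      refine Finset.sum_congr rfl fun p _ => ?_
      rw [Finset.sum_comm]
      iterate 2 refine Finset.sum_congr rfl fun _ _ => ?_
      ring
    · refine Finset.sum_congr rfl fun q _ => ?_
      rw [Finset.sum_comm]
      refine Finset.sum_congr rfl fun f _ => Finset.sum_congr rfl fun p _ => ?_
      rw [hs p f]; ring
  rw [hsplit] at hzero
  simp only [z1, z3, mul_zero, Finset.sum_const_zero, add_zero] at hzero
  rw [← hzero, Finset.sum_comm]
  refine Finset.sum_congr rfl fun p _ => ?_
  simp only [riemann, Finset.mul_sum]
  rw [Finset.sum_comm]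
  refine Finset.sum_congr rfl fun f _ => Finset.sum_congr rfl fun q _ => ?_
  rw [hsg q f]; ring

end IsPulledBack

/-! ### The concomitants of a conformal product in an arbitrary coordinate system -/

theorem fderiv_apply_eq_jacobian {F : R4 → R4} {x : R4} (hF : DifferentiableAt ℝ F x)
    (A i : Fin 4) : (fderiv ℝ F x (EuclideanSpace.single i 1)) A = jacobian F x A i := by
  have := ((EuclideanSpace.proj A : R4 →L[ℝ] ℝ).hasFDerivAt.comp x hF.hasFDerivAt).fderiv
  simp only [jacobian, pd]
  change _ = fderiv ℝ ((EuclideanSpace.proj A : R4 →L[ℝ] ℝ) ∘ F) x _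
  rw [this]; rfl

theorem pd_comp_map {F : R4 → R4} {f : R4 → ℝ} {x : R4} (hF : DifferentiableAt ℝ F x)
    (hf : DifferentiableAt ℝ f (F x)) (i : Fin 4) :
    pd i (fun y => f (F y)) x = ∑ A, jacobian F x A i * pd A f (F x) := by
  have h1 : pd i (fun y => f (F y)) x =
      fderiv ℝ f (F x) (fderiv ℝ F x (EuclideanSpace.single i 1)) := by
    have := (hf.hasFDerivAt.comp x hF.hasFDerivAt).fderiv
    simp only [pd]
    change fderiv ℝ (f ∘ F) x _ = _
    rw [this]; rfl
  rw [h1, fderiv_apply_eq_sum_pd]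
  simp only [fderiv_apply_eq_jacobian hF]

/-! ### W, S and Φ of the pulled back conformal product -/

namespace IsPulledBack

variable {γ : R4 → Matrix (Fin 4) (Fin 4) ℝ} {U : Set R4} {F : R4 → R4} {O : Set R4}
  {v h : (Fin 2 → ℝ) → Matrix (Fin 2) (Fin 2) ℝ} {lam : R4 → ℝ}

theorem split_conformal (P : IsPulledBack γ U F O v h lam) {y : R4} (hy : y ∈ U) :
    IsSplit (γ y) (Real.exp (2 * lam (F y)) • leftPart F v y)
      (Real.exp (2 * lam (F y)) • rightPart F h y) := by
  rw [P.isConformalOn.eq y hy]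
  exact (P.split hy).smul (Real.exp_ne_zero _)

theorem exists_weyl_eq (P : IsPulledBack γ U F O v h lam) {y : R4} (hy : y ∈ U) :
    ∃ r : ℝ, weyl γ y = r • (IsSplit.idForm (γ y) + (-3 : ℝ) • IsSplit.pureForm
      (Real.exp (2 * lam (F y)) • leftPart F v y) (Real.exp (2 * lam (F y)) • rightPart F h y)) := by
  obtain ⟨k, l, hkl⟩ := curvature_eq_of_mixed (P.det_ne y hy) (P.det_left hy) (P.det_right hy)
    (P.symm_left hy) (P.symm_right hy) (R := riemann (prodMetric F v h) y)
    (fun a b c d => IsMetricOn.riemann_antisymm_right a b c d)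
    (fun a b c d => P.isMetricOn.riemann_antisymm_left hy a b c d)
    (fun a b c d => P.isMetricOn.riemann_bianchi hy a b c d)
    (fun A B hA hB c d => P.riemann_mixed hy A B hA hB c d)
  obtain ⟨T, hT⟩ := P.isConformalOn.exists_riemann_eq hy
  have hE := Real.exp_ne_zero (2 * lam (F y))
  refine ⟨_, weyl_eq_of_riemann (k := k / Real.exp (2 * lam (F y)))
    (l := l / Real.exp (2 * lam (F y))) (T := T) (P.split_conformal hy) ?_⟩
  rw [hT, hkl]
  simp only [extProd_smul_left, extProd_smul_right, smul_add, smul_smul]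
  congr 3
  · field_simp
  · field_simp

theorem bigS_eq_neg_pureForm (P : IsPulledBack γ U F O v h lam) {y : R4} (hy : y ∈ U)
    (hW : weyl γ y ≠ 0) : bigS γ y = -IsSplit.pureForm
      (Real.exp (2 * lam (F y)) • leftPart F v y) (Real.exp (2 * lam (F y)) • rightPart F h y) := by
  obtain ⟨r, hr⟩ := P.exists_weyl_eq hy
  refine bigS_eq (P.split_conformal hy) hr ?_
  rintro rfl
  exact hW (by rw [hr, zero_smul])

/-- The chain rule expresses -2dλ through its components in the adapted coordinates, the form in
which the frame criterion applies. -/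
theorem phi_eq_mulVec (P : IsPulledBack γ U F O v h lam) (hW : ∀ y ∈ U, weyl γ y ≠ 0) {x : R4}
    (hx : x ∈ U) :
    phi γ x = (jacobian F x).transpose.mulVec (fun A => -2 * pd A lam (F x)) := by
  funext i
  rw [phi_eq P.isConformalOn P.isParallelSplitOn (fun y hy => P.bigS_eq_neg_pureForm hy (hW y hy)) hx]
  have hF : DifferentiableAt ℝ F x := differentiableAt_euclidean.2 fun A =>
    differentiableAt_of_contDiffOn P.isOpen_source (P.smooth_map A) hx
  have hl : DifferentiableAt ℝ lam (F x) :=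
    differentiableAt_of_contDiffOn P.isOpen_target P.smooth (P.mapsTo x hx)
  rw [pd_comp_map hF hl]
  simp only [Matrix.mulVec, dotProduct, Matrix.transpose_apply, Finset.mul_sum]
  exact Finset.sum_congr rfl fun A _ => by ring

theorem phi_ne_zero_iff (P : IsPulledBack γ U F O v h lam) (hW : ∀ y ∈ U, weyl γ y ≠ 0) {x : R4}
    (hx : x ∈ U) : phi γ x ≠ 0 ↔ ∃ A, pd A lam (F x) ≠ 0 := by
  have hJ : IsUnit (jacobian F x).transpose := by
    rw [Matrix.isUnit_iff_isUnit_det, Matrix.det_transpose]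
    exact isUnit_iff_ne_zero.2 (P.det_ne x hx)
  rw [P.phi_eq_mulVec hW hx, ← not_iff_not]
  push Not
  constructor
  · intro h0 A
    have h1 : (fun A => -2 * pd A lam (F x)) = 0 :=
      Matrix.mulVec_injective_of_isUnit hJ (by rw [h0, Matrix.mulVec_zero])
    have := congrFun h1 A
    simpa using this
  · intro h0
    have : (fun A => -2 * pd A lam (F x)) = (0 : Fin 4 → ℝ) := by funext A; simp [h0]
    rw [this, Matrix.mulVec_zero]

theorem act22_phi_eq_zero_iff (P : IsPulledBack γ U F O v h lam) (hW : ∀ y ∈ U, weyl γ y ≠ 0)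
    {x : R4} (hx : x ∈ U) :
    act22 (hodge (γ x) (IsSplit.pureForm (Real.exp (2 * lam (F x)) • leftPart F v x)
      (Real.exp (2 * lam (F x)) • rightPart F h x))) (raise (γ x) (phi γ x))
      (raise (γ x) (phi γ x)) = 0 ↔
      (pd 0 lam (F x) = 0 ∧ pd 1 lam (F x) = 0) ∨ (pd 2 lam (F x) = 0 ∧ pd 3 lam (F x) = 0) := by
  have hE := Real.exp_ne_zero (2 * lam (F x))
  have e1 : Real.exp (2 * lam (F x)) • leftPart F v x = pullMat (jacobian F x)
      (blockDiag (Real.exp (2 * lam (F x)) • v (firstPair (F x))) 0) := by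
    rw [leftPart, ← pullMat_smul, blockDiag_smul, smul_zero]
  have e2 : Real.exp (2 * lam (F x)) • rightPart F h x = pullMat (jacobian F x)
      (blockDiag 0 (Real.exp (2 * lam (F x)) • h (lastPair (F x)))) := by
    rw [rightPart, ← pullMat_smul, blockDiag_smul, smul_zero]
  rw [P.phi_eq_mulVec hW hx, e1, e2, P.eq x hx, act22_hodge_raise_eq_zero_iff (P.det_ne x hx) ?_ ?_
    ((P.symm_left hx).smul _) ((P.symm_right hx).smul _)]
  · simp
  · rw [Matrix.det_smul]; exact mul_ne_zero (pow_ne_zero _ hE) (P.det_left hx)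
  · rw [Matrix.det_smul]; exact mul_ne_zero (pow_ne_zero _ hE) (P.det_right hx)

theorem starSPhi_eq_zero_iff (P : IsPulledBack γ U F O v h lam) (hW : ∀ y ∈ U, weyl γ y ≠ 0)
    {x : R4} (hx : x ∈ U) : starSPhi γ x = 0 ↔
      (pd 0 lam (F x) = 0 ∧ pd 1 lam (F x) = 0) ∨ (pd 2 lam (F x) = 0 ∧ pd 3 lam (F x) = 0) := by
  rw [← P.act22_phi_eq_zero_iff hW hx, starSPhi, P.bigS_eq_neg_pureForm hx (hW x hx)]
  set Q := IsSplit.pureForm (Real.exp (2 * lam (F x)) • leftPart F v x)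
    (Real.exp (2 * lam (F x)) • rightPart F h x)
  have : -Q = (-1 : ℝ) • Q := by module
  rw [this, hodge, comp_smul_right, act22_smul, smul_eq_zero]
  simp [hodge]

theorem starWPhi_eq_zero_iff (P : IsPulledBack γ U F O v h lam) (hW : ∀ y ∈ U, weyl γ y ≠ 0)
    {x : R4} (hx : x ∈ U) : starWPhi γ x = 0 ↔
      (pd 0 lam (F x) = 0 ∧ pd 1 lam (F x) = 0) ∨ (pd 2 lam (F x) = 0 ∧ pd 3 lam (F x) = 0) := by
  obtain ⟨r, hr⟩ := P.exists_weyl_eq hx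
  have hr0 : r ≠ 0 := by
    rintro rfl
    exact hW x hx (by rw [hr, zero_smul])
  rw [← P.act22_phi_eq_zero_iff hW hx, starWPhi, hr, smul_add, smul_smul,
    act22_hodge (P.split_conformal hx).det_ne, smul_eq_zero]
  simp [hr0]

end IsPulledBack

/-! ### Functions on a box -/

theorem eq_of_fderiv_apply_eq_zero {f : R4 → ℝ} {K : Set R4} (hK : IsOpen K) (hc : Convex ℝ K)
    (hf : ContDiffOn ℝ ∞ f K) {z z' : R4} (hz : z ∈ K) (hz' : z' ∈ K)
    (h : ∀ y ∈ K, fderiv ℝ f y (z' - z) = 0) : f z = f z' := by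
  set L : ℝ → R4 := fun t => z + t • (z' - z) with hL
  have hLd : ∀ t, HasDerivAt L (z' - z) t := by
    intro t
    have := ((hasDerivAt_id t).smul_const (z' - z)).const_add z
    rwa [one_smul] at this
  have hLc : Continuous L := by fun_prop
  have hder : ∀ t ∈ L ⁻¹' K, HasDerivAt (fun t => f (L t)) 0 t := by
    intro t ht
    have := (differentiableAt_of_contDiffOn hK hf ht).hasFDerivAt.comp_hasDerivAt t (hLd t)
    rwa [h _ ht] at this
  have hconv : Convex ℝ (L ⁻¹' K) := by
    have : L = AffineMap.lineMap z z' := by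
      funext t; simp [hL, AffineMap.lineMap_apply, add_comm]
    rw [this]
    exact hc.affine_preimage _
  have := (hK.preimage hLc).is_const_of_deriv_eq_zero hconv.isPreconnected
    (fun t ht => (hder t ht).differentiableAt.differentiableWithinAt)
    (fun t ht => (hder t ht).deriv) (x := 0) (y := 1)
    (by simpa [hL] using hz) (by simpa [hL] using hz')
  simpa [hL] using this

/-- The square of f has derivative 2f·f′, which vanishes along the direction both where f = 0 and
where f ≠ 0. So f² is constant on the segment. -/
theorem ne_zero_of_fderiv_apply_eq_zero {f : R4 → ℝ} {K : Set R4} (hK : IsOpen K)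
    (hc : Convex ℝ K) (hf : ContDiffOn ℝ ∞ f K) {z z' : R4} (hz : z ∈ K) (hz' : z' ∈ K)
    (h : ∀ y ∈ K, f y ≠ 0 → fderiv ℝ f y (z' - z) = 0) (h0 : f z ≠ 0) : f z' ≠ 0 := by
  have key := eq_of_fderiv_apply_eq_zero (f := fun y => f y * f y) hK hc (hf.mul hf) hz hz' (by
    intro y hy
    have hd := differentiableAt_of_contDiffOn hK hf hy
    rw [fderiv_fun_mul hd hd]
    by_cases hy0 : f y = 0
    · simp [hy0]
    · simp [h y hy hy0])
  intro h1
  rw [h1, mul_zero] at key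
  exact h0 (mul_self_eq_zero.1 key)

/-- The point with given first and last pairs of coordinates. -/
def joinPair (u w : Fin 2 → ℝ) : R4 := WithLp.toLp 2 ![u 0, u 1, w 0, w 1]

theorem firstPair_joinPair (u w : Fin 2 → ℝ) : firstPair (joinPair u w) = u := by
  funext i; fin_cases i <;> rfl

theorem lastPair_joinPair (u w : Fin 2 → ℝ) : lastPair (joinPair u w) = w := by
  funext i; fin_cases i <;> rfl

theorem joinPair_pairs (x : R4) : joinPair (firstPair x) (lastPair x) = x := by
  ext i; fin_cases i <;> rfl

/-- The box `s × t`. -/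
def box (s t : Set (Fin 2 → ℝ)) : Set R4 := {x | firstPair x ∈ s ∧ lastPair x ∈ t}

theorem continuous_firstPair : Continuous firstPair := by
  unfold firstPair; fun_prop

theorem continuous_lastPair : Continuous lastPair := by
  unfold lastPair; fun_prop

theorem contDiff_joinPair : ContDiff ℝ ∞ (fun p : (Fin 2 → ℝ) × (Fin 2 → ℝ) => joinPair p.1 p.2) := by
  rw [contDiff_euclidean]
  intro i
  fin_cases i
  · exact (contDiff_apply ℝ ℝ (0 : Fin 2)).comp contDiff_fst
  · exact (contDiff_apply ℝ ℝ (1 : Fin 2)).comp contDiff_fst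
  · exact (contDiff_apply ℝ ℝ (0 : Fin 2)).comp contDiff_snd
  · exact (contDiff_apply ℝ ℝ (1 : Fin 2)).comp contDiff_snd

theorem isOpen_box {s t : Set (Fin 2 → ℝ)} (hs : IsOpen s) (ht : IsOpen t) : IsOpen (box s t) :=
  (hs.preimage continuous_firstPair).inter (ht.preimage continuous_lastPair)

theorem convex_box {s t : Set (Fin 2 → ℝ)} (hs : Convex ℝ s) (ht : Convex ℝ t) :
    Convex ℝ (box s t) := by
  intro x hx y hy a b ha hb hab
  exact ⟨hs hx.1 hy.1 ha hb hab, ht hx.2 hy.2 ha hb hab⟩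

theorem exists_box_subset {O : Set R4} (hO : IsOpen O) {x : R4} (hx : x ∈ O) :
    ∃ s t : Set (Fin 2 → ℝ), IsOpen s ∧ IsOpen t ∧ Convex ℝ s ∧ Convex ℝ t ∧ x ∈ box s t ∧
      box s t ⊆ O := by
  have h1 : IsOpen ((fun p : (Fin 2 → ℝ) × (Fin 2 → ℝ) => joinPair p.1 p.2) ⁻¹' O) :=
    hO.preimage contDiff_joinPair.continuous
  have h2 : (firstPair x, lastPair x) ∈
      ((fun p : (Fin 2 → ℝ) × (Fin 2 → ℝ) => joinPair p.1 p.2) ⁻¹' O) := by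
    simpa [joinPair_pairs] using hx
  obtain ⟨ε, hε, hb⟩ := Metric.isOpen_iff.1 h1 _ h2
  refine ⟨Metric.ball (firstPair x) ε, Metric.ball (lastPair x) ε, Metric.isOpen_ball,
    Metric.isOpen_ball, convex_ball _ _, convex_ball _ _,
    ⟨Metric.mem_ball_self hε, Metric.mem_ball_self hε⟩, ?_⟩
  rintro y ⟨hy1, hy2⟩
  have : (firstPair y, lastPair y) ∈ Metric.ball (firstPair x, lastPair x) ε := by
    rw [← ball_prod_same]; exact ⟨hy1, hy2⟩
  simpa [joinPair_pairs] using hb this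

/-- Near a point where ∂_A f ≠ 0 it stays nonzero, so ∂_B f vanishes on a neighbourhood;
differentiate this along A and exchange derivatives. -/
theorem pd_pd_eq_zero {f : R4 → ℝ} {K : Set R4} (hK : IsOpen K) (hf : ContDiffOn ℝ ∞ f K)
    (A B : Fin 4) (h : ∀ y ∈ K, pd A f y ≠ 0 → pd B f y = 0) {y : R4} (hy : y ∈ K)
    (h0 : pd A f y ≠ 0) : pd B (fun z => pd A f z) y = 0 := by
  rw [pd_comm hK hf B A hy]
  have hc : ContinuousOn (fun z => pd A f z) K := (contDiffOn_pd hK hf A).continuousOn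
  have hN : IsOpen (K ∩ (fun z => pd A f z) ⁻¹' {0}ᶜ) :=
    hc.isOpen_inter_preimage hK isOpen_compl_singleton
  rw [pd_congr hN (k := fun _ => 0) (fun z hz => h z hz.1 hz.2) A ⟨hy, h0⟩, pd_const]

/-- A function on a box, at each point of which the differential is in one of the two factors, is
a function on one of the factors. -/
theorem box_alternative {f : R4 → ℝ} {s t : Set (Fin 2 → ℝ)} (hs : IsOpen s) (ht : IsOpen t)
    (hsc : Convex ℝ s) (htc : Convex ℝ t) (hf : ContDiffOn ℝ ∞ f (box s t))
    (h : ∀ y ∈ box s t, (pd 0 f y = 0 ∧ pd 1 f y = 0) ∨ (pd 2 f y = 0 ∧ pd 3 f y = 0)) :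
    (∀ y ∈ box s t, pd 0 f y = 0 ∧ pd 1 f y = 0) ∨ (∀ y ∈ box s t, pd 2 f y = 0 ∧ pd 3 f y = 0) := by
  have hK := isOpen_box hs ht
  have hc := convex_box hsc htc
  by_contra hcon
  push Not at hcon
  obtain ⟨⟨x, hx, hx0⟩, ⟨y, hy, hy0⟩⟩ := hcon
  obtain ⟨A, hA, hAx⟩ : ∃ A : Fin 4, (A = 0 ∨ A = 1) ∧ pd A f x ≠ 0 := by
    by_cases h0 : pd 0 f x = 0
    · exact ⟨1, Or.inr rfl, hx0 h0⟩
    · exact ⟨0, Or.inl rfl, h0⟩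
  obtain ⟨B, hB, hBy⟩ : ∃ B : Fin 4, (B = 2 ∨ B = 3) ∧ pd B f y ≠ 0 := by
    by_cases h0 : pd 2 f y = 0
    · exact ⟨3, Or.inr rfl, hy0 h0⟩
    · exact ⟨2, Or.inl rfl, h0⟩
  -- The corner of the box shared by the slice through x along the second factor and the slice
  -- through y along the first. Both nonvanishing derivatives propagate to it, which contradicts the
  -- alternative there.
  set z := joinPair (firstPair x) (lastPair y) with hz
  have hzK : z ∈ box s t := ⟨by rw [hz, firstPair_joinPair]; exact hx.1,
    by rw [hz, lastPair_joinPair]; exact hy.2⟩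
  have hA2 : ∀ w ∈ box s t, pd A f w ≠ 0 → pd 2 f w = 0 ∧ pd 3 f w = 0 := by
    intro w hw hne
    refine (h w hw).resolve_left fun h01 => ?_
    rcases hA with rfl | rfl
    · exact hne h01.1
    · exact hne h01.2
  have hB2 : ∀ w ∈ box s t, pd B f w ≠ 0 → pd 0 f w = 0 ∧ pd 1 f w = 0 := by
    intro w hw hne
    refine (h w hw).resolve_right fun h01 => ?_
    rcases hB with rfl | rfl
    · exact hne h01.1
    · exact hne h01.2
  have hAz : pd A f z ≠ 0 := by
    refine ne_zero_of_fderiv_apply_eq_zero hK hc (contDiffOn_pd hK hf A) hx hzK ?_ hAx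
    intro w hw hne
    have d0 : (z - x) 0 = 0 := sub_self (x 0)
    have d1 : (z - x) 1 = 0 := sub_self (x 1)
    rw [fderiv_apply_eq_sum_pd, Fin.sum_univ_four, d0, d1,
      pd_pd_eq_zero hK hf A 2 (fun w hw hne => (hA2 w hw hne).1) hw hne,
      pd_pd_eq_zero hK hf A 3 (fun w hw hne => (hA2 w hw hne).2) hw hne]
    ring
  have hBz : pd B f z ≠ 0 := by
    refine ne_zero_of_fderiv_apply_eq_zero hK hc (contDiffOn_pd hK hf B) hy hzK ?_ hBy
    intro w hw hne
    have d0 : (z - y) 2 = 0 := sub_self (y 2)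
    have d1 : (z - y) 3 = 0 := sub_self (y 3)
    rw [fderiv_apply_eq_sum_pd, Fin.sum_univ_four, d0, d1,
      pd_pd_eq_zero hK hf B 0 (fun w hw hne => (hB2 w hw hne).1) hw hne,
      pd_pd_eq_zero hK hf B 1 (fun w hw hne => (hB2 w hw hne).2) hw hne]
    ring
  have h23 := hA2 z hzK hAz
  rcases hB with rfl | rfl
  · exact hBz h23.1
  · exact hBz h23.2

theorem exists_eq_comp_lastPair {f : R4 → ℝ} {s t : Set (Fin 2 → ℝ)} (hs : IsOpen s) (ht : IsOpen t)
    (hsc : Convex ℝ s) (htc : Convex ℝ t) (hf : ContDiffOn ℝ ∞ f (box s t)) {x₀ : R4}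
    (hx₀ : x₀ ∈ box s t) (h : ∀ y ∈ box s t, pd 0 f y = 0 ∧ pd 1 f y = 0) :
    ∃ m : (Fin 2 → ℝ) → ℝ, ContDiffOn ℝ ∞ m t ∧ ∀ x ∈ box s t, f x = m (lastPair x) := by
  -- The restriction of f to the slice through the base point; segments from any point of the box to
  -- this slice stay in the box by convexity.
  refine ⟨fun w => f (joinPair (firstPair x₀) w), ?_, ?_⟩
  · have hj : ContDiff ℝ ∞ (fun w => joinPair (firstPair x₀) w) :=
      contDiff_joinPair.comp (f := fun w => (firstPair x₀, w)) (contDiff_const.prodMk contDiff_id)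
    refine hf.comp hj.contDiffOn ?_
    intro w hw
    exact ⟨by simpa [firstPair_joinPair] using hx₀.1, by simpa [lastPair_joinPair] using hw⟩
  · intro x hx
    refine eq_of_fderiv_apply_eq_zero (isOpen_box hs ht) (convex_box hsc htc) hf hx
      ⟨by simpa [firstPair_joinPair] using hx₀.1, by simpa [lastPair_joinPair] using hx.2⟩ ?_
    intro y hy
    have d0 : (joinPair (firstPair x₀) (lastPair x) - x) 2 = 0 := sub_self (x 2)
    have d1 : (joinPair (firstPair x₀) (lastPair x) - x) 3 = 0 := sub_self (x 3)
    rw [fderiv_apply_eq_sum_pd, Fin.sum_univ_four, d0, d1, (h y hy).1, (h y hy).2]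
    ring

theorem exists_eq_comp_firstPair {f : R4 → ℝ} {s t : Set (Fin 2 → ℝ)} (hs : IsOpen s)
    (ht : IsOpen t) (hsc : Convex ℝ s) (htc : Convex ℝ t) (hf : ContDiffOn ℝ ∞ f (box s t))
    {x₀ : R4} (hx₀ : x₀ ∈ box s t) (h : ∀ y ∈ box s t, pd 2 f y = 0 ∧ pd 3 f y = 0) :
    ∃ m : (Fin 2 → ℝ) → ℝ, ContDiffOn ℝ ∞ m s ∧ ∀ x ∈ box s t, f x = m (firstPair x) := by
  refine ⟨fun u => f (joinPair u (lastPair x₀)), ?_, ?_⟩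
  · have hj : ContDiff ℝ ∞ (fun u => joinPair u (lastPair x₀)) :=
      contDiff_joinPair.comp (f := fun u => (u, lastPair x₀)) (contDiff_id.prodMk contDiff_const)
    refine hf.comp hj.contDiffOn ?_
    intro w hw
    exact ⟨by simpa [firstPair_joinPair] using hw, by simpa [lastPair_joinPair] using hx₀.2⟩
  · intro x hx
    refine eq_of_fderiv_apply_eq_zero (isOpen_box hs ht) (convex_box hsc htc) hf hx
      ⟨by simpa [firstPair_joinPair] using hx.1, by simpa [lastPair_joinPair] using hx₀.2⟩ ?_
    intro y hy
    have d0 : (joinPair (firstPair x) (lastPair x₀) - x) 0 = 0 := sub_self (x 0)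
    have d1 : (joinPair (firstPair x) (lastPair x₀) - x) 1 = 0 := sub_self (x 1)
    rw [fderiv_apply_eq_sum_pd, Fin.sum_univ_four, d0, d1, (h y hy).1, (h y hy).2]
    ring

/-! ### Change of chart -/

/-- The data of `IsConfProductOn`. -/
structure IsConfProductData (g : R4 → Matrix (Fin 4) (Fin 4) ℝ) (O : Set R4)
    (v h : (Fin 2 → ℝ) → Matrix (Fin 2) (Fin 2) ℝ) (lam : R4 → ℝ) : Prop where
  lorentz : IsLorentz2 v (firstPair '' O)
  riemannian : IsRiemann2 h (lastPair '' O)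
  smooth : ContDiffOn ℝ ∞ lam O
  eq : ∀ x ∈ O, g x = blockDiag (Real.exp (2 * lam x) • v (firstPair x))
      (Real.exp (2 * lam x) • h (lastPair x))

section transition
variable {M : Type*} [TopologicalSpace M]

theorem isOpen_transition (φ ψ : OpenPartialHomeomorph M R4) :
    IsOpen (φ.target ∩ φ.symm ⁻¹' ψ.source) :=
  φ.symm.isOpen_inter_preimage ψ.open_source

variable [ChartedSpace R4 M]

theorem contDiffOn_transition {φ ψ : OpenPartialHomeomorph M R4}
    (hφ : φ ∈ IsManifold.maximalAtlas (𝓡 4) ∞ M) (hψ : ψ ∈ IsManifold.maximalAtlas (𝓡 4) ∞ M) :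
    ContDiffOn ℝ ∞ (ψ ∘ φ.symm) (φ.target ∩ φ.symm ⁻¹' ψ.source) := by
  rw [← contMDiffOn_iff_contDiffOn]
  exact (contMDiffOn_of_mem_maximalAtlas hψ).comp
    ((contMDiffOn_symm_of_mem_maximalAtlas hφ).mono inter_subset_left) (fun y hy => hy.2)

theorem jacobian_transition_det_ne {φ ψ : OpenPartialHomeomorph M R4}
    (hφ : φ ∈ IsManifold.maximalAtlas (𝓡 4) ∞ M) (hψ : ψ ∈ IsManifold.maximalAtlas (𝓡 4) ∞ M)
    {y : R4} (hy : y ∈ φ.target ∩ φ.symm ⁻¹' ψ.source) :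
    (jacobian (ψ ∘ φ.symm) y).det ≠ 0 := by
  have hU := isOpen_transition φ ψ
  have hF : DifferentiableAt ℝ (ψ ∘ φ.symm) y :=
    ((contDiffOn_transition hφ hψ).contDiffAt (hU.mem_nhds hy)).differentiableAt (by simp)
  have hy' : (ψ ∘ φ.symm) y ∈ ψ.target ∩ ψ.symm ⁻¹' φ.source := by
    refine ⟨ψ.map_source hy.2, ?_⟩
    simp only [Function.comp, mem_preimage, ψ.left_inv hy.2]
    exact φ.map_target hy.1
  have hG : DifferentiableAt ℝ (φ ∘ ψ.symm) ((ψ ∘ φ.symm) y) :=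
    ((contDiffOn_transition hψ hφ).contDiffAt
      ((isOpen_transition ψ φ).mem_nhds hy')).differentiableAt (by simp)
  -- The two transition maps are mutually inverse near these points, so their Jacobians are inverse
  -- matrices by the chain rule.
  have hprod : jacobian (φ ∘ ψ.symm) ((ψ ∘ φ.symm) y) * jacobian (ψ ∘ φ.symm) y = 1 := by
    ext i j
    have h1 := pd_comp_map (f := fun z => (φ ∘ ψ.symm) z i) hF (differentiableAt_euclidean.1 hG i) j
    have h2 : pd j (fun z => (φ ∘ ψ.symm) ((ψ ∘ φ.symm) z) i) y = pd j (fun z => z i) y := by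
      refine pd_congr hU (fun z hz => ?_) j hy
      have hz2 : ψ.symm (ψ (φ.symm z)) = φ.symm z := ψ.left_inv hz.2
      simp only [Function.comp, hz2, φ.right_inv hz.1]
    have h3 : pd j (fun z : R4 => z i) y = (1 : Matrix (Fin 4) (Fin 4) ℝ) i j := by
      have : fderiv ℝ (fun z : R4 => z i) y = (EuclideanSpace.proj i : R4 →L[ℝ] ℝ) :=
        (EuclideanSpace.proj i : R4 →L[ℝ] ℝ).fderiv
      simp [pd, this, Matrix.one_apply]
    rw [Matrix.mul_apply, ← h3, ← h2, h1]
    exact Finset.sum_congr rfl fun A _ => mul_comm _ _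
  intro h0
  have := congrArg Matrix.det hprod
  rw [Matrix.det_mul, h0, mul_zero, Matrix.det_one] at this
  exact zero_ne_one this

variable [IsManifold (𝓡 4) ∞ M]

theorem LorentzMetric.val_congr (g : LorentzMetric M) {p q : M} (h : p = q) (u w : R4) :
    (g.val p : R4 →L[ℝ] R4 →L[ℝ] ℝ) u w = (g.val q : R4 →L[ℝ] R4 →L[ℝ] ℝ) u w := by
  subst h; rfl

/-- Near the point, the inverse of φ is the inverse of ψ after the transition map; its differential
therefore sends the i-th coordinate vector to the combination given by the i-th column of the
Jacobian. -/
theorem metricIn_transition (g : LorentzMetric M) {φ ψ : OpenPartialHomeomorph M R4}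
    (hφ : φ ∈ IsManifold.maximalAtlas (𝓡 4) ∞ M) (hψ : ψ ∈ IsManifold.maximalAtlas (𝓡 4) ∞ M)
    {y : R4} (hy : y ∈ φ.target ∩ φ.symm ⁻¹' ψ.source) :
    metricIn g φ y = pullMat (jacobian (ψ ∘ φ.symm) y) (metricIn g ψ ((ψ ∘ φ.symm) y)) := by
  have hU := isOpen_transition φ ψ
  set F := ψ ∘ φ.symm with hFdef
  have hF : DifferentiableAt ℝ F y :=
    ((contDiffOn_transition hφ hψ).contDiffAt (hU.mem_nhds hy)).differentiableAt (by simp)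
  have hFy : F y ∈ ψ.target := ψ.map_source hy.2
  have hψs : MDifferentiableAt (𝓡 4) (𝓡 4) ψ.symm (F y) :=
    ((contMDiffOn_symm_of_mem_maximalAtlas hψ).contMDiffAt
      (ψ.open_target.mem_nhds hFy)).mdifferentiableAt (by simp)
  have hev : φ.symm =ᶠ[𝓝 y] ψ.symm ∘ F :=
    Filter.eventually_of_mem (hU.mem_nhds hy) fun z hz => (ψ.left_inv hz.2).symm
  have hmf : mfderiv (𝓡 4) (𝓡 4) φ.symm y =
      (mfderiv (𝓡 4) (𝓡 4) ψ.symm (F y)).comp (fderiv ℝ F y) := by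
    have e1 := hev.mfderiv_eq (I := 𝓡 4) (I' := 𝓡 4)
    have e2 := mfderiv_comp y hψs hF.mdifferentiableAt
    rw [mfderiv_eq_fderiv] at e2
    exact e1.trans e2
  have hp : φ.symm y = ψ.symm (F y) := (ψ.left_inv hy.2).symm
  set D : R4 →L[ℝ] R4 := mfderiv (𝓡 4) (𝓡 4) ψ.symm (F y) with hD
  set B : R4 →L[ℝ] R4 →L[ℝ] ℝ := g.val (ψ.symm (F y)) with hB
  have hexp : ∀ i, fderiv ℝ F y (EuclideanSpace.single i 1) =
      ∑ A, jacobian F y A i • EuclideanSpace.single A (1 : ℝ) := by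
    intro i
    ext k
    rw [fderiv_apply_eq_jacobian hF]
    simp [Pi.single_apply]
  have h1 : ∀ i j, metricIn g φ y i j = B (D (fderiv ℝ F y (EuclideanSpace.single i 1)))
      (D (fderiv ℝ F y (EuclideanSpace.single j 1))) := by
    intro i j
    refine (g.val_congr hp _ _).trans ?_
    rw [hmf]
    rfl
  have h2 : ∀ A B', metricIn g ψ (F y) A B' = B (D (EuclideanSpace.single A 1))
      (D (EuclideanSpace.single B' 1)) := fun _ _ => rfl
  ext i j
  rw [h1, hexp, hexp]
  simp only [map_sum, map_smul, sum_apply, smul_apply, smul_eq_mul, ← h2, pullMat, Matrix.mul_apply, Matrix.transpose_apply, Finset.sum_mul,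
    Finset.mul_sum]
  iterate 2 refine Finset.sum_congr rfl fun _ _ => ?_
  ring

theorem isPulledBack_transition (g : LorentzMetric M) {φ ψ : OpenPartialHomeomorph M R4}
    (hφ : φ ∈ IsManifold.maximalAtlas (𝓡 4) ∞ M) (hψ : ψ ∈ IsManifold.maximalAtlas (𝓡 4) ∞ M)
    {v h : (Fin 2 → ℝ) → Matrix (Fin 2) (Fin 2) ℝ} {lam : R4 → ℝ}
    (hd : IsConfProductData (metricIn g ψ) ψ.target v h lam) :
    IsPulledBack (metricIn g φ) (φ.target ∩ φ.symm ⁻¹' ψ.source) (ψ ∘ φ.symm) ψ.target v h lam where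
  isOpen_source := isOpen_transition φ ψ
  isOpen_target := ψ.open_target
  smooth_map := contDiffOn_euclidean.1 (contDiffOn_transition hφ hψ)
  mapsTo y hy := ψ.map_source hy.2
  det_ne y hy := jacobian_transition_det_ne hφ hψ hy
  lorentz := hd.lorentz
  riemannian := hd.riemannian
  smooth := hd.smooth
  eq y hy := by
    rw [metricIn_transition g hφ hψ hy, hd.eq ((ψ ∘ φ.symm) y) (ψ.map_source hy.2)]

end transition

/-! ### Warped products as conformal products -/

theorem fderiv_apply_eq_sum_single (m : (Fin 2 → ℝ) → ℝ) (u w : Fin 2 → ℝ) :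
    fderiv ℝ m u w = ∑ C, w C * fderiv ℝ m u (Pi.single C 1) := by
  conv_lhs => rw [← Finset.univ_sum_single w]
  rw [map_sum]
  refine Finset.sum_congr rfl fun C _ => ?_
  have : (Pi.single C (w C) : Fin 2 → ℝ) = w C • Pi.single C 1 := by
    ext k; simp [Pi.single_apply]
  rw [this, map_smul, smul_eq_mul]

theorem pd_coord (i A : Fin 4) (x : R4) : pd i (fun z => z A) x = if A = i then 1 else 0 := by
  have : fderiv ℝ (fun z : R4 => z A) x = (EuclideanSpace.proj A : R4 →L[ℝ] ℝ) :=
    (EuclideanSpace.proj A : R4 →L[ℝ] ℝ).fderiv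
  simp [pd, this]

theorem pd_comp_firstPair {m : (Fin 2 → ℝ) → ℝ} {x : R4} (hm : DifferentiableAt ℝ m (firstPair x))
    (i : Fin 4) : pd i (fun y => m (firstPair y)) x =
      ∑ C : Fin 2, (if Fin.castAdd 2 C = i then 1 else 0) * fderiv ℝ m (firstPair x) (Pi.single C 1) := by
  have := pd_comp (x := fun C y => y (Fin.castAdd 2 C)) (y := x) hm (fun C => by fun_prop) i
  simp only [pd_coord] at this
  exact this

theorem pd_comp_lastPair {m : (Fin 2 → ℝ) → ℝ} {x : R4} (hm : DifferentiableAt ℝ m (lastPair x))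
    (i : Fin 4) : pd i (fun y => m (lastPair y)) x =
      ∑ C : Fin 2, (if Fin.natAdd 2 C = i then 1 else 0) * fderiv ℝ m (lastPair x) (Pi.single C 1) := by
  have := pd_comp (x := fun C y => y (Fin.natAdd 2 C)) (y := x) hm (fun C => by fun_prop) i
  simp only [pd_coord] at this
  exact this

theorem fderiv_eq_zero_iff (m : (Fin 2 → ℝ) → ℝ) (u : Fin 2 → ℝ) :
    fderiv ℝ m u = 0 ↔ ∀ C, fderiv ℝ m u (Pi.single C 1) = 0 := by
  constructor
  · intro h C; rw [h]; rfl
  · intro h; ext w; rw [fderiv_apply_eq_sum_single]; simp [h]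

theorem pd_comp_lastPair_ne_zero_iff {m : (Fin 2 → ℝ) → ℝ} {x : R4}
    (hm : DifferentiableAt ℝ m (lastPair x)) :
    (∃ A, pd A (fun y => m (lastPair y)) x ≠ 0) ↔ fderiv ℝ m (lastPair x) ≠ 0 := by
  rw [← not_iff_not, not_not, fderiv_eq_zero_iff]
  push Not
  simp only [pd_comp_lastPair hm, Fin.forall_fin_two, Fin.sum_univ_two]
  constructor
  · intro h
    have h2 := h 2
    have h3 := h 3
    simp [Fin.natAdd, Fin.ext_iff] at h2 h3
    exact ⟨h2, h3⟩
  · rintro ⟨h0, h1⟩ A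
    rw [h0, h1]; ring

theorem pd_comp_firstPair_ne_zero_iff {m : (Fin 2 → ℝ) → ℝ} {x : R4}
    (hm : DifferentiableAt ℝ m (firstPair x)) :
    (∃ A, pd A (fun y => m (firstPair y)) x ≠ 0) ↔ fderiv ℝ m (firstPair x) ≠ 0 := by
  rw [← not_iff_not, not_not, fderiv_eq_zero_iff]
  push Not
  simp only [pd_comp_firstPair hm, Fin.forall_fin_two, Fin.sum_univ_two]
  constructor
  · intro h
    have h2 := h 0
    have h3 := h 1
    simp [Fin.castAdd, Fin.castLE] at h2 h3
    exact ⟨h2, h3⟩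
  · rintro ⟨h0, h1⟩ A
    rw [h0, h1]; ring

theorem IsLorentz2.exp_smul {v : (Fin 2 → ℝ) → Matrix (Fin 2) (Fin 2) ℝ} {s : Set (Fin 2 → ℝ)}
    (hv : IsLorentz2 v s) {m : (Fin 2 → ℝ) → ℝ} (hm : ContDiffOn ℝ ∞ m s) :
    IsLorentz2 (fun u => Real.exp (m u) • v u) s where
  smooth i j := hm.exp.mul (hv.smooth i j)
  symm u hu := (hv.symm u hu).smul _
  det_neg u hu := by
    rw [Matrix.det_smul]
    exact mul_neg_of_pos_of_neg (pow_pos (Real.exp_pos _) _) (hv.det_neg u hu)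

theorem IsRiemann2.exp_smul {h : (Fin 2 → ℝ) → Matrix (Fin 2) (Fin 2) ℝ} {s : Set (Fin 2 → ℝ)}
    (hh : IsRiemann2 h s) {m : (Fin 2 → ℝ) → ℝ} (hm : ContDiffOn ℝ ∞ m s) :
    IsRiemann2 (fun u => Real.exp (m u) • h u) s where
  smooth i j := hm.exp.mul (hh.smooth i j)
  posDef u hu := (hh.posDef u hu).smul (Real.exp_pos _)

theorem exp_smul_exp_neg_smul (p : ℝ) (A : Matrix (Fin 2) (Fin 2) ℝ) :
    Real.exp (2 * p) • Real.exp (-2 * p) • A = A := by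
  rw [smul_smul, ← Real.exp_add]
  simp

/-- e^{2λ}v + h = e^{2λ}(v + e^{-2λ}h), with λ a function of the last pair. The last clause
transfers `C` to dλ in four coordinates, so that one statement serves both the strict and the wide
notion. -/
theorem IsTWarpedOn.exists_data {C : ((Fin 2 → ℝ) →L[ℝ] ℝ) → Prop}
    {g : R4 → Matrix (Fin 4) (Fin 4) ℝ} {O : Set R4} (hO : IsOpen O) (hg : IsTWarpedOn C g O) :
    ∃ v h lam, IsConfProductData g O v h lam ∧
      (∀ x ∈ O, (pd 0 lam x = 0 ∧ pd 1 lam x = 0) ∨ (pd 2 lam x = 0 ∧ pd 3 lam x = 0)) ∧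
      ∀ x ∈ O, ∃ l, C l ∧ (l ≠ 0 → ∃ A, pd A lam x ≠ 0) := by
  obtain ⟨v, h, m, hv, hh, hm, hC, heq⟩ := hg
  have dm : ∀ x ∈ O, DifferentiableAt ℝ m (lastPair x) := fun x hx =>
    differentiableAt_of_contDiffOn (isOpenMap_lastPair O hO) hm (mem_image_of_mem _ hx)
  refine ⟨v, fun u => Real.exp (-2 * m u) • h u, fun x => m (lastPair x),
    ⟨hv, hh.exp_smul (contDiffOn_const.mul hm), ?_, ?_⟩, ?_, ?_⟩
  · exact hm.comp ((contDiff_pi.2 fun i => contDiff_euclidean.1 contDiff_id _).contDiffOn)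
      fun x hx => mem_image_of_mem lastPair hx
  · intro x hx
    rw [heq x hx, exp_smul_exp_neg_smul]
  · intro x hx
    left
    rw [pd_comp_lastPair (dm x hx), pd_comp_lastPair (dm x hx)]
    constructor <;> refine Finset.sum_eq_zero fun C _ => ?_ <;>
      rw [if_neg (by fin_cases C <;> decide), zero_mul]
  · intro x hx
    exact ⟨_, hC _ (mem_image_of_mem _ hx), (pd_comp_lastPair_ne_zero_iff (dm x hx)).2⟩

theorem IsSWarpedOn.exists_data {C : ((Fin 2 → ℝ) →L[ℝ] ℝ) → Prop}
    {g : R4 → Matrix (Fin 4) (Fin 4) ℝ} {O : Set R4} (hO : IsOpen O) (hg : IsSWarpedOn C g O) :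
    ∃ v h lam, IsConfProductData g O v h lam ∧
      (∀ x ∈ O, (pd 0 lam x = 0 ∧ pd 1 lam x = 0) ∨ (pd 2 lam x = 0 ∧ pd 3 lam x = 0)) ∧
      ∀ x ∈ O, ∃ l, C l ∧ (l ≠ 0 → ∃ A, pd A lam x ≠ 0) := by
  obtain ⟨v, h, m, hv, hh, hm, hC, heq⟩ := hg
  have dm : ∀ x ∈ O, DifferentiableAt ℝ m (firstPair x) := fun x hx =>
    differentiableAt_of_contDiffOn (isOpenMap_firstPair O hO) hm (mem_image_of_mem _ hx)
  refine ⟨fun u => Real.exp (-2 * m u) • v u, h, fun x => m (firstPair x),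
    ⟨hv.exp_smul (contDiffOn_const.mul hm), hh, ?_, ?_⟩, ?_, ?_⟩
  · exact hm.comp ((contDiff_pi.2 fun i => contDiff_euclidean.1 contDiff_id _).contDiffOn)
      fun x hx => mem_image_of_mem firstPair hx
  · intro x hx
    rw [heq x hx, exp_smul_exp_neg_smul]
  · intro x hx
    right
    rw [pd_comp_firstPair (dm x hx), pd_comp_firstPair (dm x hx)]
    simp [Fin.castAdd, Fin.castLE, Fin.ext_iff]
  · intro x hx
    exact ⟨_, hC _ (mem_image_of_mem _ hx), (pd_comp_firstPair_ne_zero_iff (dm x hx)).2⟩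

/-- A conformal product on a box with suitable conformal factor is warped. -/
theorem IsConfProductData.warped {C : ((Fin 2 → ℝ) →L[ℝ] ℝ) → Prop}
    {g : R4 → Matrix (Fin 4) (Fin 4) ℝ} {s t : Set (Fin 2 → ℝ)} (hs : IsOpen s) (ht : IsOpen t)
    (hsc : Convex ℝ s) (htc : Convex ℝ t) {x₀ : R4} (hx₀ : x₀ ∈ box s t)
    {v h : (Fin 2 → ℝ) → Matrix (Fin 2) (Fin 2) ℝ} {lam : R4 → ℝ}
    (hd : IsConfProductData g (box s t) v h lam)
    (halt : ∀ x ∈ box s t,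
      (pd 0 lam x = 0 ∧ pd 1 lam x = 0) ∨ (pd 2 lam x = 0 ∧ pd 3 lam x = 0))
    (hC : ∀ x ∈ box s t, ∀ l, ((∃ A, pd A lam x ≠ 0) → l ≠ 0) → C l) :
    IsTWarpedOn C g (box s t) ∨ IsSWarpedOn C g (box s t) := by
  have hK := isOpen_box hs ht
  rcases box_alternative hs ht hsc htc hd.smooth halt with h0 | h0
  · left
    obtain ⟨m, hm, hlam⟩ := exists_eq_comp_lastPair hs ht hsc htc hd.smooth hx₀ h0
    have hm' : ContDiffOn ℝ ∞ m (lastPair '' box s t) := hm.mono (by rintro _ ⟨x, hx, rfl⟩; exact hx.2)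
    -- Once λ depends on the last pair only, e^{2λ}h is itself a Riemannian metric in that pair, and
    -- e^{2λ} warps v.
    refine ⟨v, fun u => Real.exp (2 * m u) • h u, m, hd.lorentz,
      hd.riemannian.exp_smul (contDiffOn_const.mul hm'), hm', ?_, ?_⟩
    · rintro _ ⟨x, hx, rfl⟩
      refine hC x hx _ ?_
      rintro ⟨A, hA⟩
      rw [pd_congr hK hlam A hx] at hA
      exact (pd_comp_lastPair_ne_zero_iff
        (differentiableAt_of_contDiffOn ht hm hx.2)).1 ⟨A, hA⟩
    · intro x hx
      rw [hd.eq x hx, hlam x hx]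
  · right
    obtain ⟨m, hm, hlam⟩ := exists_eq_comp_firstPair hs ht hsc htc hd.smooth hx₀ h0
    have hm' : ContDiffOn ℝ ∞ m (firstPair '' box s t) := hm.mono (by rintro _ ⟨x, hx, rfl⟩; exact hx.1)
    refine ⟨fun u => Real.exp (2 * m u) • v u, h, m,
      hd.lorentz.exp_smul (contDiffOn_const.mul hm'), hd.riemannian, hm', ?_, ?_⟩
    · rintro _ ⟨x, hx, rfl⟩
      refine hC x hx _ ?_
      rintro ⟨A, hA⟩
      rw [pd_congr hK hlam A hx] at hA
      exact (pd_comp_firstPair_ne_zero_iff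
        (differentiableAt_of_contDiffOn hs hm hx.1)).1 ⟨A, hA⟩
    · intro x hx
      rw [hd.eq x hx, hlam x hx]

theorem IsConfProductData.mono {g : R4 → Matrix (Fin 4) (Fin 4) ℝ} {O O' : Set R4} (hO : O' ⊆ O)
    {v h : (Fin 2 → ℝ) → Matrix (Fin 2) (Fin 2) ℝ} {lam : R4 → ℝ}
    (hd : IsConfProductData g O v h lam) : IsConfProductData g O' v h lam where
  lorentz := ⟨fun i j => (hd.lorentz.smooth i j).mono (image_mono hO),
    fun u hu => hd.lorentz.symm u (image_mono hO hu),
    fun u hu => hd.lorentz.det_neg u (image_mono hO hu)⟩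
  riemannian := ⟨fun i j => (hd.riemannian.smooth i j).mono (image_mono hO),
    fun u hu => hd.riemannian.posDef u (image_mono hO hu)⟩
  smooth := hd.smooth.mono hO
  eq x hx := hd.eq x (hO hx)

/-! ### Both implications on a spacetime -/

section spacetime
variable {M : Type*} [TopologicalSpace M] [ChartedSpace R4 M] [IsManifold (𝓡 4) ∞ M]

/-- The concomitants in any chart in terms of the conformal factor in an adapted chart. -/
theorem concomitants_iff (g : LorentzMetric M) (hflat : NonConfFlat g)
    {φ ψ : OpenPartialHomeomorph M R4}
    (hφ : φ ∈ IsManifold.maximalAtlas (𝓡 4) ∞ M) (hψ : ψ ∈ IsManifold.maximalAtlas (𝓡 4) ∞ M)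
    {v h : (Fin 2 → ℝ) → Matrix (Fin 2) (Fin 2) ℝ} {lam : R4 → ℝ}
    (hd : IsConfProductData (metricIn g ψ) ψ.target v h lam) {x : R4} (hx : x ∈ φ.target)
    (hx' : φ.symm x ∈ ψ.source) :
    (phi (metricIn g φ) x ≠ 0 ↔ ∃ A, pd A lam (ψ (φ.symm x)) ≠ 0) ∧
    (starSPhi (metricIn g φ) x = 0 ↔ (pd 0 lam (ψ (φ.symm x)) = 0 ∧ pd 1 lam (ψ (φ.symm x)) = 0) ∨
      (pd 2 lam (ψ (φ.symm x)) = 0 ∧ pd 3 lam (ψ (φ.symm x)) = 0)) ∧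
    (starWPhi (metricIn g φ) x = 0 ↔ (pd 0 lam (ψ (φ.symm x)) = 0 ∧ pd 1 lam (ψ (φ.symm x)) = 0) ∨
      (pd 2 lam (ψ (φ.symm x)) = 0 ∧ pd 3 lam (ψ (φ.symm x)) = 0)) := by
  have P := isPulledBack_transition g hφ hψ hd
  have hW : ∀ y ∈ φ.target ∩ φ.symm ⁻¹' ψ.source, weyl (metricIn g φ) y ≠ 0 := fun y hy =>
    hflat φ hφ y hy.1
  exact ⟨P.phi_ne_zero_iff hW ⟨hx, hx'⟩, P.starSPhi_eq_zero_iff hW ⟨hx, hx'⟩,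
    P.starWPhi_eq_zero_iff hW ⟨hx, hx'⟩⟩

/-- Necessity: a warped metric satisfies the equations in every chart. -/
theorem concomitants_of_warped {C : ((Fin 2 → ℝ) →L[ℝ] ℝ) → Prop} (g : LorentzMetric M)
    (hflat : NonConfFlat g)
    (hw : Locally g fun γ O => IsTWarpedOn C γ O ∨ IsSWarpedOn C γ O) :
    Everywhere g (fun γ x => starSPhi γ x = 0) ∧ Everywhere g (fun γ x => starWPhi γ x = 0) ∧
    ((∀ l, C l → l ≠ 0) → Everywhere g (fun γ x => phi γ x ≠ 0)) := by
  have key : ∀ φ ∈ IsManifold.maximalAtlas (𝓡 4) ∞ M, ∀ x ∈ φ.target,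
      starSPhi (metricIn g φ) x = 0 ∧ starWPhi (metricIn g φ) x = 0 ∧
      ((∀ l, C l → l ≠ 0) → phi (metricIn g φ) x ≠ 0) := by
    intro φ hφ x hx
    obtain ⟨ψ, hψ, hp, hform⟩ := hw (φ.symm x)
    obtain ⟨v, h, lam, hd, halt, hne⟩ : ∃ v h lam,
        IsConfProductData (metricIn g ψ) ψ.target v h lam ∧
        (∀ x ∈ ψ.target, (pd 0 lam x = 0 ∧ pd 1 lam x = 0) ∨ (pd 2 lam x = 0 ∧ pd 3 lam x = 0)) ∧
        ∀ x ∈ ψ.target, ∃ l, C l ∧ (l ≠ 0 → ∃ A, pd A lam x ≠ 0) :=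
      hform.elim (fun h => h.exists_data ψ.open_target) (fun h => h.exists_data ψ.open_target)
    obtain ⟨h1, h2, h3⟩ := concomitants_iff g hflat hφ hψ hd hx hp
    refine ⟨h2.2 (halt _ (ψ.map_source hp)), h3.2 (halt _ (ψ.map_source hp)), fun hC => h1.2 ?_⟩
    obtain ⟨l, hl, hl'⟩ := hne _ (ψ.map_source hp)
    exact hl' (hC l hl)
  exact ⟨fun φ hφ x hx => (key φ hφ x hx).1, fun φ hφ x hx => (key φ hφ x hx).2.1,
    fun hC φ hφ x hx => (key φ hφ x hx).2.2 hC⟩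

/-- Sufficiency: the equations in the adapted charts imply that the metric is warped. -/
theorem warped_of_concomitants {C : ((Fin 2 → ℝ) →L[ℝ] ℝ) → Prop} (g : LorentzMetric M)
    (hprod : IsConfProduct g) (hflat : NonConfFlat g)
    (hstar : Everywhere g (fun γ x => starSPhi γ x = 0) ∨
      Everywhere g (fun γ x => starWPhi γ x = 0))
    (hC : (∀ l, C l) ∨ ((∀ l, l ≠ 0 → C l) ∧ Everywhere g (fun γ x => phi γ x ≠ 0))) :
    Locally g fun γ O => IsTWarpedOn C γ O ∨ IsSWarpedOn C γ O := by
  intro p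
  obtain ⟨ψ, hψ, hp, v, h, lam, hv, hh, hlam, heq⟩ := hprod p
  have hd : IsConfProductData (metricIn g ψ) ψ.target v h lam := ⟨hv, hh, hlam, heq⟩
  -- An adapted chart domain need not be a box, and there λ could depend on different pairs in
  -- different regions; the chart is first shrunk around the point.
  obtain ⟨s, t, hs, ht, hsc, htc, hmem, hsub⟩ :=
    exists_box_subset ψ.open_target (ψ.map_source hp)
  have hopen : IsOpen (ψ.source ∩ ψ ⁻¹' box s t) := ψ.isOpen_inter_preimage (isOpen_box hs ht)
  have hiff := fun x (hx : x ∈ ψ.target) =>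
    concomitants_iff g hflat hψ hψ hd hx (ψ.map_target hx)
  have htarget : (ψ.restr (ψ.source ∩ ψ ⁻¹' box s t)).target = box s t := by
    rw [ψ.restr_target, hopen.interior_eq]
    ext x
    constructor
    · rintro ⟨hx, hx'⟩
      have := hx'.2
      rwa [mem_preimage, ψ.right_inv hx] at this
    · intro hx
      refine ⟨hsub hx, ψ.map_target (hsub hx), ?_⟩
      rwa [mem_preimage, ψ.right_inv (hsub hx)]
  -- The restricted chart has the same inverse map, hence the same metric components on a smaller
  -- target.
  refine ⟨ψ.restr (ψ.source ∩ ψ ⁻¹' box s t), restr_mem_maximalAtlas _ hψ hopen, ?_, ?_⟩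
  · rw [ψ.restr_source' _ hopen]
    exact ⟨hp, hp, hmem⟩
  · rw [htarget]
    refine IsConfProductData.warped (g := metricIn g ψ) hs ht hsc htc hmem (hd.mono hsub) ?_ ?_
    · intro x hx
      have := hiff x (hsub hx)
      rw [ψ.right_inv (hsub hx)] at this
      rcases hstar with hS | hS
      · exact this.2.1.1 (hS ψ hψ x (hsub hx))
      · exact this.2.2.1 (hS ψ hψ x (hsub hx))
    · intro x hx l hl
      rcases hC with hC | ⟨hC, hphi⟩
      · exact hC l
      · refine hC l (hl ?_)
        have := hiff x (hsub hx)
        rw [ψ.right_inv (hsub hx)] at this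
        exact this.1.1 (hphi ψ hψ x (hsub hx))

end spacetime

end Warped22

end

theorem mainTheorem11 {M : Type*} [TopologicalSpace M] [ChartedSpace Warped22.R4 M]
    [IsManifold (𝓡 4) ∞ M] (g : Warped22.LorentzMetric M)
    (hprod : Warped22.IsConfProduct g) (hflat : Warped22.NonConfFlat g) :
    (Warped22.IsWarped g ↔
      Warped22.Everywhere g (fun γ x => Warped22.phi γ x ≠ 0) ∧
      Warped22.Everywhere g (fun γ x => Warped22.starSPhi γ x = 0)) ∧
    (Warped22.IsWarped g ↔
      Warped22.Everywhere g (fun γ x => Warped22.phi γ x ≠ 0) ∧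
      Warped22.Everywhere g (fun γ x => Warped22.starWPhi γ x = 0)) ∧
    (Warped22.IsWarpedWide g ↔
      Warped22.Everywhere g (fun γ x => Warped22.starSPhi γ x = 0)) ∧
    (Warped22.IsWarpedWide g ↔
      Warped22.Everywhere g (fun γ x => Warped22.starWPhi γ x = 0)) := by
  -- Both notions of warping are instances of one statement, the condition `C` on dλ being
  -- nonvanishing or trivial.
  refine ⟨⟨fun hw => ?_, fun hw => ?_⟩, ⟨fun hw => ?_, fun hw => ?_⟩, ⟨fun hw => ?_, fun hw => ?_⟩,
    ⟨fun hw => ?_, fun hw => ?_⟩⟩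
  · obtain ⟨h1, _, h3⟩ := Warped22.concomitants_of_warped g hflat hw
    exact ⟨h3 fun _ h => h, h1⟩
  · exact Warped22.warped_of_concomitants g hprod hflat (Or.inl hw.2) (Or.inr ⟨fun _ h => h, hw.1⟩)
  · obtain ⟨_, h2, h3⟩ := Warped22.concomitants_of_warped g hflat hw
    exact ⟨h3 fun _ h => h, h2⟩
  · exact Warped22.warped_of_concomitants g hprod hflat (Or.inr hw.2) (Or.inr ⟨fun _ h => h, hw.1⟩)
  · exact (Warped22.concomitants_of_warped g hflat hw).1
  · exact Warped22.warped_of_concomitants g hprod hflat (Or.inl hw) (Or.inl fun _ => trivial)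
  · exact (Warped22.concomitants_of_warped g hflat hw).2.1
  · exact Warped22.warped_of_concomitants g hprod hflat (Or.inr hw) (Or.inl fun _ => trivial)
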